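/- **Conventions.** A *weakly toric monoid* is a finitely generated submonoid $P\subseteq\mathbb Z^k$ (some $k\ge 0$) that is saturated: if $p$ lies in the subgroup $P^{\rm gp}$ generated by $P$ and $np\in P$ for some $n\ge 1$, then $p\in P$. Its rank is the rank of $P^{\rm gp}$. Let $X_P$ be the set of monoid morphisms $x:(P,+)\to([0,\infty),\cdot)$, with the weakest topology making all the functions $\lambda_p(x)=x(p)$, $p\in P$, continuous. On an open $U\subseteq X_P$, a function to $\mathbb R$ is *smooth* if it is locally of the form $g(\lambda_{r_1},\dots,\lambda_{r_n})$ with $r_j\in P$ and $g$ smooth; a function to $[0,\infty)$ is *smooth* if near each point it is either $0$ or $\lambda_p\cdot h$ with $p\in P$ and $h>0$ smooth, and *interior* if it is always of the second form. A map from $U$ to an open subset of $X_Q$ is smooth (interior) if its composition with each $\lambda_q$, $q\in Q$, is smooth (interior). An *$n$-manifold with g-corners* is a second countable Hausdorff space with a maximal $n$-dimensional atlas of charts modelled on open subsets of spaces $X_P$, $P$ weakly toric of rank $n$, with transition maps smooth in both directions. Smooth and interior maps between such manifolds are continuous maps which are smooth, respectively interior, in charts; a *diffeomorphism* is a smooth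 bijection with smooth inverse. The *depth stratum* $S^k(X)$ is the set of $x\in X$ which in a chart to $X_P$ satisfy $\operatorname{rank}P-\operatorname{rank}\{p\in P:x(p)\ne 0\}=k$; it is a manifold without boundary. The *corners* $C(X)=\coprod_k C_k(X)$ is the set of pairs $(x,\gamma)$ with $\gamma$ a local connected component of $S^k(X)$ near $x$. It is a manifold with g-corners of mixed dimension: each chart of $X$ on $U\subseteq X_P$ and each face $F$ of $P$ give a chart on the preimage of $U$ in $X_F$, where $X_F\hookrightarrow X_P$ is extension by zero. One has $C_0(X)\cong X$, and a smooth map $f:X\to Y$ induces an interior map $C(f):C(X)\to C(Y)$, $(x,\gamma)\mapsto(f(x),f_*\gamma)$. Let $\tilde M_xX$ be the monoid of morphisms $\alpha$ from the multiplicative monoid of germs at $x$ of interior functions $c:X\to[0,\infty)$ to $(\mathbb N,+)$, such that $\alpha([c])=0$ if $c(x)>0$; for an interior map $f$, let $\tilde M_xf:\tilde M_xX\to\tilde M_{f(x)}Y$ be $\alpha\mapsto\alpha\circ f^*$. An interior map $f$ is an *interior immersion* if for all $x\in S^k(X)$ with $f(x)=y\in S^l(Y)$: (i) ${\rm d}(f|_{S^k(X)})|_x:T_xS^k(X)\to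 T_yS^l(Y)$ is injective; (ii) $\tilde M_xf$ is injective; (iii) the quotient monoid $\tilde M_yY/(\tilde M_xf)[\tilde M_xX]$ is torsion-free, i.e. its group completion is torsion-free. A smooth map $f:X\to Y$ is an *immersion* if $C(f)|_{C_0(X)}:X\cong C_0(X)\to C(Y)$ is an interior immersion (if $f$ is interior this just says that $f$ is an interior immersion). An *embedding* is an immersion which is a homeomorphism onto its image. **Corollary.** Let $i:X\to Y$ be an embedding of manifolds with g-corners. Then the subspace $i(X)\subseteq Y$ carries the structure of a manifold with g-corners of dimension $\dim X$, such that: (a) $i:X\to i(X)$ is a diffeomorphism, and this is the only structure of a manifold with g-corners on the topological space $i(X)$ with this property (if $X=\emptyset$, the only one of dimension $\dim X$); (b) the structure depends only on the subset $i(X)\subseteq Y$ and on the manifold with g-corners $Y$, and is independent of $i$ and $X$: if $i':X'\to Y$ is any embedding of a manifold with g-corners $X'$ with $i'(X')=i(X)$, then $i':X'\to i(X)$ is a diffeomorphism for the same structure. -/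

import Mathlib

open Set Filter Topology
open scoped NNReal ContDiff

universe u v w

noncomputable section

namespace GCorners

/-! ### Weakly toric monoids and the model spaces -/

section Monoids

variable {k : ℕ}

/-- The rank of a submonoid `P` of `ℤᵏ`: the rank of the group `P^gp ⊆ ℤᵏ` it generates. -/
def rank (P : AddSubmonoid (Fin k → ℤ)) : ℕ :=
  Module.finrank ℤ (AddSubgroup.closure (P : Set (Fin k → ℤ)))

/-- Weakly toric submonoids of `ℤᵏ`: finitely generated and saturated (a submonoid of `ℤᵏ` is
automatically integral and torsion-free). -/
structure IsWeaklyToric (P : AddSubmonoid (Fin k → ℤ)) : Prop where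
  fg : P.FG
  saturated : ∀ p ∈ AddSubgroup.closure (P : Set (Fin k → ℤ)), ∀ n : ℕ, 1 ≤ n → n • p ∈ P → p ∈ P

/-- `F` is a face of the monoid `P`. -/
structure IsFace (P F : AddSubmonoid (Fin k → ℤ)) : Prop where
  le : F ≤ P
  mem_of_add_mem : ∀ p ∈ P, ∀ q ∈ P, p + q ∈ F → p ∈ F ∧ q ∈ F

/-- The model space `X_P`: monoid morphisms `(P, +) → ([0, ∞), ·)`. -/
def ModelSpace (P : AddSubmonoid (Fin k → ℤ)) : Type := Multiplicative P →* ℝ≥0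

/-- The function `λ_p : X_P → [0, ∞)`, `λ_p x = x p`. -/
def lam {P : AddSubmonoid (Fin k → ℤ)} (p : P) (x : ModelSpace P) : ℝ≥0 :=
  DFunLike.coe (F := Multiplicative P →* ℝ≥0) x (Multiplicative.ofAdd p)

theorem lam_zero {P : AddSubmonoid (Fin k → ℤ)} (x : ModelSpace P) : lam 0 x = 1 :=
  MonoidHom.map_one x

theorem lam_add {P : AddSubmonoid (Fin k → ℤ)} (p q : P) (x : ModelSpace P) :
    lam (p + q) x = lam p x * lam q x :=
  MonoidHom.map_mul x (Multiplicative.ofAdd p) (Multiplicative.ofAdd q)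

/-- The weakest topology making all `λ_p` continuous. -/
instance (P : AddSubmonoid (Fin k → ℤ)) : TopologicalSpace (ModelSpace P) :=
  TopologicalSpace.induced (fun x (p : P) => lam p x) inferInstance

/-- The support `{p ∈ P : x p ≠ 0}` of a point `x` of `X_P`, a face of `P`. -/
def supp {P : AddSubmonoid (Fin k → ℤ)} (x : ModelSpace P) : AddSubmonoid (Fin k → ℤ) where
  carrier := {p | ∃ h : p ∈ P, lam ⟨p, h⟩ x ≠ 0}
  zero_mem' := ⟨P.zero_mem, by
    have h := lam_zero x
    change lam 0 x ≠ 0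
    rw [h]; exact one_ne_zero⟩
  add_mem' := by
    rintro p q ⟨hp, hp'⟩ ⟨hq, hq'⟩
    refine ⟨P.add_mem hp hq, ?_⟩
    have h := lam_add ⟨p, hp⟩ ⟨q, hq⟩ x
    change lam (⟨p, hp⟩ + ⟨q, hq⟩) x ≠ 0
    rw [h]; exact mul_ne_zero hp' hq'

/-- The depth of a point of `X_P`, i.e. the codimension of its support. -/
def modelDepth {P : AddSubmonoid (Fin k → ℤ)} (x : ModelSpace P) : ℕ := rank P - rank (supp x)

/-- Restriction of a morphism `P → [0, ∞)` to a submonoid `F ≤ P`. If `F` is a face, this is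
inverse to the inclusion `X_F → X_P` (extension by zero) on points supported in `F`. -/
def restrict {P F : AddSubmonoid (Fin k → ℤ)} (h : F ≤ P) (x : ModelSpace P) : ModelSpace F :=
  MonoidHom.comp x (AddMonoidHom.toMultiplicative (AddSubmonoid.inclusion h))

end Monoids

/-! ### Smooth functions in terms of a coordinate map

A chart is recorded by its coordinate map `e = φ⁻¹` to `X_P`, so that functions on open subsets of
`X_P` become functions on open subsets of the space `X`. -/

section Local

variable {k : ℕ} {X : Type u} [TopologicalSpace X] {P : AddSubmonoid (Fin k → ℤ)}

/-- `a` is, near `x`, a smooth real function of the coordinates `e`: `a = g(λ_{r₁}, …, λ_{rₙ})` with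
`r₁, …, rₙ ∈ P` and `g` smooth on an open subset of `ℝⁿ` (equivalently, by Seeley's theorem, on an
open subset of `[0, ∞)ⁿ`). -/
def SmoothRealAt (e : X → ModelSpace P) (x : X) (a : X → ℝ) : Prop :=
  ∃ (n : ℕ) (r : Fin n → P) (W : Set (Fin n → ℝ)) (g : (Fin n → ℝ) → ℝ),
    IsOpen W ∧ ContDiffOn ℝ ∞ g W ∧
    ∀ᶠ z in 𝓝 x, (fun j => (lam (r j) (e z) : ℝ)) ∈ W ∧ a z = g fun j => (lam (r j) (e z) : ℝ)

/-- `b` is, near `x`, of the form `λ_p · h` with `p ∈ P` and `h` smooth and positive. -/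
def InteriorAt (e : X → ModelSpace P) (x : X) (b : X → ℝ≥0) : Prop :=
  ∃ (p : P) (h : X → ℝ), SmoothRealAt e x h ∧
    ∀ᶠ z in 𝓝 x, 0 < h z ∧ (b z : ℝ) = (lam p (e z) : ℝ) * h z

/-- `b` is, near `x`, smooth as a `[0, ∞)`-valued function of the coordinates `e`: locally either
`λ_p · h` with `h` smooth and positive, or zero. -/
def SmoothNonnegAt (e : X → ModelSpace P) (x : X) (b : X → ℝ≥0) : Prop :=
  InteriorAt e x b ∨ ∀ᶠ z in 𝓝 x, b z = 0

end Local

section LocalLemmas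

variable {k : ℕ} {X : Type u} [TopologicalSpace X] {P : AddSubmonoid (Fin k → ℤ)}

/-- Smooth functions of smooth functions are smooth. -/
theorem SmoothRealAt.comp {e : X → ModelSpace P} {x : X} {m : ℕ} {a : Fin m → X → ℝ}
    (ha : ∀ j, SmoothRealAt e x (a j)) {W : Set (Fin m → ℝ)} {g : (Fin m → ℝ) → ℝ}
    (hW : IsOpen W) (hg : ContDiffOn ℝ ∞ g W) (hx : ∀ᶠ z in 𝓝 x, (fun j => a j z) ∈ W)
    {b : X → ℝ} (hb : ∀ᶠ z in 𝓝 x, b z = g fun j => a j z) : SmoothRealAt e x b := by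
  choose n r V f hV hf hz using ha
  let E : (Σ j, Fin (n j)) ≃ Fin (∑ j, n j) := finSigmaFinEquiv
  let pr : ∀ j, (Fin (∑ j, n j) → ℝ) → (Fin (n j) → ℝ) := fun j y l => y (E ⟨j, l⟩)
  have hpr : ∀ j, ContDiff ℝ ∞ (pr j) := fun j => contDiff_pi.2 fun l => contDiff_apply ℝ ℝ _
  let V' : Set (Fin (∑ j, n j) → ℝ) := ⋂ j, pr j ⁻¹' V j
  have hV' : IsOpen V' := isOpen_iInter_of_finite fun j => (hV j).preimage (hpr j).continuous
  let G : (Fin (∑ j, n j) → ℝ) → (Fin m → ℝ) := fun y j => f j (pr j y)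
  have hG : ContDiffOn ℝ ∞ G V' := contDiffOn_pi.2 fun j =>
    (hf j).comp (hpr j).contDiffOn fun y hy => mem_iInter.1 hy j
  refine ⟨∑ j, n j, fun i => r (E.symm i).1 (E.symm i).2, V' ∩ G ⁻¹' W, g ∘ G,
    hG.continuousOn.isOpen_inter_preimage hV' hW,
    hg.comp (hG.mono inter_subset_left) fun y hy => hy.2, ?_⟩
  filter_upwards [eventually_all.2 hz, hx, hb] with z hz hx hb
  have hp : ∀ j, pr j (fun i => (lam (r (E.symm i).1 (E.symm i).2) (e z) : ℝ)) =
      fun l => (lam (r j l) (e z) : ℝ) := by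
    intro j; funext l
    exact congrArg (fun s : Σ j, Fin (n j) => (lam (r s.1 s.2) (e z) : ℝ))
      (E.symm_apply_apply ⟨j, l⟩)
  have hGz : G (fun i => (lam (r (E.symm i).1 (E.symm i).2) (e z) : ℝ)) = fun j => a j z := by
    funext j
    simp only [G, hp]
    exact (hz j).2.symm
  refine ⟨⟨mem_iInter.2 fun j => ?_, ?_⟩, ?_⟩
  · rw [mem_preimage, hp]; exact (hz j).1
  · rw [mem_preimage, hGz]; exact hx
  · rw [Function.comp_apply, hGz]; exact hb

theorem SmoothRealAt.congr {e : X → ModelSpace P} {x : X} {a b : X → ℝ}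
    (ha : SmoothRealAt e x a) (h : ∀ᶠ z in 𝓝 x, b z = a z) : SmoothRealAt e x b := by
  obtain ⟨n, r, W, g, hW, hg, hz⟩ := ha
  exact ⟨n, r, W, g, hW, hg, by filter_upwards [hz, h] with z h1 h2; exact ⟨h1.1, h2.trans h1.2⟩⟩

theorem SmoothRealAt.const (e : X → ModelSpace P) (x : X) (t : ℝ) :
    SmoothRealAt e x fun _ => t :=
  ⟨0, Fin.elim0, univ, fun _ => t, isOpen_univ, contDiffOn_const, by simp⟩

theorem SmoothRealAt.add {e : X → ModelSpace P} {x : X} {a b : X → ℝ}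
    (ha : SmoothRealAt e x a) (hb : SmoothRealAt e x b) :
    SmoothRealAt e x fun z => a z + b z := by
  refine SmoothRealAt.comp (a := ![a, b]) (W := univ) (g := fun y => y 0 + y 1) ?_ isOpen_univ
    (by fun_prop) (by simp) (by simp)
  intro j; fin_cases j
  · exact ha
  · exact hb

theorem SmoothRealAt.mul {e : X → ModelSpace P} {x : X} {a b : X → ℝ}
    (ha : SmoothRealAt e x a) (hb : SmoothRealAt e x b) :
    SmoothRealAt e x fun z => a z * b z := by
  refine SmoothRealAt.comp (a := ![a, b]) (W := univ) (g := fun y => y 0 * y 1) ?_ isOpen_univ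
    (by fun_prop) (by simp) (by simp)
  intro j; fin_cases j
  · exact ha
  · exact hb

theorem SmoothRealAt.lam (e : X → ModelSpace P) (x : X) (p : P) :
    SmoothRealAt e x fun z => (lam p (e z) : ℝ) :=
  ⟨1, fun _ => p, univ, fun y => y 0, isOpen_univ, by fun_prop, by simp⟩

theorem InteriorAt.smoothReal {e : X → ModelSpace P} {x : X} {b : X → ℝ≥0}
    (hb : InteriorAt e x b) : SmoothRealAt e x fun z => (b z : ℝ) := by
  obtain ⟨p, h, hh, hz⟩ := hb
  exact ((SmoothRealAt.lam e x p).mul hh).congr (hz.mono fun z hz => hz.2)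

theorem InteriorAt.mul {e : X → ModelSpace P} {x : X} {b c : X → ℝ≥0}
    (hb : InteriorAt e x b) (hc : InteriorAt e x c) : InteriorAt e x fun z => b z * c z := by
  obtain ⟨p, h, hh, hz⟩ := hb
  obtain ⟨p', h', hh', hz'⟩ := hc
  refine ⟨p + p', fun z => h z * h' z, hh.mul hh', ?_⟩
  filter_upwards [hz, hz'] with z h1 h2
  refine ⟨mul_pos h1.1 h2.1, ?_⟩
  rw [lam_add, NNReal.coe_mul, NNReal.coe_mul, h1.2, h2.2]
  ring

theorem InteriorAt.one (e : X → ModelSpace P) (x : X) : InteriorAt e x fun _ => 1 :=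
  ⟨0, fun _ => 1, SmoothRealAt.const e x 1, by simp [lam_zero]⟩

end LocalLemmas

/-! ### Generalized charts -/

/-- The data of a g-chart `(P, U, φ)` on `X`, recorded by the set `source = φ(U)` and the coordinate
map `coord = φ⁻¹ : φ(U) → U ⊆ X_P` (its values outside `source` are irrelevant). -/
structure GChart (X : Type u) where
  k : ℕ
  P : AddSubmonoid (Fin k → ℤ)
  source : Set X
  coord : X → ModelSpace P

/-- `c` is an `n`-dimensional g-chart on `X`. -/
structure GChart.IsChart {X : Type u} [TopologicalSpace X] (c : GChart X) (n : ℕ) : Prop where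
  weaklyToric : IsWeaklyToric c.P
  rank_eq : rank c.P = n
  isOpen_source : IsOpen c.source
  /-- `φ⁻¹` is a homeomorphism from `φ(U)` onto an open subset of `X_P`. -/
  isOpenEmbedding : IsOpenEmbedding (c.source.domRestrict c.coord)

/-- Compatibility: the transition maps between `c` and `d`, in both directions, are smooth. -/
def GChart.Compatible {X : Type u} [TopologicalSpace X] (c d : GChart X) : Prop :=
  ∀ x ∈ c.source ∩ d.source,
    (∀ q : d.P, SmoothNonnegAt c.coord x fun z => lam q (d.coord z)) ∧
    (∀ p : c.P, SmoothNonnegAt d.coord x fun z => lam p (c.coord z))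

/-- A topological space with a set of charts. The notions below are defined for arbitrary chart
families, so that they apply both to manifolds with g-corners and to their corners, which have mixed
dimension. -/
structure GSpace (X : Type u) where
  charts : Set (GChart X)

/-- The structure of a manifold with g-corners on the topological space `X`: a dimension and a
maximal g-atlas of that dimension. -/
structure GManifold (X : Type u) [TopologicalSpace X] extends GSpace X where
  t2 : T2Space X
  secondCountable : SecondCountableTopology X
  dim : ℕ
  isChart : ∀ c ∈ charts, c.IsChart dim
  compatible : ∀ c ∈ charts, ∀ d ∈ charts, c.Compatible d
  cover : ∀ x : X, ∃ c ∈ charts, x ∈ c.source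
  maximal : ∀ c : GChart X, c.IsChart dim → (∀ d ∈ charts, c.Compatible d) → c ∈ charts

/-! ### Smooth maps, interior maps, diffeomorphisms -/

section Maps

variable {X : Type u} {Y : Type v} [TopologicalSpace X] [TopologicalSpace Y]

/-- Smooth maps: continuous, and smooth in all charts. -/
def IsSmooth (𝒳 : GSpace X) (𝒴 : GSpace Y) (f : X → Y) : Prop :=
  Continuous f ∧ ∀ x, ∀ c ∈ 𝒳.charts, x ∈ c.source → ∀ d ∈ 𝒴.charts, f x ∈ d.source →
    ∀ q : d.P, SmoothNonnegAt c.coord x fun z => lam q (d.coord (f z))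

/-- `f` is an interior smooth map near `x`: in charts, the functions `λ_q ∘ f` are of the form
`λ_p · h` with `h` smooth and positive (the case of a function vanishing near `x` does not occur).
That `f x` lies in some chart is automatic when the charts of `Y` cover `Y`. -/
structure IsInteriorAt (𝒳 : GSpace X) (𝒴 : GSpace Y) (f : X → Y) (x : X) : Prop where
  continuousAt : ContinuousAt f x
  covered : ∃ d ∈ 𝒴.charts, f x ∈ d.source
  interior : ∀ c ∈ 𝒳.charts, x ∈ c.source → ∀ d ∈ 𝒴.charts, f x ∈ d.source →
    ∀ q : d.P, InteriorAt c.coord x fun z => lam q (d.coord (f z))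

/-- Diffeomorphisms: smooth bijections with smooth inverse. -/
def IsDiffeo (𝒳 : GSpace X) (𝒴 : GSpace Y) (f : X → Y) : Prop :=
  ∃ g : X ≃ Y, ⇑g = f ∧ IsSmooth 𝒳 𝒴 g ∧ IsSmooth 𝒴 𝒳 g.symm

end Maps

/-! ### Germs, tangent spaces, depth strata -/

section Germs

variable {X : Type u} {Y : Type v} [TopologicalSpace X] [TopologicalSpace Y]

/-- `C^∞_x(X)`: germs at `x` of smooth functions to `ℝ`. -/
def smoothGerms (𝒳 : GSpace X) (x : X) : Submodule ℝ (Germ (𝓝 x) ℝ) where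
  carrier := {φ | ∃ a : X → ℝ, (a : Germ (𝓝 x) ℝ) = φ ∧
    ∀ c ∈ 𝒳.charts, x ∈ c.source → SmoothRealAt c.coord x a}
  zero_mem' := ⟨fun _ => 0, rfl, fun c _ _ => SmoothRealAt.const c.coord x 0⟩
  add_mem' := by
    rintro _ _ ⟨a, rfl, ha⟩ ⟨b, rfl, hb⟩
    exact ⟨fun z => a z + b z, rfl, fun c hc hx => (ha c hc hx).add (hb c hc hx)⟩
  smul_mem' := by
    rintro t _ ⟨a, rfl, ha⟩
    exact ⟨fun z => t * a z, rfl, fun c hc hx =>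
      (SmoothRealAt.const c.coord x t).mul (ha c hc hx)⟩

theorem smoothGerms_mul_mem {𝒳 : GSpace X} {x : X} {φ ψ : Germ (𝓝 x) ℝ}
    (hφ : φ ∈ smoothGerms 𝒳 x) (hψ : ψ ∈ smoothGerms 𝒳 x) : φ * ψ ∈ smoothGerms 𝒳 x := by
  obtain ⟨a, rfl, ha⟩ := hφ
  obtain ⟨b, rfl, hb⟩ := hψ
  exact ⟨fun z => a z * b z, rfl, fun c hc hx => (ha c hc hx).mul (hb c hc hx)⟩

/-- The monoid `I_x(X)` of germs at `x` of interior functions to `[0, ∞)`, under multiplication. -/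
def interiorGerms (𝒳 : GSpace X) (x : X) : Submonoid (Germ (𝓝 x) ℝ≥0) where
  carrier := {φ | ∃ b : X → ℝ≥0, (b : Germ (𝓝 x) ℝ≥0) = φ ∧
    ∀ c ∈ 𝒳.charts, x ∈ c.source → InteriorAt c.coord x b}
  one_mem' := ⟨fun _ => 1, rfl, fun c _ _ => InteriorAt.one c.coord x⟩
  mul_mem' := by
    rintro _ _ ⟨a, rfl, ha⟩ ⟨b, rfl, hb⟩
    exact ⟨fun z => a z * b z, rfl, fun c hc hx => (ha c hc hx).mul (hb c hc hx)⟩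

/-- The depth `k` stratum `S^k(X)`. -/
def stratum (𝒳 : GSpace X) (k : ℕ) : Set X :=
  {x | ∃ c ∈ 𝒳.charts, x ∈ c.source ∧ modelDepth (c.coord x) = k}

/-- The tangent space `T_x X`: derivations `C^∞_x(X) → ℝ` over evaluation at `x`. -/
def tangentSpace (𝒳 : GSpace X) (x : X) : Submodule ℝ (smoothGerms 𝒳 x →ₗ[ℝ] ℝ) where
  carrier := {v | ∀ φ ψ : smoothGerms 𝒳 x,
    v ⟨φ.1 * ψ.1, smoothGerms_mul_mem φ.2 ψ.2⟩ = v φ * ψ.1.value + φ.1.value * v ψ}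
  zero_mem' := by intro φ ψ; simp
  add_mem' := by
    intro v w hv hw φ ψ
    simp only [LinearMap.add_apply, hv φ ψ, hw φ ψ]
    ring
  smul_mem' := by
    intro t v hv φ ψ
    simp only [LinearMap.smul_apply, hv φ ψ, smul_eq_mul]
    ring

/-- The tangent space `T_x S^k(X)` of the stratum through `x`, as the subspace of those `v ∈ T_x X`
which kill all germs vanishing on `S^k(X)` near `x`. (Every smooth function on the locally closed
submanifold `S^k(X)` extends locally to a smooth function on `X`, so these are the derivations of
germs of smooth functions on `S^k(X)`.) -/
def tangentStratum (𝒳 : GSpace X) (k : ℕ) (x : X) :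
    Submodule ℝ (smoothGerms 𝒳 x →ₗ[ℝ] ℝ) where
  carrier := {v | v ∈ tangentSpace 𝒳 x ∧ ∀ (a : X → ℝ) (ha : (a : Germ (𝓝 x) ℝ) ∈ smoothGerms 𝒳 x),
    (∀ᶠ z in 𝓝[stratum 𝒳 k] x, a z = 0) → v ⟨a, ha⟩ = 0}
  zero_mem' := ⟨Submodule.zero_mem _, by intros; rfl⟩
  add_mem' := by
    rintro v w ⟨hv, hv'⟩ ⟨hw, hw'⟩
    refine ⟨Submodule.add_mem _ hv hw, fun a ha h => ?_⟩
    rw [LinearMap.add_apply, hv' a ha h, hw' a ha h, add_zero]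
  smul_mem' := by
    rintro t v ⟨hv, hv'⟩
    refine ⟨Submodule.smul_mem _ t hv, fun a ha h => ?_⟩
    rw [LinearMap.smul_apply, hv' a ha h, smul_zero]

/-- The monoid `M̃_x X` of monoid morphisms `α : I_x(X) → ℕ` with `α [c] = 0` if `c x > 0`. -/
def tildeM (𝒳 : GSpace X) (x : X) : AddSubmonoid (Additive (interiorGerms 𝒳 x) →+ ℕ) where
  carrier := {α | ∀ φ : interiorGerms 𝒳 x, 0 < φ.1.value → α (Additive.ofMul φ) = 0}
  zero_mem' := by intro φ _; rfl
  add_mem' := by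
    intro α β hα hβ φ h
    rw [AddMonoidHom.add_apply, hα φ h, hβ φ h]

variable {𝒳 : GSpace X} {𝒴 : GSpace Y} {f : X → Y} {x : X}

theorem IsInteriorAt.smoothReal_comp (hf : IsInteriorAt 𝒳 𝒴 f x) {a : Y → ℝ} {d : GChart Y}
    (hd : d ∈ 𝒴.charts) (hd' : f x ∈ d.source) (ha : SmoothRealAt d.coord (f x) a)
    {c : GChart X} (hc : c ∈ 𝒳.charts) (hc' : x ∈ c.source) :
    SmoothRealAt c.coord x fun z => a (f z) := by
  obtain ⟨n, r, W, g, hW, hg, hz⟩ := ha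
  have hz' := hf.continuousAt.eventually hz
  exact SmoothRealAt.comp (fun j => (hf.interior c hc hc' d hd hd' (r j)).smoothReal) hW hg
    (hz'.mono fun z h => h.1) (hz'.mono fun z h => h.2)

theorem IsInteriorAt.smoothGerms_comp (hf : IsInteriorAt 𝒳 𝒴 f x) {φ : Germ (𝓝 (f x)) ℝ}
    (hφ : φ ∈ smoothGerms 𝒴 (f x)) : φ.compTendsto f hf.continuousAt ∈ smoothGerms 𝒳 x := by
  obtain ⟨a, rfl, ha⟩ := hφ
  obtain ⟨d, hd, hd'⟩ := hf.covered
  exact ⟨fun z => a (f z), rfl, fun c hc hc' => hf.smoothReal_comp hd hd' (ha d hd hd') hc hc'⟩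

theorem IsInteriorAt.interiorGerms_comp (hf : IsInteriorAt 𝒳 𝒴 f x) {φ : Germ (𝓝 (f x)) ℝ≥0}
    (hφ : φ ∈ interiorGerms 𝒴 (f x)) : φ.compTendsto f hf.continuousAt ∈ interiorGerms 𝒳 x := by
  obtain ⟨b, rfl, hb⟩ := hφ
  obtain ⟨d, hd, hd'⟩ := hf.covered
  refine ⟨fun z => b (f z), rfl, fun c hc hc' => ?_⟩
  obtain ⟨q, h, hh, hz⟩ := hb d hd hd'
  obtain ⟨p, h', hh', hz'⟩ := hf.interior c hc hc' d hd hd' q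
  refine ⟨p, fun z => h' z * h (f z), hh'.mul (hf.smoothReal_comp hd hd' hh hc hc'), ?_⟩
  filter_upwards [hz', hf.continuousAt.eventually hz] with z h1 h2
  refine ⟨mul_pos h1.1 h2.1, ?_⟩
  rw [h2.2, h1.2, mul_assoc]

/-- Pullback of smooth germs `f^* : C^∞_{f x}(Y) → C^∞_x(X)`, `[a] ↦ [a ∘ f]`. -/
def smoothPullback (hf : IsInteriorAt 𝒳 𝒴 f x) : smoothGerms 𝒴 (f x) →ₗ[ℝ] smoothGerms 𝒳 x where
  toFun φ := ⟨φ.1.compTendsto f hf.continuousAt, hf.smoothGerms_comp φ.2⟩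
  map_add' φ ψ := Subtype.ext <| by
    obtain ⟨_, a, rfl, _⟩ := φ
    obtain ⟨_, b, rfl, _⟩ := ψ
    rfl
  map_smul' t φ := Subtype.ext <| by
    obtain ⟨_, a, rfl, _⟩ := φ
    rfl

/-- Pullback of interior germs `f^* : I_{f x}(Y) → I_x(X)`, `[b] ↦ [b ∘ f]`. -/
def interiorPullback (hf : IsInteriorAt 𝒳 𝒴 f x) :
    interiorGerms 𝒴 (f x) →* interiorGerms 𝒳 x where
  toFun φ := ⟨φ.1.compTendsto f hf.continuousAt, hf.interiorGerms_comp φ.2⟩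
  map_one' := rfl
  map_mul' φ ψ := Subtype.ext <| by
    obtain ⟨_, a, rfl, _⟩ := φ
    obtain ⟨_, b, rfl, _⟩ := ψ
    rfl

/-- The differential `df|_x`, `v ↦ v ∘ f^*`. -/
def differential (hf : IsInteriorAt 𝒳 𝒴 f x) :
    (smoothGerms 𝒳 x →ₗ[ℝ] ℝ) →ₗ[ℝ] (smoothGerms 𝒴 (f x) →ₗ[ℝ] ℝ) :=
  LinearMap.lcomp ℝ ℝ (smoothPullback hf)

/-- The monoid morphism `M̃_x f : M̃_x X → M̃_{f x} Y`, `α ↦ α ∘ f^*`. -/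
def tildeMap (hf : IsInteriorAt 𝒳 𝒴 f x) : tildeM 𝒳 x →+ tildeM 𝒴 (f x) where
  toFun α := ⟨α.1.comp (MonoidHom.toAdditive (interiorPullback hf)), by
    intro φ hφ
    refine α.2 (interiorPullback hf φ) ?_
    obtain ⟨_, b, rfl, _⟩ := φ
    exact hφ⟩
  map_zero' := rfl
  map_add' _ _ := rfl

end Germs

/-- The congruence on a commutative monoid `M` defining the quotient monoid `M/N`:
`p ∼ p'` if and only if `p + q = p' + q'` for some `q, q' ∈ N`. -/
def quotientCon {M : Type*} [AddCommMonoid M] (N : AddSubmonoid M) : AddCon M where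
  r p p' := ∃ q ∈ N, ∃ q' ∈ N, p + q = p' + q'
  iseqv :=
    { refl := fun p => ⟨0, N.zero_mem, 0, N.zero_mem, rfl⟩
      symm := fun ⟨q, hq, q', hq', h⟩ => ⟨q', hq', q, hq, h.symm⟩
      trans := by
        rintro a b c ⟨q, hq, q', hq', h⟩ ⟨s, hs, s', hs', h'⟩
        refine ⟨q + s, N.add_mem hq hs, s' + q', N.add_mem hs' hq', ?_⟩
        rw [← add_assoc, h, add_right_comm, h', add_assoc] }
  add' := by
    rintro a b c d ⟨q, hq, q', hq', h⟩ ⟨s, hs, s', hs', h'⟩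
    refine ⟨q + s, N.add_mem hq hs, q' + s', N.add_mem hq' hs', ?_⟩
    rw [add_add_add_comm, h, h', add_add_add_comm]

/-- A commutative monoid is called torsion-free if its group completion is torsion-free. -/
def IsTorsionFreeMonoid (M : Type*) [AddCommMonoid M] : Prop :=
  IsAddTorsionFree (Algebra.GrothendieckAddGroup M)

/-- Interior immersions: interior maps such that, for `x ∈ S^k(X)`, the differential is injective on
`T_x S^k(X)`, the morphism `M̃_x f` is injective, and `M̃_{f x} Y / M̃_x f (M̃_x X)` is
torsion-free. -/
def IsInteriorImmersion {X : Type u} {Y : Type v} [TopologicalSpace X] [TopologicalSpace Y]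
    (𝒳 : GSpace X) (𝒴 : GSpace Y) (f : X → Y) : Prop :=
  ∀ x, ∃ hf : IsInteriorAt 𝒳 𝒴 f x,
    (∀ k, x ∈ stratum 𝒳 k → InjOn (differential hf) (tangentStratum 𝒳 k x)) ∧
    Function.Injective (tildeMap hf) ∧
    IsTorsionFreeMonoid (quotientCon (AddMonoidHom.mrange (tildeMap hf))).Quotient

/-! ### Corners, immersions, embeddings -/

section Corners

variable {X : Type u} {Y : Type v} [TopologicalSpace X] [TopologicalSpace Y]

/-- A local `k`-corner component of `X` at `x`: a compatible choice, for the open neighbourhoods `V`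
of `x`, of a connected component of `V ∩ S^k(X)` having `x` in its closure. -/
structure LocalCorner (𝒳 : GSpace X) (k : ℕ) (x : X) where
  comp : TopologicalSpace.OpenNhdsOf x → Set X
  isComponent : ∀ V : TopologicalSpace.OpenNhdsOf x, ∃ z ∈ (V : Set X) ∩ stratum 𝒳 k,
    comp V = connectedComponentIn ((V : Set X) ∩ stratum 𝒳 k) z
  mem_closure : ∀ V, x ∈ closure (comp V)
  compat : ∀ V V', x ∈ closure (comp V ∩ comp V')

/-- The corners `C(X) = ∐_k C_k(X)`, the set of points `(x, γ)` with `γ` a local `k`-corner component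
of `X` at `x`, for some `k`. -/
def Corners (𝒳 : GSpace X) : Type u := Σ x : X, Σ k : ℕ, LocalCorner 𝒳 k x

/-- The chart of `C(X)` defined by a chart `(P, U, φ)` of `X` and a face `F` of `P`. It contains
`(x, γ)` if `x ∈ φ(U)` is supported in `F` and `γ` is the local component determined by the stratum
`X^P_F = {supp = F}`; the coordinates of `(x, γ)` are those of `x`, as a point of `X_F ⊆ X_P`. -/
def cornerChart (𝒳 : GSpace X) (c : GChart X) {F : AddSubmonoid (Fin c.k → ℤ)} (h : F ≤ c.P) :
    GChart (Corners 𝒳) where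
  k := c.k
  P := F
  source := {ξ | ξ.1 ∈ c.source ∧ supp (c.coord ξ.1) ≤ F ∧
    ∀ V, (ξ.2.2.comp V ∩ {z | z ∈ c.source ∧ supp (c.coord z) = F}).Nonempty}
  coord := fun ξ => restrict h (c.coord ξ.1)

/-- `C(X)` with the charts coming from the charts of `X`. -/
def cornersSpace (𝒳 : GSpace X) : GSpace (Corners 𝒳) where
  charts := {e | ∃ c ∈ 𝒳.charts, ∃ (F : AddSubmonoid (Fin c.k → ℤ)) (h : IsFace c.P F),
    e = cornerChart 𝒳 c h.le}

/-- The topology of `C(X)`, for which the charts are homeomorphisms with open sets: it is generated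
by the preimages of open sets under the charts. -/
instance (𝒳 : GSpace X) : TopologicalSpace (Corners 𝒳) :=
  TopologicalSpace.generateFrom {O | ∃ e ∈ (cornersSpace 𝒳).charts, ∃ T : Set (ModelSpace e.P),
    IsOpen T ∧ O = e.source ∩ e.coord ⁻¹' T}

/-- `δ = f_* γ`, for `γ` a local corner component of `X` at `x` and `δ` one of `Y` at `f x`: the
components determined by `δ` meet the images of the components determined by `γ`. -/
def PushesTo {𝒳 : GSpace X} {𝒴 : GSpace Y} (f : X → Y) {x : X} {k l : ℕ}
    (γ : LocalCorner 𝒳 k x) (δ : LocalCorner 𝒴 l (f x)) : Prop :=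
  ∀ (V : TopologicalSpace.OpenNhdsOf x) (V' : TopologicalSpace.OpenNhdsOf (f x)),
    (δ.comp V' ∩ f '' γ.comp V).Nonempty

/-- A smooth map `f : X → Y` is an immersion if the map `C(f)|_{C_0(X)} : X ≅ C_0(X) → C(Y)`, given by
`x ↦ (f x, f_* [X°])` with `[X°]` the `0`-corner component of `X` at `x`, is an interior
immersion. -/
def IsImmersion (𝒳 : GSpace X) (𝒴 : GSpace Y) (f : X → Y) : Prop :=
  IsSmooth 𝒳 𝒴 f ∧ ∃ δ : ∀ x, Σ l : ℕ, LocalCorner 𝒴 l (f x),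
    (∀ x, ∃ γ : LocalCorner 𝒳 0 x, PushesTo f γ (δ x).2) ∧
    IsInteriorImmersion 𝒳 (cornersSpace 𝒴) fun x => (⟨f x, δ x⟩ : Corners 𝒴)

/-- Embeddings: immersions which are homeomorphisms onto their images. -/
def IsEmbedding (𝒳 : GSpace X) (𝒴 : GSpace Y) (f : X → Y) : Prop :=
  IsImmersion 𝒳 𝒴 f ∧ Topology.IsEmbedding f

end Corners

end GCorners

end

open Set Filter Topology
open scoped NNReal ContDiff

noncomputable section

namespace GCorners

/-! ### Linear inequalities -/

/-! The structure on `i(X)` is that of `X`, transported along the homeomorphism `X ≅ i(X)`. Any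
other structure making `i` a diffeomorphism has charts compatible with the transported ones.
Dimensions agree because transition maps have injective derivatives at interior points
(`GChart.IsChart.dim_eq`), so the two maximal atlases coincide
(`GManifold.eq_transport_of_isDiffeo`).

The substance is independence of `i`. Two embeddings with the same image differ by a homeomorphism
`h : X' → X` with `i ∘ h = i'` smooth, and `h` must be shown smooth (`isSmooth_of_comp_immersion`);
the inverse is handled by symmetry. Passing to `f : X → C(Y)`, which is an interior immersion,
reduces this to the local statement `interiorAt_of_comp_immersion`.

Locally the immersion conditions act as follows. Interior germs at `x` have exponents in the
quotient of `P^gp` by the group of the support, and (ii) and (iii) together say that exponents of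
pullbacks from the target generate this group (`closure_exponents_eq_top`). Otherwise a functional
nonzero modulo a prime `p` but divisible by `p` on pullbacks would give an element of `M̃_x X` whose
image is `p` times something, contradicting torsion-freeness and injectivity. Hence each coordinate
`λ` of `X` satisfies `λ · H = F_q / F_r` with `H > 0` smooth and `F_q`, `F_r` pullbacks
(`exists_quotient_of_pullbacks`). On `X'` the pullbacks of `F_q`, `F_r` are interior and the
quotient is continuous, so it is interior (`GChart.IsChart.exists_eq_lam_mul`); this uses
saturation, through Farkas' lemma, and density of interior points.

It remains to remove `H ∘ h`, not yet known to be smooth. Near `x`, let `κ` be the coordinates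
vanishing at `x` and `y` logarithmic coordinates along the stratum. The functions `κ H` and `F` have
smooth pullbacks to `X'`. By (i) and positivity of `H`, the map `(κ, y) ↦ (κ H, F, y - R y)` has
injective derivative, so a smooth left inverse recovers `(κ, y) ∘ h`. Thus `h` pulls smooth
functions back to smooth functions, and dividing by `H ∘ h` finishes. -/

/-- Farkas' lemma over an ordered field, for finitely many linear functionals. -/
theorem farkas {K V ι : Type*} [Field K] [LinearOrder K] [IsStrictOrderedRing K] [AddCommGroup V]
    [Module K V] (s : Finset ι) : ∀ (a : ι → Module.Dual K V) (b : Module.Dual K V),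
    (∀ x, (∀ i ∈ s, 0 ≤ a i x) → 0 ≤ b x) →
      ∃ c : ι → K, (∀ i, 0 ≤ c i) ∧ b = ∑ i ∈ s, c i • a i := by
  classical
  induction s using Finset.induction_on with
  | empty =>
    intro a b h
    refine ⟨0, fun _ => le_rfl, ?_⟩
    ext x
    have h1 := h x (by simp)
    have h2 := h (-x) (by simp)
    rw [map_neg] at h2
    simp only [Finset.sum_empty, LinearMap.zero_apply]
    linarith
  | insert j s hj ih =>
    intro a b h
    by_cases hb : ∀ x, (∀ i ∈ s, 0 ≤ a i x) → 0 ≤ b x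
    · obtain ⟨c, hc, hbc⟩ := ih a b hb
      refine ⟨Function.update c j 0, fun i => ?_, ?_⟩
      · by_cases hi : i = j
        · subst hi; simp
        · simp [hi, hc i]
      · rw [Finset.sum_insert hj, Function.update_self, zero_smul, zero_add, hbc]
        refine Finset.sum_congr rfl fun i hi => ?_
        rw [Function.update_of_ne (ne_of_mem_of_not_mem hi hj)]
    · push Not at hb
      obtain ⟨y, hy, hyb⟩ := hb
      have hyj : a j y < 0 := by
        by_contra! hc
        refine absurd (h y fun i hi => ?_) (not_le.2 hyb)
        rcases Finset.mem_insert.1 hi with rfl | hi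
        · exact hc
        · exact hy i hi
      -- With `a j z = -1`, the map `x ↦ x + a j x • z` is the projection onto the kernel of `a j`
      -- along `z`. The induction hypothesis is applied to `a i` and `b` composed with this
      -- projection.
      set z : V := (-(a j y)⁻¹) • y with hz
      have hpos : 0 < -(a j y)⁻¹ := by
        have := inv_lt_zero.2 hyj; linarith
      have hzj : a j z = -1 := by
        rw [hz, map_smul, smul_eq_mul, neg_mul, inv_mul_cancel₀ hyj.ne]
      have hzi : ∀ i ∈ s, 0 ≤ a i z := fun i hi => by
        rw [hz, map_smul, smul_eq_mul]; exact mul_nonneg hpos.le (hy i hi)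
      have hzb : b z ≤ 0 := by
        rw [hz, map_smul, smul_eq_mul]; exact mul_nonpos_of_nonneg_of_nonpos hpos.le hyb.le
      obtain ⟨c, hc, hbc⟩ := ih (fun i => a i + a i z • a j) (b + b z • a j) (by
        intro x hx
        have := h (x + a j x • z) (by
          intro i hi
          rcases Finset.mem_insert.1 hi with rfl | hi
          · simp [hzj]
          · have := hx i hi
            simp only [LinearMap.add_apply, LinearMap.smul_apply, smul_eq_mul] at this
            simp only [map_add, map_smul, smul_eq_mul]
            linarith [mul_comm (a i z) (a j x)])
        simp only [map_add, map_smul, smul_eq_mul] at this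
        simp only [LinearMap.add_apply, LinearMap.smul_apply, smul_eq_mul]
        linarith [mul_comm (b z) (a j x)])
      -- The coefficient of `a j` is read off by expanding `hbc`; it is nonnegative because `b z ≤ 0
      -- ≤ a i z`.
      refine ⟨Function.update c j (∑ i ∈ s, c i * a i z - b z), fun i => ?_, ?_⟩
      · by_cases hi : i = j
        · subst hi
          rw [Function.update_self]
          have : 0 ≤ ∑ i ∈ s, c i * a i z :=
            Finset.sum_nonneg fun i hi => mul_nonneg (hc i) (hzi i hi)
          linarith
        · simp [hi, hc i]
      · rw [Finset.sum_insert hj, Function.update_self]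
        have e1 : ∑ i ∈ s, Function.update c j (∑ i ∈ s, c i * a i z - b z) i • a i =
            ∑ i ∈ s, c i • a i := Finset.sum_congr rfl fun i hi => by
          rw [Function.update_of_ne (ne_of_mem_of_not_mem hi hj)]
        rw [e1]
        ext x
        have := congrArg (fun l : Module.Dual K V => l x) hbc
        simp only [LinearMap.add_apply, LinearMap.smul_apply, smul_eq_mul,
          LinearMap.coe_sum, Finset.sum_apply, mul_add, Finset.sum_add_distrib] at this
        simp only [LinearMap.add_apply, LinearMap.smul_apply, smul_eq_mul, LinearMap.coe_sum,
          Finset.sum_apply]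
        have e2 : ∑ i ∈ s, c i * (a i z * a j x) = (∑ i ∈ s, c i * a i z) * a j x := by
          rw [Finset.sum_mul]; exact Finset.sum_congr rfl fun i _ => by ring
        rw [e2] at this
        linear_combination this

theorem exists_nat_mul_eq_intCast {ι : Type*} (s : Finset ι) (x : ι → ℚ) :
    ∃ N : ℕ, 0 < N ∧ ∀ i ∈ s, ∃ z : ℤ, (N : ℚ) * x i = z := by
  refine ⟨∏ i ∈ s, (x i).den, Finset.prod_pos fun i _ => (x i).pos, fun i hi => ?_⟩
  obtain ⟨m, hm⟩ := Finset.dvd_prod_of_mem (fun i => (x i).den) hi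
  refine ⟨m * (x i).num, ?_⟩
  rw [hm]
  push_cast
  have := Rat.mul_den_eq_num (x i)
  linear_combination (m : ℚ) * this

variable {k : ℕ}

/-- The integral form of Farkas' lemma: the saturation of a finitely generated submonoid of `ℤᵏ` in
`ℤᵏ` is cut out by integral linear inequalities. -/
theorem exists_nsmul_mem_closure (G : Finset (Fin k → ℤ)) (b : Fin k → ℤ)
    (h : ∀ a : Fin k → ℤ, (∀ g ∈ G, 0 ≤ a ⬝ᵥ g) → 0 ≤ a ⬝ᵥ b) :
    ∃ n : ℕ, 1 ≤ n ∧ n • b ∈ AddSubmonoid.closure (G : Set (Fin k → ℤ)) := by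
  classical
  let L : (Fin k → ℤ) → Module.Dual ℚ (Fin k → ℚ) := fun g =>
    ∑ i, (g i : ℚ) • LinearMap.proj i
  have hL : ∀ g x, L g x = ∑ i, (g i : ℚ) * x i := fun g x => by
    simp [L, LinearMap.coe_sum]
  obtain ⟨c, hc, hbc⟩ := farkas G L (L b) (by
    intro x hx
    obtain ⟨N, hN, hz⟩ := exists_nat_mul_eq_intCast Finset.univ x
    choose z hz using fun i => hz i (Finset.mem_univ i)
    have key : ∀ g, ((z ⬝ᵥ g : ℤ) : ℚ) = N * L g x := by
      intro g
      rw [hL, dotProduct, Finset.mul_sum]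
      push_cast
      refine Finset.sum_congr rfl fun i _ => ?_
      rw [← hz i]; ring
    have hN' : (0 : ℚ) < N := by exact_mod_cast hN
    have := h z fun g hg => by
      have : (0 : ℚ) ≤ ((z ⬝ᵥ g : ℤ) : ℚ) := by
        rw [key]; exact mul_nonneg hN'.le (hx g hg)
      exact_mod_cast this
    have h2 : (0 : ℚ) ≤ ((z ⬝ᵥ b : ℤ) : ℚ) := by exact_mod_cast this
    rw [key] at h2
    exact nonneg_of_mul_nonneg_right h2 hN')
  -- A common denominator of the rational Farkas coefficients is the required multiple.
  obtain ⟨N, hN, hz⟩ := exists_nat_mul_eq_intCast G c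
  have hn : ∀ g ∈ G, ∃ n : ℕ, (N : ℚ) * c g = n := fun g hg => by
    obtain ⟨z, hz⟩ := hz g hg
    have : (0 : ℚ) ≤ z := hz ▸ mul_nonneg (Nat.cast_nonneg _) (hc g)
    have h0 : 0 ≤ z := by exact_mod_cast this
    exact ⟨z.toNat, by rw [hz]; exact_mod_cast (Int.toNat_of_nonneg h0).symm⟩
  choose! n hn using hn
  refine ⟨N, hN, ?_⟩
  have : N • b = ∑ g ∈ G, n g • g := by
    funext i
    have h1 := congrArg (fun l : Module.Dual ℚ (Fin k → ℚ) => l (Pi.single i 1)) hbc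
    simp only [LinearMap.coe_sum, Finset.sum_apply, LinearMap.smul_apply, hL, smul_eq_mul,
      Pi.single_apply, mul_ite, mul_one, mul_zero, Finset.sum_ite_eq', Finset.mem_univ,
      if_true] at h1
    have h2 : ((N * b i : ℤ) : ℚ) = ((∑ g ∈ G, n g * g i : ℤ) : ℚ) := by
      push_cast
      rw [h1, Finset.mul_sum]
      refine Finset.sum_congr rfl fun g hg => ?_
      rw [← hn g hg]; ring
    have h3 : (N * b i : ℤ) = ∑ g ∈ G, n g * g i := by exact_mod_cast h2
    simpa [Finset.sum_apply] using h3
  rw [this]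
  exact sum_mem fun g hg => nsmul_mem (AddSubmonoid.subset_closure hg) _

/-! ### Faces -/

/-- A sum of generators lies in a face only if every summand does, so the generators outside the
face are not needed. -/
theorem IsFace.closure_inter {P S : AddSubmonoid (Fin k → ℤ)} (hS : IsFace P S)
    {G : Set (Fin k → ℤ)} (hG : AddSubmonoid.closure G = P) :
    AddSubmonoid.closure (G ∩ S) = S := by
  apply le_antisymm ((AddSubmonoid.closure_le).2 inter_subset_right)
  have hGP : G ⊆ P := hG ▸ AddSubmonoid.subset_closure
  suffices h : ∀ p, p ∈ AddSubmonoid.closure G → p ∈ S → p ∈ AddSubmonoid.closure (G ∩ S) from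
    fun p hp => h p (hG ▸ hS.le hp) hp
  intro p hp
  induction hp using AddSubmonoid.closure_induction with
  | mem g hg => exact fun h => AddSubmonoid.subset_closure ⟨hg, h⟩
  | zero => exact fun _ => zero_mem _
  | add p q hp hq ihp ihq =>
    intro h
    obtain ⟨h1, h2⟩ := hS.mem_of_add_mem p (hG ▸ hp) q (hG ▸ hq) h
    exact add_mem (ihp h1) (ihq h2)

theorem IsFace.fg {P S : AddSubmonoid (Fin k → ℤ)} (hS : IsFace P S) (hP : P.FG) : S.FG := by
  classical
  obtain ⟨G, hG⟩ := hP
  refine ⟨G.filter (· ∈ S), ?_⟩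
  rw [Finset.coe_filter]
  exact hS.closure_inter hG

theorem IsFace.of_nsmul_mem {P S : AddSubmonoid (Fin k → ℤ)} (hS : IsFace P S) {p : Fin k → ℤ}
    (hp : p ∈ P) {n : ℕ} (hn : 1 ≤ n) (h : n • p ∈ S) : p ∈ S := by
  obtain ⟨m, rfl⟩ := Nat.exists_eq_add_of_le' hn
  rw [succ_nsmul] at h
  exact (hS.mem_of_add_mem _ (nsmul_mem hp m) _ hp h).2

theorem mem_closure_union_neg {G S : Set (Fin k → ℤ)} {x : Fin k → ℤ}
    (hx : x ∈ AddSubmonoid.closure (G ∪ -S)) :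
    ∃ p ∈ AddSubmonoid.closure G, ∃ s ∈ AddSubmonoid.closure S, x + s = p := by
  induction hx using AddSubmonoid.closure_induction with
  | mem x hx =>
    rcases hx with hx | hx
    · exact ⟨x, AddSubmonoid.subset_closure hx, 0, zero_mem _, add_zero x⟩
    · exact ⟨0, zero_mem _, -x, AddSubmonoid.subset_closure hx, add_neg_cancel x⟩
  | zero => exact ⟨0, zero_mem _, 0, zero_mem _, add_zero 0⟩
  | add x y _ _ hx hy =>
    obtain ⟨p, hp, s, hs, h⟩ := hx
    obtain ⟨q, hq, t, ht, h'⟩ := hy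
    exact ⟨p + q, add_mem hp hq, s + t, add_mem hs ht, by rw [← h, ← h']; abel⟩

theorem dotProduct_nonneg_of_mem_closure {G : Set (Fin k → ℤ)} {a : Fin k → ℤ}
    (h : ∀ g ∈ G, 0 ≤ a ⬝ᵥ g) {p : Fin k → ℤ} (hp : p ∈ AddSubmonoid.closure G) : 0 ≤ a ⬝ᵥ p := by
  induction hp using AddSubmonoid.closure_induction with
  | mem x hx => exact h x hx
  | zero => simp
  | add x y _ _ hx hy => rw [dotProduct_add]; exact add_nonneg hx hy

theorem dotProduct_eq_zero_of_mem_closure {G : Set (Fin k → ℤ)} {a : Fin k → ℤ}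
    (h : ∀ g ∈ G, a ⬝ᵥ g = 0) {p : Fin k → ℤ} (hp : p ∈ AddSubmonoid.closure G) : a ⬝ᵥ p = 0 := by
  induction hp using AddSubmonoid.closure_induction with
  | mem x hx => exact h x hx
  | zero => simp
  | add x y _ _ hx hy => rw [dotProduct_add, hx, hy, add_zero]

/-- Farkas' lemma relative to a face `S` of a finitely generated monoid `P`: if no multiple of `b`
lies in `P - S`, there is an integral functional which is nonnegative on `P`, zero on `S` and
negative on `b`. -/
theorem IsFace.exists_separating {P S : AddSubmonoid (Fin k → ℤ)} (hP : P.FG) (hS : IsFace P S)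
    (b : Fin k → ℤ) (hb : ∀ n : ℕ, 1 ≤ n → ∀ s ∈ S, n • b + s ∉ P) :
    ∃ a : Fin k → ℤ, (∀ p ∈ P, 0 ≤ a ⬝ᵥ p) ∧ (∀ s ∈ S, a ⬝ᵥ s = 0) ∧ a ⬝ᵥ b < 0 := by
  classical
  obtain ⟨G, hG⟩ := hP
  have hGS := hS.closure_inter hG
  -- Functionals nonnegative on `G ∪ -(G ∩ S)` are exactly those nonnegative on `P` and zero on `S`,
  -- and this set generates `P - S`.
  let G' : Finset (Fin k → ℤ) := G ∪ (G.filter (· ∈ S)).image (- ·)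
  have hG' : (G' : Set (Fin k → ℤ)) = (G : Set (Fin k → ℤ)) ∪ -((G : Set (Fin k → ℤ)) ∩ S) := by
    ext x
    simp only [G', Finset.coe_union, Finset.coe_image, Finset.coe_filter, Set.mem_union,
      Set.mem_image, Set.mem_neg, Set.mem_inter_iff, Set.mem_ofPred_eq, Finset.mem_coe]
    refine or_congr Iff.rfl ⟨?_, fun h => ⟨-x, h, neg_neg x⟩⟩
    rintro ⟨y, hy, rfl⟩
    rwa [neg_neg]
  by_contra! hcon
  obtain ⟨n, hn, hmem⟩ := exists_nsmul_mem_closure G' b fun a ha => by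
    have ha' : ∀ g ∈ (G : Set (Fin k → ℤ)) ∪ -((G : Set (Fin k → ℤ)) ∩ S), 0 ≤ a ⬝ᵥ g :=
      fun g hg => ha g (by rw [← Finset.mem_coe, hG']; exact hg)
    refine hcon a (fun p hp => ?_) fun s hs => ?_
    · rw [← hG] at hp
      exact dotProduct_nonneg_of_mem_closure (fun g hg => ha' g (Or.inl hg)) hp
    · rw [← hGS] at hs
      refine dotProduct_eq_zero_of_mem_closure (fun g hg => ?_) hs
      have h1 := ha' g (Or.inl hg.1)
      have h2 := ha' (-g) (Or.inr (by rw [Set.mem_neg, neg_neg]; exact hg))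
      rw [dotProduct_neg] at h2
      linarith
  rw [hG'] at hmem
  obtain ⟨p, hp, s, hs, h⟩ := mem_closure_union_neg hmem
  rw [hGS] at hs
  rw [hG] at hp
  exact hb n hn s hs (h ▸ hp)

/-- A face of a finitely generated monoid is exposed by an integral functional. -/
theorem IsFace.exists_exposing {P S : AddSubmonoid (Fin k → ℤ)} (hP : P.FG) (hS : IsFace P S) :
    ∃ a : Fin k → ℤ, (∀ s ∈ S, a ⬝ᵥ s = 0) ∧ ∀ p ∈ P, p ∉ S → 0 < a ⬝ᵥ p := by
  classical
  obtain ⟨G, hG⟩ := id hP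
  have hGP : ∀ g ∈ G, g ∈ P := fun g hg => hG ▸ AddSubmonoid.subset_closure hg
  have key : ∀ g ∈ G, ∃ a : Fin k → ℤ, (∀ p ∈ P, 0 ≤ a ⬝ᵥ p) ∧ (∀ s ∈ S, a ⬝ᵥ s = 0) ∧
      (g ∉ S → 0 < a ⬝ᵥ g) := by
    intro g hg
    by_cases hgS : g ∈ S
    · exact ⟨0, by simp, by simp, fun h => absurd hgS h⟩
    -- If `s - n g` were in `P`, then `n g` would be a summand of `s ∈ S`, forcing `g ∈ S`.
    · obtain ⟨a, h1, h2, h3⟩ := hS.exists_separating hP (-g) fun n hn s hs hmem => by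
        refine hgS (hS.of_nsmul_mem (hGP g hg) hn ?_)
        refine (hS.mem_of_add_mem _ (nsmul_mem (hGP g hg) n) _ hmem ?_).1
        rwa [smul_neg, add_neg_cancel_left]
      refine ⟨a, h1, h2, fun _ => ?_⟩
      rw [dotProduct_neg] at h3
      linarith
  choose! a ha using key
  have hsum : ∀ p, (∑ g ∈ G, a g) ⬝ᵥ p = ∑ g ∈ G, a g ⬝ᵥ p := fun p => sum_dotProduct _ _ _
  -- Each summand is nonnegative on `P` and zero on `S`, and every generator outside `S` is detected
  -- by its own summand.
  refine ⟨∑ g ∈ G, a g, fun s hs => ?_, fun p hp => ?_⟩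
  · rw [hsum]; exact Finset.sum_eq_zero fun g hg => (ha g hg).2.1 s hs
  · have hge : ∀ p ∈ P, 0 ≤ (∑ g ∈ G, a g) ⬝ᵥ p := fun p hp => by
      rw [hsum]; exact Finset.sum_nonneg fun g hg => (ha g hg).1 p hp
    rw [← hG] at hp
    induction hp using AddSubmonoid.closure_induction with
    | mem g hg =>
      intro hgS
      rw [hsum]
      exact Finset.sum_pos' (fun i hi => (ha i hi).1 g (hGP g hg)) ⟨g, hg, (ha g hg).2.2 hgS⟩
    | zero => exact fun h => absurd S.zero_mem h
    | add p q hp hq ihp ihq =>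
      intro h
      rw [hG] at hp hq
      rw [dotProduct_add]
      by_cases hpS : p ∈ S
      · have : q ∉ S := fun hqS => h (S.add_mem hpS hqS)
        have := ihq this; have := hge p hp; linarith
      · have := ihp hpS; have := hge q hq; linarith

/-! ### Additive characters of submonoids of `ℤᵏ` -/

/-- The pairing of `ℝᵏ` with `ℤᵏ`. -/
def dot (w : Fin k → ℝ) (p : Fin k → ℤ) : ℝ := ∑ i, w i * (p i : ℝ)

theorem dot_zero (w : Fin k → ℝ) : dot w 0 = 0 := by simp [dot]

theorem dot_add (w : Fin k → ℝ) (p q : Fin k → ℤ) : dot w (p + q) = dot w p + dot w q := by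
  simp [dot, mul_add, Finset.sum_add_distrib]

theorem add_dot (w w' : Fin k → ℝ) (p : Fin k → ℤ) : dot (w + w') p = dot w p + dot w' p := by
  simp [dot, add_mul, Finset.sum_add_distrib]

theorem smul_dot (t : ℝ) (w : Fin k → ℝ) (p : Fin k → ℤ) : dot (t • w) p = t * dot w p := by
  simp [dot, Finset.mul_sum, mul_assoc]

theorem zero_dot (p : Fin k → ℤ) : dot 0 p = 0 := by simp [dot]

theorem sub_dot (w w' : Fin k → ℝ) (p : Fin k → ℤ) : dot (w - w') p = dot w p - dot w' p := by
  simp [dot, sub_mul, Finset.sum_sub_distrib]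

theorem dot_intCast (a p : Fin k → ℤ) : dot (fun i => (a i : ℝ)) p = ((a ⬝ᵥ p : ℤ) : ℝ) := by
  simp [dot, dotProduct]

theorem contDiff_dot (p : Fin k → ℤ) : ContDiff ℝ ∞ fun w : Fin k → ℝ => dot w p := by
  unfold dot; fun_prop

/-- The linear functional `w ↦ ⟨w, p⟩`. -/
def dotL (p : Fin k → ℤ) : (Fin k → ℝ) →ₗ[ℝ] ℝ where
  toFun w := dot w p
  map_add' w w' := add_dot w w' p
  map_smul' t w := smul_dot t w p

/-- Additive real functions on a submonoid of an abelian group extend to the group. -/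
theorem exists_addMonoidHom_extension {A : Type*} [AddCommGroup A] (S : AddSubmonoid A)
    (f : S →+ ℝ) : ∃ F : A →+ ℝ, ∀ s : S, F s = f s := by
  -- The group completion of the cancellative monoid `S` embeds in `A`; the divisible group `ℝ` is
  -- injective, so the homomorphism extends.
  let ι : Algebra.GrothendieckAddGroup S →+ A := Algebra.GrothendieckAddGroup.lift S.subtype
  have hι : ∀ s : S, ι (Algebra.GrothendieckAddGroup.of s) = s := fun s =>
    DFunLike.congr_fun (Algebra.GrothendieckAddGroup.lift.symm_apply_apply S.subtype) s
  have hinj : Function.Injective ι := by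
    rw [injective_iff_map_eq_zero]
    intro x hx
    obtain ⟨⟨a, b⟩, h⟩ := (AddLocalization.addMonoidOf (⊤ : AddSubmonoid S)).surj x
    have h' : x + Algebra.GrothendieckAddGroup.of (b : S) = Algebra.GrothendieckAddGroup.of a := h
    have hab : (b : S) = a := by
      have := congrArg ι h'
      rw [map_add, hx, zero_add, hι, hι] at this
      exact Subtype.ext this
    rw [hab] at h'
    simpa using h'
  obtain ⟨F, hF⟩ := (Module.Baer.of_divisible ℝ).extension_property_addMonoidHom ι hinj
    (Algebra.GrothendieckAddGroup.lift f)
  refine ⟨F, fun s => ?_⟩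
  have := DFunLike.congr_fun hF (Algebra.GrothendieckAddGroup.of s)
  rw [AddMonoidHom.comp_apply, hι] at this
  rw [this]
  exact DFunLike.congr_fun (Algebra.GrothendieckAddGroup.lift.symm_apply_apply f) s

/-- Additive real functions on a submonoid of `ℤᵏ` are given by vectors in `ℝᵏ`. -/
theorem exists_eq_dot (S : AddSubmonoid (Fin k → ℤ)) (f : S →+ ℝ) :
    ∃ u : Fin k → ℝ, ∀ s : S, f s = dot u s := by
  obtain ⟨F, hF⟩ := exists_addMonoidHom_extension S f
  refine ⟨fun i => F (Pi.single i 1), fun s => ?_⟩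
  rw [← hF]
  have : (s : Fin k → ℤ) = ∑ i, (s : Fin k → ℤ) i • Pi.single i (1 : ℤ) := by
    funext j; simp [Finset.sum_apply, Pi.single_apply]
  conv_lhs => rw [this]
  rw [map_sum]
  refine Finset.sum_congr rfl fun i _ => ?_
  rw [map_zsmul, zsmul_eq_mul, mul_comm]

/-! ### Points of the model spaces -/

section ModelPoints

variable {k : ℕ} {P : AddSubmonoid (Fin k → ℤ)}

theorem submonoid_induction {G : Set (Fin k → ℤ)} (hG : AddSubmonoid.closure G = P) {C : P → Prop}
    (gen : ∀ g : P, (g : Fin k → ℤ) ∈ G → C g) (zero : C 0)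
    (add : ∀ p q : P, C p → C q → C (p + q)) (p : P) : C p := by
  subst hG
  obtain ⟨p, hp⟩ := p
  induction hp using AddSubmonoid.closure_induction with
  | mem x hx => exact gen _ hx
  | zero => exact zero
  | add x y hx hy ihx ihy => exact add _ _ ihx ihy

theorem mem_supp {m : ModelSpace P} {p : P} : (p : Fin k → ℤ) ∈ supp m ↔ lam p m ≠ 0 :=
  ⟨fun ⟨_, h⟩ => h, fun h => ⟨p.2, h⟩⟩

theorem supp_le (m : ModelSpace P) : supp m ≤ P := fun _ h => h.1

theorem isFace_supp (m : ModelSpace P) : IsFace P (supp m) where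
  le := supp_le m
  mem_of_add_mem p hp q hq h := by
    obtain ⟨h1, h2⟩ := h
    have h3 : lam (⟨p, hp⟩ + ⟨q, hq⟩) m ≠ 0 := h2
    rw [lam_add] at h3
    exact ⟨⟨hp, left_ne_zero_of_mul h3⟩, ⟨hq, right_ne_zero_of_mul h3⟩⟩

/-- The point of `X_P` defined by a multiplicative character. -/
def ofChar (f : P → ℝ≥0) (h0 : f 0 = 1) (hadd : ∀ p q, f (p + q) = f p * f q) : ModelSpace P :=
  ({ toFun := fun p => f p.toAdd, map_one' := h0, map_mul' := fun p q => hadd p.toAdd q.toAdd } :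
    Multiplicative P →* ℝ≥0)

/-- The interior point `p ↦ exp ⟨v, p⟩` of `X_P`. -/
def expPt (P : AddSubmonoid (Fin k → ℤ)) (v : Fin k → ℝ) : ModelSpace P :=
  ofChar (fun p => ⟨Real.exp (dot v p), (Real.exp_pos _).le⟩)
    (NNReal.eq ((congrArg Real.exp (dot_zero v)).trans Real.exp_zero))
    fun p q => NNReal.eq ((congrArg Real.exp (dot_add v p q)).trans (Real.exp_add _ _))

theorem lam_expPt (p : P) (v : Fin k → ℝ) : (lam p (expPt P v) : ℝ) = Real.exp (dot v p) := rfl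

/-- The point `p ↦ m p * exp ⟨w, p⟩` of `X_P`. -/
def twist (m : ModelSpace P) (w : Fin k → ℝ) : ModelSpace P :=
  ofChar (fun p => lam p m * ⟨Real.exp (dot w p), (Real.exp_pos _).le⟩)
    (NNReal.eq (by
      change (lam 0 m : ℝ) * Real.exp (dot w 0) = 1
      simp [dot_zero, lam_zero]))
    fun p q => NNReal.eq (by
      change (lam (p + q) m : ℝ) * Real.exp (dot w ((p : Fin k → ℤ) + q)) =
        (lam p m * Real.exp (dot w p)) * (lam q m * Real.exp (dot w q))
      rw [dot_add, Real.exp_add, lam_add, NNReal.coe_mul]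
      ring)

theorem lam_twist (p : P) (m : ModelSpace P) (w : Fin k → ℝ) :
    (lam p (twist m w) : ℝ) = lam p m * Real.exp (dot w p) := rfl

theorem modelSpace_ext {m m' : ModelSpace P} (h : ∀ p : P, (lam p m : ℝ) = lam p m') : m = m' :=
  MonoidHom.ext fun p => NNReal.eq (h p.toAdd)

theorem twist_zero (m : ModelSpace P) : twist m 0 = m :=
  modelSpace_ext fun p => by rw [lam_twist, zero_dot, Real.exp_zero, mul_one]

theorem supp_twist (m : ModelSpace P) (w : Fin k → ℝ) : supp (twist m w) = supp m := by
  ext p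
  refine ⟨fun ⟨h, h'⟩ => ⟨h, fun e => h' (NNReal.eq ?_)⟩, fun ⟨h, h'⟩ => ⟨h, fun e => h' (NNReal.eq ?_)⟩⟩
  · rw [lam_twist, e]; simp
  · have := congrArg NNReal.toReal e
    rw [lam_twist] at this
    simpa [Real.exp_ne_zero] using this

theorem continuous_lam (p : P) : Continuous (lam p : ModelSpace P → ℝ≥0) :=
  (continuous_apply p).comp continuous_induced_dom

theorem continuous_lam_real (p : P) : Continuous fun m : ModelSpace P => (lam p m : ℝ) :=
  NNReal.continuous_coe.comp (continuous_lam p)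

theorem tendsto_modelSpace {ι : Type*} {l : Filter ι} {γ : ι → ModelSpace P} {m : ModelSpace P}
    (h : ∀ p : P, Tendsto (fun t => (lam p (γ t) : ℝ)) l (𝓝 (lam p m))) : Tendsto γ l (𝓝 m) := by
  rw [nhds_induced, tendsto_comap_iff, tendsto_pi_nhds]
  exact fun p => NNReal.tendsto_coe.1 (h p)

theorem tendsto_twist (m : ModelSpace P) (w : Fin k → ℝ) :
    Tendsto (fun t : ℝ => twist m (t • w)) (𝓝 0) (𝓝 m) := by
  refine tendsto_modelSpace fun p => ?_
  have : Continuous fun t : ℝ => (lam p m : ℝ) * Real.exp (t * dot w p) := by fun_prop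
  simpa [lam_twist, smul_dot] using this.tendsto 0

/-- On its support `m` takes positive values, so its logarithm is an additive real function there,
hence a pairing with a vector. -/
theorem exists_log (m : ModelSpace P) :
    ∃ u : Fin k → ℝ, ∀ p : P, (p : Fin k → ℤ) ∈ supp m → (lam p m : ℝ) = Real.exp (dot u p) := by
  have hpos : ∀ s : supp m, 0 < (lam (⟨s, supp_le m s.2⟩ : P) m : ℝ) := fun s =>
    NNReal.coe_pos.2 (pos_iff_ne_zero.2 (mem_supp.1 s.2))
  let f : supp m →+ ℝ :=
    { toFun := fun s => Real.log (lam (⟨s, supp_le m s.2⟩ : P) m)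
      map_zero' := by
        change Real.log (lam (0 : P) m) = 0
        simp [lam_zero]
      map_add' := fun s t => by
        change Real.log (lam ((⟨s, supp_le m s.2⟩ : P) + ⟨t, supp_le m t.2⟩) m) = _
        rw [lam_add, NNReal.coe_mul, Real.log_mul (hpos s).ne' (hpos t).ne'] }
  obtain ⟨u, hu⟩ := exists_eq_dot (supp m) f
  refine ⟨u, fun p hp => ?_⟩
  rw [← hu ⟨p, hp⟩]
  exact (Real.exp_log (hpos ⟨p, hp⟩)).symm

/-- Moving along `-a`, with `a` exposing the support, leaves `λ_p` unchanged on the support and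
sends every other `λ_p` to `0`. This approaches `m` through interior points. -/
theorem tendsto_expPt {m : ModelSpace P} {u a : Fin k → ℝ}
    (hu : ∀ p : P, (p : Fin k → ℤ) ∈ supp m → (lam p m : ℝ) = Real.exp (dot u p))
    (ha : ∀ s ∈ supp m, dot a s = 0) (ha' : ∀ p ∈ P, p ∉ supp m → 0 < dot a p) :
    Tendsto (fun T : ℝ => expPt P (u - T • a)) atTop (𝓝 m) := by
  refine tendsto_modelSpace fun p => ?_
  simp only [lam_expPt, sub_dot, smul_dot]
  by_cases hp : (p : Fin k → ℤ) ∈ supp m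
  · simp [ha _ hp, hu p hp]
  · have h0 : lam p m = 0 := by
      by_contra h; exact hp (mem_supp.2 h)
    rw [h0, NNReal.coe_zero]
    refine Real.tendsto_exp_atBot.comp ?_
    exact tendsto_atBot_add_const_left _ _
      (tendsto_neg_atTop_atBot.comp (tendsto_id.atTop_mul_const (ha' p p.2 hp)))

/-- Interior points are dense in `X_P`. -/
theorem frequently_full (hP : P.FG) (m : ModelSpace P) :
    ∃ᶠ m' in 𝓝 m, ∀ p : P, lam p m' ≠ 0 := by
  obtain ⟨u, hu⟩ := exists_log m
  obtain ⟨a, h1, h2⟩ := (isFace_supp m).exists_exposing hP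
  refine (tendsto_expPt hu (a := fun i => (a i : ℝ)) (fun s hs => ?_) fun p hp hps => ?_).frequently
    (Filter.Frequently.of_forall fun T p h => ?_)
  · rw [dot_intCast, h1 s hs, Int.cast_zero]
  · rw [dot_intCast]; exact_mod_cast h2 p hp hps
  · have := lam_expPt p (u - T • fun i => (a i : ℝ))
    rw [h, NNReal.coe_zero] at this
    exact (Real.exp_pos _).ne this

/-- The support is generated by finitely many elements, and each condition `λ_g ≠ 0` is open. -/
theorem eventually_supp_le (hP : P.FG) (m : ModelSpace P) : ∀ᶠ m' in 𝓝 m, supp m ≤ supp m' := by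
  obtain ⟨G, hG⟩ := hP
  have h : ∀ g ∈ G, ∀ᶠ m' in 𝓝 m, g ∈ supp m → g ∈ supp m' := fun g hg => by
    by_cases hgs : g ∈ supp m
    · have := (continuous_lam (⟨g, supp_le m hgs⟩ : P)).continuousAt.eventually_ne hgs.2
      filter_upwards [this] with m' hm' _ using ⟨supp_le m hgs, hm'⟩
    · exact Eventually.of_forall fun m' h => absurd h hgs
  have h2 := (G.finite_toSet.eventually_all).2 h
  filter_upwards [h2] with m' hm'
  conv_lhs => rw [← (isFace_supp m).closure_inter hG]
  exact (AddSubmonoid.closure_le).2 fun g hg => hm' g hg.1 hg.2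

/-- If `λ_p ≤ C λ_q` near `m`, then `q` divides `p` up to elements of the support of `m`. -/
theorem IsWeaklyToric.exists_add_eq_of_le (hP : IsWeaklyToric P) {m : ModelSpace P} {p q : P} {C : ℝ}
    (h : ∀ᶠ m' in 𝓝 m, (lam p m' : ℝ) ≤ C * lam q m') :
    ∃ s : P, (s : Fin k → ℤ) ∈ supp m ∧ ∃ r : P, p + s = q + r := by
  by_contra! hcon
  -- By saturation, `n (p - q) + s ∈ P` would already give `p - q + s ∈ P`, which `hcon` excludes.
  obtain ⟨a, ha0, haS, hab⟩ := (isFace_supp m).exists_separating hP.fg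
    ((p : Fin k → ℤ) - q) fun n hn s hs hmem => by
      have hsP := supp_le m hs
      have : (p : Fin k → ℤ) - q + s ∈ P := by
        refine hP.saturated _ ?_ n hn ?_
        · exact add_mem (sub_mem (AddSubgroup.subset_closure p.2) (AddSubgroup.subset_closure q.2))
            (AddSubgroup.subset_closure hsP)
        · obtain ⟨n, rfl⟩ := Nat.exists_eq_add_of_le' hn
          have : (n + 1) • ((p : Fin k → ℤ) - q + s) =
              ((n + 1) • ((p : Fin k → ℤ) - q) + s) + n • s := by
            rw [smul_add, succ_nsmul s, add_assoc, add_comm s]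
          rw [this]
          exact add_mem hmem (nsmul_mem hsP n)
      refine hcon ⟨s, hsP⟩ hs ⟨_, this⟩ (Subtype.ext ?_)
      simp only [AddSubmonoid.coe_add]
      abel
  obtain ⟨a', h1, h2⟩ := (isFace_supp m).exists_exposing hP.fg
  obtain ⟨u, hu⟩ := exists_log m
  -- Adding `a'` makes the functional strictly positive off the support. Since `a` takes a value at
  -- most `-1` on `p - q`, this `N` keeps the total negative there.
  set N : ℤ := |a' ⬝ᵥ ((p : Fin k → ℤ) - q)| + 1 with hN
  have hN0 : 0 < N := by positivity
  set b : Fin k → ℤ := N • a + a' with hb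
  have hbS : ∀ s ∈ supp m, b ⬝ᵥ s = 0 := fun s hs => by
    rw [hb, add_dotProduct, smul_dotProduct, haS s hs, h1 s hs]; simp
  have hbP : ∀ r ∈ P, r ∉ supp m → 0 < b ⬝ᵥ r := fun r hr hrs => by
    rw [hb, add_dotProduct, smul_dotProduct, smul_eq_mul]
    have := mul_nonneg hN0.le (ha0 r hr); have := h2 r hr hrs; linarith
  have hbneg : b ⬝ᵥ ((p : Fin k → ℤ) - q) < 0 := by
    rw [hb, add_dotProduct, smul_dotProduct, smul_eq_mul]
    have h3 : a ⬝ᵥ ((p : Fin k → ℤ) - q) ≤ -1 := by linarith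
    have h4 := mul_le_mul_of_nonneg_left h3 hN0.le
    have h5 := le_abs_self (a' ⬝ᵥ ((p : Fin k → ℤ) - q))
    linarith
  have htend := tendsto_expPt (m := m) hu (a := fun i => (b i : ℝ))
    (fun s hs => by rw [dot_intCast, hbS s hs, Int.cast_zero])
    (fun p hp hps => by rw [dot_intCast]; exact_mod_cast hbP p hp hps)
  have hev := htend.eventually h
  simp only [lam_expPt] at hev
  -- Along the path, `λ_p / λ_q` is a constant times `exp (T c)` with `c > 0`, which eventually
  -- exceeds `C`.
  set c : ℝ := -((b ⬝ᵥ ((p : Fin k → ℤ) - q) : ℤ) : ℝ) with hc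
  have hcpos : 0 < c := by rw [hc, neg_pos]; exact_mod_cast hbneg
  have hdiff : ∀ T : ℝ, dot (u - T • fun i => (b i : ℝ)) p =
      dot (u - T • fun i => (b i : ℝ)) q + (dot u p - dot u q + T * c) := fun T => by
    simp only [sub_dot, smul_dot, dot_intCast, hc, dotProduct_sub, Int.cast_sub]
    ring
  have hlim : Tendsto (fun T : ℝ => Real.exp (dot u p - dot u q + T * c)) atTop atTop :=
    Real.tendsto_exp_atTop.comp
      (tendsto_atTop_add_const_left _ _ (tendsto_id.atTop_mul_const hcpos))
  obtain ⟨T, hT1, hT2⟩ := (hev.and (hlim.eventually_gt_atTop C)).exists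
  rw [hdiff, Real.exp_add, mul_comm] at hT1
  exact absurd (le_of_mul_le_mul_right hT1 (Real.exp_pos _)) (not_le.2 hT2)

end ModelPoints

/-! ### Smooth and interior functions -/

section SmoothFunctions

variable {k : ℕ} {X : Type u} [TopologicalSpace X] {P : AddSubmonoid (Fin k → ℤ)}
  {e : X → ModelSpace P} {x : X}

theorem SmoothRealAt.comp_fintype {ι : Type*} [Fintype ι] {a : ι → X → ℝ}
    (ha : ∀ j, SmoothRealAt e x (a j)) {W : Set (ι → ℝ)} {g : (ι → ℝ) → ℝ}
    (hW : IsOpen W) (hg : ContDiffOn ℝ ∞ g W) (hx : ∀ᶠ z in 𝓝 x, (fun j => a j z) ∈ W)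
    {b : X → ℝ} (hb : ∀ᶠ z in 𝓝 x, b z = g fun j => a j z) : SmoothRealAt e x b := by
  let E := Fintype.equivFin ι
  let ρ : (Fin (Fintype.card ι) → ℝ) → (ι → ℝ) := fun y j => y (E j)
  have hρ : ContDiff ℝ ∞ ρ := contDiff_pi.2 fun j => contDiff_apply ℝ ℝ _
  have hρa : ∀ z, ρ (fun j => a (E.symm j) z) = fun j => a j z := fun z => by
    funext j; simp [ρ]
  refine SmoothRealAt.comp (a := fun j => a (E.symm j)) (W := ρ ⁻¹' W) (g := g ∘ ρ)
    (fun j => ha _) (hW.preimage hρ.continuous) (hg.comp hρ.contDiffOn fun _ hy => hy) ?_ ?_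
  · filter_upwards [hx] with z hz
    rwa [mem_preimage, hρa]
  · filter_upwards [hb] with z hz
    rw [Function.comp_apply, hρa, hz]

theorem SmoothRealAt.comp_real {a : X → ℝ} (ha : SmoothRealAt e x a) {W : Set ℝ} {g : ℝ → ℝ}
    (hW : IsOpen W) (hg : ContDiffOn ℝ ∞ g W) (hx : ∀ᶠ z in 𝓝 x, a z ∈ W) :
    SmoothRealAt e x fun z => g (a z) :=
  SmoothRealAt.comp (m := 1) (a := fun _ => a) (W := (fun y => y 0) ⁻¹' W) (g := fun y => g (y 0))
    (fun _ => ha) (hW.preimage (continuous_apply _))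
    (hg.comp (contDiff_apply ℝ ℝ _).contDiffOn fun _ hy => hy) hx (Eventually.of_forall fun _ => rfl)

theorem SmoothRealAt.inv {a : X → ℝ} (ha : SmoothRealAt e x a) (h : ∀ᶠ z in 𝓝 x, a z ≠ 0) :
    SmoothRealAt e x fun z => (a z)⁻¹ :=
  ha.comp_real (W := {0}ᶜ) isOpen_compl_singleton
    (fun _ hy => (contDiffAt_inv ℝ hy).contDiffWithinAt) h

theorem SmoothRealAt.continuousAt {a : X → ℝ} (ha : SmoothRealAt e x a) (he : ContinuousAt e x) :
    ContinuousAt a x := by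
  obtain ⟨n, r, W, g, hW, hg, hz⟩ := ha
  have h1 : ContinuousAt (fun z (j : Fin n) => (GCorners.lam (r j) (e z) : ℝ)) x :=
    continuousAt_pi.2 fun j => (continuous_lam_real (r j)).continuousAt.comp he
  have hx := hz.self_of_nhds.1
  have h2 : ContinuousAt g fun j => (GCorners.lam (r j) (e x) : ℝ) :=
    (hg.continuousOn).continuousAt (hW.mem_nhds hx)
  exact (ContinuousAt.comp (f := fun z (j : Fin n) => (GCorners.lam (r j) (e z) : ℝ)) h2 h1).congr
    (hz.mono fun z hz => hz.2.symm)

theorem SmoothRealAt.eventually {a : X → ℝ} (ha : SmoothRealAt e x a) :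
    ∀ᶠ z in 𝓝 x, SmoothRealAt e z a := by
  obtain ⟨n, r, W, g, hW, hg, hz⟩ := ha
  exact hz.eventually_nhds.mono fun z hz => ⟨n, r, W, g, hW, hg, hz⟩

theorem InteriorAt.congr {b c : X → ℝ≥0} (hb : InteriorAt e x b) (h : ∀ᶠ z in 𝓝 x, c z = b z) :
    InteriorAt e x c := by
  obtain ⟨p, g, hg, hz⟩ := hb
  exact ⟨p, g, hg, by filter_upwards [hz, h] with z h1 h2 using ⟨h1.1, h2 ▸ h1.2⟩⟩

theorem SmoothNonnegAt.smoothReal {b : X → ℝ≥0} (hb : SmoothNonnegAt e x b) :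
    SmoothRealAt e x fun z => (b z : ℝ) := by
  rcases hb with hb | hb
  · exact hb.smoothReal
  · exact (SmoothRealAt.const e x 0).congr (hb.mono fun z hz => by rw [hz, NNReal.coe_zero])

variable {X' : Type v} [TopologicalSpace X'] {φ : X' → X} {x' : X'}

theorem SmoothRealAt.comp_continuousAt {a : X → ℝ} (ha : SmoothRealAt e (φ x') a)
    (hφ : ContinuousAt φ x') : SmoothRealAt (fun z => e (φ z)) x' fun z => a (φ z) := by
  obtain ⟨n, r, W, g, hW, hg, hz⟩ := ha
  exact ⟨n, r, W, g, hW, hg, hφ.eventually hz⟩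

theorem InteriorAt.comp_continuousAt {b : X → ℝ≥0} (hb : InteriorAt e (φ x') b)
    (hφ : ContinuousAt φ x') : InteriorAt (fun z => e (φ z)) x' fun z => b (φ z) := by
  obtain ⟨p, h, hh, hz⟩ := hb
  exact ⟨p, fun z => h (φ z), hh.comp_continuousAt hφ, hφ.eventually hz⟩

theorem SmoothNonnegAt.comp_continuousAt {b : X → ℝ≥0} (hb : SmoothNonnegAt e (φ x') b)
    (hφ : ContinuousAt φ x') : SmoothNonnegAt (fun z => e (φ z)) x' fun z => b (φ z) :=
  hb.imp (fun h => h.comp_continuousAt hφ) fun h => hφ.eventually h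

end SmoothFunctions

/-! ### Charts -/

namespace GChart.IsChart

variable {X : Type u} [TopologicalSpace X] {c : GChart X} {n : ℕ} {x : X}

theorem map_nhds (hc : c.IsChart n) (hx : x ∈ c.source) : map c.coord (𝓝 x) = 𝓝 (c.coord x) := by
  have h1 := hc.isOpenEmbedding.map_nhds_eq ⟨x, hx⟩
  have h2 := hc.isOpen_source.isOpenEmbedding_subtypeVal.map_nhds_eq ⟨x, hx⟩
  have h3 : c.source.domRestrict c.coord = c.coord ∘ Subtype.val := rfl
  rw [h3, ← Filter.map_map, h2] at h1
  exact h1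

theorem continuousAt (hc : c.IsChart n) (hx : x ∈ c.source) : ContinuousAt c.coord x :=
  (hc.map_nhds hx).le

theorem eventually_source (hc : c.IsChart n) (hx : x ∈ c.source) : ∀ᶠ z in 𝓝 x, z ∈ c.source :=
  hc.isOpen_source.mem_nhds hx

theorem injOn (hc : c.IsChart n) : InjOn c.coord c.source :=
  fun x hx y hy h => congrArg Subtype.val (hc.isOpenEmbedding.injective (a₁ := ⟨x, hx⟩)
    (a₂ := ⟨y, hy⟩) h)

theorem frequently_full (hc : c.IsChart n) (hx : x ∈ c.source) :
    ∃ᶠ z in 𝓝 x, ∀ p : c.P, lam p (c.coord z) ≠ 0 := by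
  have := GCorners.frequently_full hc.weaklyToric.fg (c.coord x)
  rw [← hc.map_nhds hx] at this
  exact this

theorem eventually_supp_le (hc : c.IsChart n) (hx : x ∈ c.source) :
    ∀ᶠ z in 𝓝 x, supp (c.coord x) ≤ supp (c.coord z) :=
  (hc.continuousAt hx).eventually (GCorners.eventually_supp_le hc.weaklyToric.fg (c.coord x))

theorem eventually_lam_pos (hc : c.IsChart n) (hx : x ∈ c.source) {s : c.P}
    (hs : (s : Fin c.k → ℤ) ∈ supp (c.coord x)) : ∀ᶠ z in 𝓝 x, 0 < (lam s (c.coord z) : ℝ) := by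
  filter_upwards [hc.eventually_supp_le hx] with z hz
  exact NNReal.coe_pos.2 (pos_iff_ne_zero.2 (mem_supp.1 (hz hs)))

theorem eventually_continuousAt (hc : c.IsChart n) (hx : x ∈ c.source) {a : X → ℝ}
    (ha : SmoothRealAt c.coord x a) : ∀ᶠ z in 𝓝 x, ContinuousAt a z := by
  filter_upwards [ha.eventually, hc.eventually_source hx] with z h1 h2
  exact h1.continuousAt (hc.continuousAt h2)

theorem exists_add_eq_of_le (hc : c.IsChart n) (hx : x ∈ c.source) {p q : c.P} {C : ℝ}
    (h : ∀ᶠ z in 𝓝 x, (lam p (c.coord z) : ℝ) ≤ C * lam q (c.coord z)) :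
    ∃ s : c.P, (s : Fin c.k → ℤ) ∈ supp (c.coord x) ∧ ∃ r : c.P, p + s = q + r := by
  refine hc.weaklyToric.exists_add_eq_of_le (C := C) ?_
  rw [← hc.map_nhds hx]
  exact h

/-- If `λ_p = t λ_q` near `x` with `t` continuous at `x`, then `q` divides `p` up to elements of the
support of `x`. -/
theorem exists_add_eq_of_eq_mul (hc : c.IsChart n) (hx : x ∈ c.source) {p q : c.P} {t : X → ℝ}
    (ht : ContinuousAt t x)
    (h : ∀ᶠ z in 𝓝 x, (lam p (c.coord z) : ℝ) = t z * lam q (c.coord z)) :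
    ∃ s : c.P, (s : Fin c.k → ℤ) ∈ supp (c.coord x) ∧ ∃ r : c.P, p + s = q + r := by
  refine hc.exists_add_eq_of_le hx (C := t x + 1) ?_
  filter_upwards [h, ht.eventually_lt continuousAt_const (lt_add_one (t x))] with z h1 h2
  rw [h1]
  exact mul_le_mul_of_nonneg_right h2.le (NNReal.coe_nonneg _)

/-- The exponent `p` of an interior function `λ_p h` is unique up to elements of the support. -/
theorem exponent_unique (hc : c.IsChart n) (hx : x ∈ c.source) {p q : c.P} {g h : X → ℝ}
    (hg : ContinuousAt g x) (hh : ContinuousAt h x) (hgp : ∀ᶠ z in 𝓝 x, 0 < g z)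
    (hhp : ∀ᶠ z in 𝓝 x, 0 < h z)
    (he : ∀ᶠ z in 𝓝 x, (lam p (c.coord z) : ℝ) * g z = lam q (c.coord z) * h z) :
    ∃ s : c.P, (s : Fin c.k → ℤ) ∈ supp (c.coord x) ∧
      ∃ r : c.P, (r : Fin c.k → ℤ) ∈ supp (c.coord x) ∧ p + s = q + r := by
  obtain ⟨s, hs, r, h1⟩ := hc.exists_add_eq_of_eq_mul hx (p := p) (q := q) (t := fun z => h z / g z)
    (hh.div hg hgp.self_of_nhds.ne') (by
      filter_upwards [hgp, he] with z h1 h2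
      field_simp
      linarith)
  obtain ⟨s', hs', r', h2⟩ := hc.exists_add_eq_of_eq_mul hx (p := q) (q := p)
    (t := fun z => g z / h z) (hg.div hh hhp.self_of_nhds.ne') (by
      filter_upwards [hhp, he] with z h1 h2
      field_simp
      linarith)
  -- The two divisibilities combine to `r + r' = s + s'`, which lies in the support; a face contains
  -- the summands of its elements.
  refine ⟨s, hs, r, ?_, h1⟩
  have h3 : (r : Fin c.k → ℤ) + r' = s + s' := by
    have e1 := congrArg (Subtype.val) h1
    have e2 := congrArg (Subtype.val) h2
    simp only [AddSubmonoid.coe_add] at e1 e2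
    have : (q : Fin c.k → ℤ) + (r + r') = q + (s + s') := by
      rw [← add_assoc, ← e1, add_right_comm, ← e2]; abel
    exact add_left_cancel this
  exact ((isFace_supp _).mem_of_add_mem _ r.2 _ r'.2 (h3 ▸ add_mem hs hs')).1

end GChart.IsChart

/-! ### Curves in strata and directional derivatives -/

section Curves

open Classical in
/-- The curve `t ↦ x · exp (t w)` in the stratum of `x`, in the coordinates of the chart `c`. -/
def GChart.curve {X : Type u} (c : GChart X) (x : X) (w : Fin c.k → ℝ) (t : ℝ) : X :=
  if h : ∃ z ∈ c.source, c.coord z = twist (c.coord x) (t • w) then h.choose else x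

namespace GChart.IsChart

variable {X : Type u} [TopologicalSpace X] {c : GChart X} {n : ℕ} {x : X}

theorem tendsto_curve_and (hc : c.IsChart n) (hx : x ∈ c.source) (w : Fin c.k → ℝ) :
    Tendsto (c.curve x w) (𝓝 0) (𝓝 x) ∧ ∀ᶠ t in 𝓝 0, c.curve x w t ∈ c.source ∧
      c.coord (c.curve x w t) = twist (c.coord x) (t • w) := by
  have key : ∀ V ∈ 𝓝 x, ∀ᶠ t in 𝓝 (0 : ℝ), c.curve x w t ∈ V ∧ c.curve x w t ∈ c.source ∧
      c.coord (c.curve x w t) = twist (c.coord x) (t • w) := by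
    intro V hV
    -- Charts are open, so for small `t` the twisted point has a preimage inside `V`; injectivity of
    -- the coordinates identifies it with the chosen one.
    have h1 : c.coord '' (V ∩ c.source) ∈ 𝓝 (c.coord x) := by
      rw [← hc.map_nhds hx]
      exact image_mem_map (inter_mem hV (hc.eventually_source hx))
    filter_upwards [tendsto_twist (c.coord x) w h1] with t ht
    obtain ⟨z, ⟨hzV, hzs⟩, hz⟩ := ht
    have hex : ∃ z ∈ c.source, c.coord z = twist (c.coord x) (t • w) := ⟨z, hzs, hz⟩
    have hcur : c.curve x w t = hex.choose := by rw [curve, dif_pos hex]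
    have hsp := hex.choose_spec
    have : hex.choose = z := hc.injOn hsp.1 hzs (hsp.2.trans hz.symm)
    rw [hcur]
    exact ⟨this ▸ hzV, hsp⟩
  exact ⟨fun V hV => (key V hV).mono fun t h => h.1, (key univ univ_mem).mono fun t h => h.2⟩

theorem tendsto_curve (hc : c.IsChart n) (hx : x ∈ c.source) (w : Fin c.k → ℝ) :
    Tendsto (c.curve x w) (𝓝 0) (𝓝 x) := (hc.tendsto_curve_and hx w).1

theorem eventually_coord_curve (hc : c.IsChart n) (hx : x ∈ c.source) (w : Fin c.k → ℝ) :
    ∀ᶠ t in 𝓝 0, c.curve x w t ∈ c.source ∧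
      c.coord (c.curve x w t) = twist (c.coord x) (t • w) := (hc.tendsto_curve_and hx w).2

theorem curve_zero (hc : c.IsChart n) (hx : x ∈ c.source) (w : Fin c.k → ℝ) :
    c.curve x w 0 = x := by
  have h := (hc.eventually_coord_curve hx w).self_of_nhds
  rw [zero_smul, twist_zero] at h
  exact hc.injOn h.1 hx h.2

theorem hasDerivAt_lam_curve (hc : c.IsChart n) (hx : x ∈ c.source) (w : Fin c.k → ℝ) (p : c.P) :
    HasDerivAt (fun t => (lam p (c.coord (c.curve x w t)) : ℝ)) (lam p (c.coord x) * dot w p) 0 := by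
  have h : HasDerivAt (fun t : ℝ => (lam p (c.coord x) : ℝ) * Real.exp (t * dot w p))
      (lam p (c.coord x) * dot w p) 0 := by
    have h1 : HasDerivAt (fun t : ℝ => t * dot w p) (dot w p) 0 := by
      simpa using (hasDerivAt_id (0 : ℝ)).mul_const (dot w p)
    simpa using h1.exp.const_mul (lam p (c.coord x) : ℝ)
  refine h.congr_of_eventuallyEq ?_
  filter_upwards [hc.eventually_coord_curve hx w] with t ht
  rw [ht.2, lam_twist, smul_dot]

/-- Chain rule along curves. -/
theorem hasDerivAt_comp_curve (hc : c.IsChart n) (hx : x ∈ c.source) (w : Fin c.k → ℝ)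
    {m : ℕ} {b : Fin m → X → ℝ} {d : Fin m → ℝ}
    (hb : ∀ j, HasDerivAt (fun t => b j (c.curve x w t)) (d j) 0) {W : Set (Fin m → ℝ)}
    {g : (Fin m → ℝ) → ℝ} (hW : IsOpen W) (hg : ContDiffOn ℝ ∞ g W) {a : X → ℝ}
    (h : ∀ᶠ z in 𝓝 x, (fun j => b j z) ∈ W ∧ a z = g fun j => b j z) :
    HasDerivAt (fun t => a (c.curve x w t)) (fderiv ℝ g (fun j => b j x) d) 0 := by
  have hx' := h.self_of_nhds.1
  have hg' : HasFDerivAt g (fderiv ℝ g fun j => b j x) fun j => b j (c.curve x w 0) := by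
    rw [hc.curve_zero hx]
    exact ((hg.contDiffAt (hW.mem_nhds hx')).differentiableAt (by simp)).hasFDerivAt
  have := hg'.comp_hasDerivAt (0 : ℝ) (f := fun t j => b j (c.curve x w t)) (hasDerivAt_pi.2 hb)
  exact this.congr_of_eventuallyEq ((hc.tendsto_curve hx w).eventually (h.mono fun z hz => hz.2))

/-- The directional derivatives of a smooth function along the curves `c.curve x w`. -/
theorem exists_hasDerivAt_curve (hc : c.IsChart n) (hx : x ∈ c.source) {a : X → ℝ}
    (ha : SmoothRealAt c.coord x a) : ∃ D : (Fin c.k → ℝ) →ₗ[ℝ] ℝ,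
      ∀ w, HasDerivAt (fun t => a (c.curve x w t)) (D w) 0 := by
  obtain ⟨m, r, W, g, hW, hg, hz⟩ := ha
  -- The derivative of `λ_p` along the curve is `λ_p(x) ⟨w, p⟩`, linear in `w`; the chain rule does
  -- the rest.
  let L : (Fin c.k → ℝ) →ₗ[ℝ] (Fin m → ℝ) :=
    LinearMap.pi fun j => (lam (r j) (c.coord x) : ℝ) • dotL (r j)
  refine ⟨(fderiv ℝ g fun j => (lam (r j) (c.coord x) : ℝ)).toLinearMap ∘ₗ L, fun w => ?_⟩
  exact hc.hasDerivAt_comp_curve hx w (fun j => hc.hasDerivAt_lam_curve hx w (r j)) hW hg hz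

theorem differentiableAt_curve (hc : c.IsChart n) (hx : x ∈ c.source) {a : X → ℝ}
    (ha : SmoothRealAt c.coord x a) (w : Fin c.k → ℝ) :
    DifferentiableAt ℝ (fun t => a (c.curve x w t)) 0 := by
  obtain ⟨D, hD⟩ := hc.exists_hasDerivAt_curve hx ha
  exact (hD w).differentiableAt

end GChart.IsChart

end Curves

/-! ### Subgroups of free abelian groups -/

/-- A proper subgroup of a free abelian group of finite rank is detected modulo a prime by an
integral functional. -/
theorem exists_prime_functional {Λ : Type*} [AddCommGroup Λ] [Module.Free ℤ Λ] [Module.Finite ℤ Λ]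
    (B : AddSubgroup Λ) (hB : B ≠ ⊤) :
    ∃ (p : ℕ) (ψ : Λ →+ ℤ), p.Prime ∧ (∀ b ∈ B, (p : ℤ) ∣ ψ b) ∧ ∃ l, ¬ (p : ℤ) ∣ ψ l := by
  -- In Smith normal form a proper subgroup either omits a basis direction, where any prime works
  -- and `2` is taken, or has a nonunit elementary divisor, where a prime factor is taken. The
  -- functional is the corresponding coordinate.
  obtain ⟨n, snf⟩ := (AddSubgroup.toIntSubmodule B).smithNormalForm (Module.Free.chooseBasis ℤ Λ)
  by_contra! hcon
  have hone : ∀ j, snf.bM.coord j (snf.bM j) = 1 := fun j => by simp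
  have h2 : ∀ j, j ∈ Set.range snf.f := by
    intro j
    by_contra hj
    have h := hcon 2 (snf.bM.coord j).toAddMonoidHom Nat.prime_two
      (fun b hb => by
        have : snf.bM.coord j b = 0 := snf.le_ker_coord_of_notMem_range hj hb
        change _ ∣ snf.bM.coord j b
        rw [this]; exact dvd_zero _) (snf.bM j)
    change _ ∣ snf.bM.coord j (snf.bM j) at h
    rw [hone] at h
    norm_num at h
  have h3 : ∀ i, (snf.a i).natAbs = 1 := by
    intro i
    by_contra hi
    obtain ⟨p, hp, hpa⟩ := Nat.exists_prime_and_dvd hi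
    have h := hcon p (snf.bM.coord (snf.f i)).toAddMonoidHom hp
      (fun b hb => by
        have h4 := DFunLike.congr_fun (snf.coord_apply_embedding_eq_smul_coord (i := i)) ⟨b, hb⟩
        change snf.bM.coord (snf.f i) b = snf.a i * _ at h4
        change _ ∣ snf.bM.coord (snf.f i) b
        rw [h4]
        exact (Int.natCast_dvd.2 hpa).mul_right _) (snf.bM (snf.f i))
    change _ ∣ snf.bM.coord (snf.f i) (snf.bM (snf.f i)) at h
    rw [hone] at h
    exact hp.one_lt.ne' (by exact_mod_cast Int.eq_one_of_dvd_one (by positivity) h)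
  refine hB (eq_top_iff.2 fun l _ => ?_)
  have hmem : ∀ j, snf.bM j ∈ AddSubgroup.toIntSubmodule B := by
    intro j
    obtain ⟨i, rfl⟩ := h2 j
    have h4 := snf.snf i
    have h5 : snf.bM (snf.f i) = snf.a i • (snf.bN i : Λ) := by
      rw [h4, smul_smul]
      rcases Int.natAbs_eq_iff.1 (h3 i) with h | h <;> simp [h]
    rw [h5]
    exact Submodule.smul_mem _ _ (snf.bN i).2
  have : l ∈ AddSubgroup.toIntSubmodule B := by
    rw [← snf.bM.sum_repr l]
    exact Submodule.sum_mem _ fun j _ => Submodule.smul_mem _ _ (hmem j)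
  exact this

/-! ### The group of exponents at a point -/

section ExponentGroup

variable {k : ℕ} {P : AddSubmonoid (Fin k → ℤ)}

theorem mem_addSubgroup_closure_iff (S : AddSubmonoid (Fin k → ℤ)) {g : Fin k → ℤ} :
    g ∈ AddSubgroup.closure (S : Set (Fin k → ℤ)) ↔ ∃ s ∈ S, ∃ r ∈ S, g + r = s := by
  constructor
  · intro h
    induction h using AddSubgroup.closure_induction with
    | mem x hx => exact ⟨x, hx, 0, S.zero_mem, add_zero x⟩
    | zero => exact ⟨0, S.zero_mem, 0, S.zero_mem, add_zero 0⟩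
    | add x y _ _ hx hy =>
      obtain ⟨s, hs, r, hr, h⟩ := hx
      obtain ⟨s', hs', r', hr', h'⟩ := hy
      exact ⟨s + s', S.add_mem hs hs', r + r', S.add_mem hr hr', by rw [← h, ← h']; abel⟩
    | neg x _ hx =>
      obtain ⟨s, hs, r, hr, h⟩ := hx
      exact ⟨r, hr, s, hs, by rw [← h]; abel⟩
  · rintro ⟨s, hs, r, hr, h⟩
    rw [← eq_sub_iff_add_eq] at h
    rw [h]
    exact sub_mem (AddSubgroup.subset_closure hs) (AddSubgroup.subset_closure hr)

/-- The group of exponents of interior germs at `m ∈ X_P`: the quotient of `P^gp` by the group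
generated by the support of `m`. -/
abbrev ExpGroup (m : ModelSpace P) : Type :=
  AddSubgroup.closure (P : Set (Fin k → ℤ)) ⧸
    (AddSubgroup.closure (supp m : Set (Fin k → ℤ))).addSubgroupOf
      (AddSubgroup.closure (P : Set (Fin k → ℤ)))

/-- The class of `p ∈ P` in the group of exponents. -/
def expClass (m : ModelSpace P) : P →+ ExpGroup m where
  toFun p := QuotientAddGroup.mk ⟨p, AddSubgroup.subset_closure p.2⟩
  map_zero' := rfl
  map_add' _ _ := rfl

theorem expClass_eq_iff {m : ModelSpace P} {p q : P} : expClass m p = expClass m q ↔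
    ∃ s : P, (s : Fin k → ℤ) ∈ supp m ∧ ∃ r : P, (r : Fin k → ℤ) ∈ supp m ∧ p + s = q + r := by
  have h1 : expClass m p = expClass m q ↔
      -(p : Fin k → ℤ) + q ∈ AddSubgroup.closure (supp m : Set (Fin k → ℤ)) :=
    QuotientAddGroup.eq
  rw [h1, mem_addSubgroup_closure_iff]
  constructor
  · rintro ⟨s, hs, r, hr, h⟩
    refine ⟨⟨s, supp_le m hs⟩, hs, ⟨r, supp_le m hr⟩, hr, Subtype.ext ?_⟩
    change (p : Fin k → ℤ) + s = q + r
    rw [← h]; abel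
  · rintro ⟨s, hs, r, hr, h⟩
    refine ⟨s, hs, r, hr, ?_⟩
    have h2 : (p : Fin k → ℤ) + s = q + r := congrArg Subtype.val h
    rw [add_assoc, ← h2]; abel

theorem expClass_eq_zero {m : ModelSpace P} {s : P} (hs : (s : Fin k → ℤ) ∈ supp m) :
    expClass m s = 0 := by
  rw [← map_zero (expClass m), expClass_eq_iff]
  exact ⟨0, (supp m).zero_mem, s, hs, by rw [add_zero, zero_add]⟩

theorem exists_expClass_sub {m : ModelSpace P} (l : ExpGroup m) :
    ∃ p q : P, l = expClass m p - expClass m q := by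
  induction l using QuotientAddGroup.induction_on with
  | H g =>
    obtain ⟨g, hg⟩ := g
    obtain ⟨p, hp, q, hq, h⟩ := (mem_addSubgroup_closure_iff P).1 hg
    refine ⟨⟨p, hp⟩, ⟨q, hq⟩, ?_⟩
    have : (⟨g, hg⟩ : AddSubgroup.closure (P : Set (Fin k → ℤ))) =
        ⟨p, AddSubgroup.subset_closure hp⟩ - ⟨q, AddSubgroup.subset_closure hq⟩ :=
      Subtype.ext (eq_sub_of_add_eq h)
    rw [this]
    rfl

instance (m : ModelSpace P) : Module.Finite ℤ (ExpGroup m) := by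
  have : Module.Finite ℤ (AddSubgroup.closure (P : Set (Fin k → ℤ))) :=
    inferInstanceAs (Module.Finite ℤ
      (AddSubgroup.toIntSubmodule (AddSubgroup.closure (P : Set (Fin k → ℤ)))))
  exact Module.Finite.of_surjective
    (QuotientAddGroup.mk' ((AddSubgroup.closure (supp m : Set (Fin k → ℤ))).addSubgroupOf
      (AddSubgroup.closure (P : Set (Fin k → ℤ))))).toIntLinearMap
    (QuotientAddGroup.mk'_surjective _)

/-- A torsion class `p - q` satisfies `n p + s = n q + r` with `s`, `r` in the support. Then `n (p -
q + s)` lies in the support, so saturation puts `p - q + s` in `P` and the face property puts it in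
the support. Finitely generated and torsion-free gives free. -/
theorem IsWeaklyToric.free_expGroup (hP : IsWeaklyToric P) (m : ModelSpace P) :
    Module.Free ℤ (ExpGroup m) := by
  have : IsAddTorsionFree (ExpGroup m) := by
    refine ⟨fun n hn => ?_⟩
    have hinj : ∀ l : ExpGroup m, n • l = 0 → l = 0 := by
      intro l hl
      obtain ⟨p, q, rfl⟩ := exists_expClass_sub l
      rw [nsmul_sub, ← map_nsmul, ← map_nsmul, sub_eq_zero, expClass_eq_iff] at hl
      obtain ⟨s, hs, r, hr, h⟩ := hl
      have h' : n • (p : Fin k → ℤ) + s = n • (q : Fin k → ℤ) + r := congrArg Subtype.val h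
      have hn1 : 1 ≤ n := Nat.one_le_iff_ne_zero.2 hn
      have hmem : n • ((p : Fin k → ℤ) - q + s) ∈ supp m := by
        obtain ⟨j, rfl⟩ := Nat.exists_eq_add_of_le' hn1
        have : (j + 1) • ((p : Fin k → ℤ) - q + s) = r + j • s := by
          rw [nsmul_add, nsmul_sub, succ_nsmul (s : Fin k → ℤ) j]
          generalize (j + 1) • (p : Fin k → ℤ) = A at h' ⊢
          generalize (j + 1) • (q : Fin k → ℤ) = B at h' ⊢
          rw [eq_sub_of_add_eq h']
          abel
        rw [this]
        exact add_mem hr (nsmul_mem hs j)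
      have hP' : (p : Fin k → ℤ) - q + s ∈ P := hP.saturated _
        (add_mem (sub_mem (AddSubgroup.subset_closure p.2) (AddSubgroup.subset_closure q.2))
          (AddSubgroup.subset_closure s.2)) n hn1 (supp_le m hmem)
      have hS := (isFace_supp m).of_nsmul_mem hP' hn1 hmem
      rw [sub_eq_zero, expClass_eq_iff]
      exact ⟨s, hs, ⟨_, hP'⟩, hS, Subtype.ext (by
        simp only [AddSubmonoid.coe_add]; abel)⟩
    intro a b hab
    have : n • (a - b) = 0 := by
      rw [nsmul_sub, sub_eq_zero]; exact hab
    exact sub_eq_zero.1 (hinj _ this)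
  exact Module.free_iff_isTorsionFree.2 inferInstance

/-- A functional on the group of exponents which is positive on all noninvertible exponents. -/
theorem exists_positive_functional (hP : P.FG) (m : ModelSpace P) :
    ∃ a : ExpGroup m →+ ℤ, ∀ p : P, (p : Fin k → ℤ) ∉ supp m → 0 < a (expClass m p) := by
  obtain ⟨a, h1, h2⟩ := (isFace_supp m).exists_exposing hP
  let f : AddSubgroup.closure (P : Set (Fin k → ℤ)) →+ ℤ :=
    { toFun := fun g => a ⬝ᵥ g, map_zero' := by simp
      map_add' := fun g h => dotProduct_add a g h }
  refine ⟨QuotientAddGroup.lift _ f ?_, fun p hp => h2 p p.2 hp⟩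
  intro g hg
  obtain ⟨s, hs, r, hr, h⟩ := (mem_addSubgroup_closure_iff (supp m)).1 hg
  have := congrArg (fun z => a ⬝ᵥ z) h
  simp only [dotProduct_add] at this
  change a ⬝ᵥ _ = 0
  rw [h1 s hs, h1 r hr, add_zero] at this
  exact this

/-- Every functional on the group of exponents becomes nonnegative on `P` after adding a suitable
multiple of `n` times a functional. -/
theorem exists_nonneg_modification (hP : P.FG) (m : ModelSpace P) (ψ : ExpGroup m →+ ℤ) {n : ℕ}
    (hn : 1 ≤ n) : ∃ α : ExpGroup m →+ ℤ, (∀ p, 0 ≤ α (expClass m p)) ∧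
      ∀ l, (n : ℤ) ∣ α l ↔ (n : ℤ) ∣ ψ l := by
  classical
  obtain ⟨a, ha⟩ := exists_positive_functional hP m
  obtain ⟨G, hG⟩ := hP
  have hGP : ∀ g ∈ G, g ∈ P := fun g hg => hG ▸ AddSubmonoid.subset_closure hg
  let ψ' : (Fin k → ℤ) → ℤ := fun g => if h : g ∈ P then |ψ (expClass m ⟨g, h⟩)| else 0
  have hψ' : ∀ g, 0 ≤ ψ' g := fun g => by
    by_cases h : g ∈ P
    · simp only [ψ', dif_pos h]; positivity
    · simp only [ψ', dif_neg h]; rfl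
  let N : ℤ := ∑ g ∈ G, ψ' g
  have hN0 : 0 ≤ N := Finset.sum_nonneg fun g _ => hψ' g
  -- `N` bounds `|ψ|` on the generators and `a ≥ 1` on the noninvertible ones, while invertible ones
  -- have class zero. The correction is a multiple of `n`.
  refine ⟨ψ + ((n : ℤ) * N) • a, fun p => ?_, fun l => ?_⟩
  · refine submonoid_induction hG (C := fun p => 0 ≤ (ψ + ((n : ℤ) * N) • a) (expClass m p))
      (fun g hg => ?_) ?_ (fun p q hp hq => ?_) p
    · by_cases hgs : (g : Fin k → ℤ) ∈ supp m
      · rw [expClass_eq_zero hgs, map_zero]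
      · have h1 := ha g hgs
        have h2 : |ψ (expClass m g)| ≤ N := by
          have := Finset.single_le_sum (f := ψ') (fun g _ => hψ' g) hg
          simpa only [ψ', dif_pos g.2] using this
        have h3 := neg_abs_le (ψ (expClass m g))
        have hn' : (1 : ℤ) ≤ n := by exact_mod_cast hn
        have h4 : N * 1 ≤ (n * N) * a (expClass m g) :=
          mul_le_mul (by nlinarith) h1 zero_le_one (by positivity)
        simp only [AddMonoidHom.add_apply, AddMonoidHom.coe_smul, Pi.smul_apply, smul_eq_mul]
        linarith
    · rw [map_zero, map_zero]
    · rw [map_add, map_add]; exact add_nonneg hp hq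
  · simp only [AddMonoidHom.add_apply, AddMonoidHom.coe_smul, Pi.smul_apply, smul_eq_mul]
    rw [mul_assoc]
    exact dvd_add_left (dvd_mul_right _ _)

end ExponentGroup

/-! ### Germs on manifolds with g-corners -/

section GermLemmas

variable {X : Type u} [TopologicalSpace X] {x : X}

theorem coe_mem_smoothGerms {𝒳 : GSpace X} {a : X → ℝ} :
    (a : Germ (𝓝 x) ℝ) ∈ smoothGerms 𝒳 x ↔
      ∀ c ∈ 𝒳.charts, x ∈ c.source → SmoothRealAt c.coord x a := by
  refine ⟨?_, fun h => ⟨a, rfl, h⟩⟩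
  rintro ⟨b, hb, h⟩ c hc hx
  exact (h c hc hx).congr (Germ.coe_eq.1 hb.symm)

theorem coe_mem_interiorGerms {𝒳 : GSpace X} {b : X → ℝ≥0} :
    (b : Germ (𝓝 x) ℝ≥0) ∈ interiorGerms 𝒳 x ↔
      ∀ c ∈ 𝒳.charts, x ∈ c.source → InteriorAt c.coord x b := by
  refine ⟨?_, fun h => ⟨b, rfl, h⟩⟩
  rintro ⟨b', hb, h⟩ c hc hx
  exact (h c hc hx).congr (Germ.coe_eq.1 hb.symm)

namespace GManifold

variable (𝒳 : GManifold X) {c d : GChart X}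

/-- Compatibility allows the alternative that `λ_p` vanishes near `x`; density of interior points
rules it out. -/
theorem interiorAt_lam (hc : c ∈ 𝒳.charts) (hd : d ∈ 𝒳.charts) (hxc : x ∈ c.source)
    (hxd : x ∈ d.source) (p : c.P) : InteriorAt d.coord x fun z => lam p (c.coord z) := by
  refine ((𝒳.compatible c hc d hd x ⟨hxc, hxd⟩).2 p).resolve_right fun h => ?_
  obtain ⟨z, hz1, hz2⟩ := (((𝒳.isChart c hc).frequently_full hxc).and_eventually h).exists
  exact hz1 p hz2

/-- The interior germ of `λ_p`. -/
def lamGerm (hc : c ∈ 𝒳.charts) (hxc : x ∈ c.source) (p : c.P) : interiorGerms 𝒳.toGSpace x :=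
  ⟨((fun z => lam p (c.coord z) : X → ℝ≥0) : Germ (𝓝 x) ℝ≥0),
    coe_mem_interiorGerms.2 fun _ hd hxd => 𝒳.interiorAt_lam hc hd hxc hxd p⟩

/-! ### Tangent vectors to strata -/

/-- The derivation of germs at `x` given by differentiation along the curve `c.curve x w`. -/
def curveDeriv (hc : c ∈ 𝒳.charts) (hxc : x ∈ c.source) (w : Fin c.k → ℝ) :
    smoothGerms 𝒳.toGSpace x →ₗ[ℝ] ℝ where
  toFun φ := φ.1.liftOn (fun a => deriv (fun t => a (c.curve x w t)) 0) fun _ _ h =>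
    Filter.EventuallyEq.deriv_eq (((𝒳.isChart c hc).tendsto_curve hxc w).eventually h)
  map_add' φ ψ := by
    obtain ⟨_, a, rfl, ha⟩ := φ
    obtain ⟨_, b, rfl, hb⟩ := ψ
    exact deriv_add ((𝒳.isChart c hc).differentiableAt_curve hxc (ha c hc hxc) w)
      ((𝒳.isChart c hc).differentiableAt_curve hxc (hb c hc hxc) w)
  map_smul' t φ := by
    obtain ⟨_, a, rfl, ha⟩ := φ
    exact deriv_const_mul t ((𝒳.isChart c hc).differentiableAt_curve hxc (ha c hc hxc) w)

theorem curveDeriv_coe (hc : c ∈ 𝒳.charts) (hxc : x ∈ c.source) (w : Fin c.k → ℝ) (a : X → ℝ)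
    (ha : (a : Germ (𝓝 x) ℝ) ∈ smoothGerms 𝒳.toGSpace x) :
    𝒳.curveDeriv hc hxc w ⟨a, ha⟩ = deriv (fun t => a (c.curve x w t)) 0 := rfl

/-- Twisting does not change the support, so the curve stays in the stratum of `x`, where the test
functions vanish. -/
theorem curveDeriv_mem (hc : c ∈ 𝒳.charts) (hxc : x ∈ c.source) (w : Fin c.k → ℝ) :
    𝒳.curveDeriv hc hxc w ∈ tangentStratum 𝒳.toGSpace (modelDepth (c.coord x)) x := by
  have hch := 𝒳.isChart c hc
  refine ⟨?_, ?_⟩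
  · rintro ⟨_, a, rfl, ha⟩ ⟨_, b, rfl, hb⟩
    have h1 := hch.differentiableAt_curve hxc (ha c hc hxc) w
    have h2 := hch.differentiableAt_curve hxc (hb c hc hxc) w
    have := deriv_mul h1 h2
    rw [hch.curve_zero hxc] at this
    exact this
  · intro a ha h
    rw [curveDeriv_coe]
    have hmem : Tendsto (c.curve x w) (𝓝 0) (𝓝[stratum 𝒳.toGSpace (modelDepth (c.coord x))] x) := by
      refine tendsto_nhdsWithin_iff.2 ⟨hch.tendsto_curve hxc w, ?_⟩
      filter_upwards [hch.eventually_coord_curve hxc w] with t ht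
      exact ⟨c, hc, ht.1, by rw [ht.2, modelDepth, modelDepth, supp_twist]⟩
    have h0 : (fun t => a (c.curve x w t)) =ᶠ[𝓝 0] fun _ => (0 : ℝ) := hmem.eventually h
    rw [h0.deriv_eq, deriv_const]

end GManifold

end GermLemmas

/-! ### Immersions: the differential -/

section ImmersionDifferential

variable {X : Type u} {Z : Type v} [TopologicalSpace X] [TopologicalSpace Z] (𝒳 : GManifold X)
  {𝒵 : GSpace Z} {f : X → Z} {x : X} {c : GChart X} {e : GChart Z}

/-- A vector tangent to the stratum of `x` along which all coordinates of `f` have derivative zero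
vanishes. -/
theorem dot_eq_zero_of_deriv_eq_zero (hf : IsInteriorAt 𝒳.toGSpace 𝒵 f x)
    (hinj : ∀ k, x ∈ stratum 𝒳.toGSpace k → InjOn (differential hf) (tangentStratum 𝒳.toGSpace k x))
    (hc : c ∈ 𝒳.charts) (hxc : x ∈ c.source) (he : e ∈ 𝒵.charts) (hxe : f x ∈ e.source)
    {G : Set (Fin e.k → ℤ)} (hG : AddSubmonoid.closure G = e.P) {w : Fin c.k → ℝ}
    (hw : ∀ g : e.P, (g : Fin e.k → ℤ) ∈ G →
      HasDerivAt (fun t => (lam g (e.coord (f (c.curve x w t))) : ℝ)) 0 0)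
    {p : c.P} (hp : (p : Fin c.k → ℤ) ∈ supp (c.coord x)) : dot w p = 0 := by
  have hch := 𝒳.isChart c hc
  have hall : ∀ q : e.P, HasDerivAt (fun t => (lam q (e.coord (f (c.curve x w t))) : ℝ)) 0 0 := by
    refine submonoid_induction hG hw ?_ fun p q hp hq => ?_
    · simpa [lam_zero] using hasDerivAt_const (0 : ℝ) (1 : ℝ)
    · simpa [lam_add] using hp.fun_mul hq
  -- Smooth germs on `Z` are smooth functions of the coordinates `λ_q`, whose derivatives along the
  -- curve all vanish. So the differential kills this tangent vector, and injectivity applies.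
  have hzero : 𝒳.curveDeriv hc hxc w = 0 := by
    refine hinj _ ⟨c, hc, hxc, rfl⟩ (𝒳.curveDeriv_mem hc hxc w) (Submodule.zero_mem _) ?_
    rw [map_zero]
    refine LinearMap.ext fun φ => ?_
    obtain ⟨_, a, rfl, ha⟩ := φ
    change deriv (fun t => a (f (c.curve x w t))) 0 = 0
    obtain ⟨n, r, W, g, hW, hg, hz⟩ := ha e he hxe
    have := hch.hasDerivAt_comp_curve hxc w (b := fun j z => (lam (r j) (e.coord (f z)) : ℝ))
      (d := 0) (fun j => hall (r j)) hW hg (a := fun z => a (f z)) (hf.continuousAt.eventually hz)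
    rw [map_zero] at this
    exact this.deriv
  have hsm : ((fun z => (lam p (c.coord z) : ℝ) : X → ℝ) : Germ (𝓝 x) ℝ) ∈
      smoothGerms 𝒳.toGSpace x :=
    coe_mem_smoothGerms.2 fun d hd hxd => (𝒳.interiorAt_lam hc hd hxc hxd p).smoothReal
  have h1 := 𝒳.curveDeriv_coe hc hxc w _ hsm
  rw [hzero, (hch.hasDerivAt_lam_curve hxc w p).deriv, LinearMap.zero_apply] at h1
  exact (mul_eq_zero.1 h1.symm).resolve_left (NNReal.coe_ne_zero.2 (mem_supp.1 hp))

end ImmersionDifferential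

/-! ### Immersions: the exponents -/

section ExponentMap

variable {X : Type u} {Z : Type v} [TopologicalSpace X] [TopologicalSpace Z] (𝒳 : GManifold X)
  {𝒵 : GSpace Z} {f : X → Z} {x : X} {c : GChart X} {e : GChart Z}

theorem exists_exponent (hc : c ∈ 𝒳.charts) (hxc : x ∈ c.source)
    (φ : interiorGerms 𝒳.toGSpace x) : ∃ p : c.P, ∃ (b : X → ℝ≥0) (h : X → ℝ),
      (b : Germ (𝓝 x) ℝ≥0) = φ.1 ∧ SmoothRealAt c.coord x h ∧
      ∀ᶠ z in 𝓝 x, 0 < h z ∧ (b z : ℝ) = lam p (c.coord z) * h z := by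
  obtain ⟨_, b, rfl, hb⟩ := φ
  obtain ⟨p, h, hh, hz⟩ := hb c hc hxc
  exact ⟨p, b, h, rfl, hh, hz⟩

theorem expClass_eq_of_eventually (hc : c ∈ 𝒳.charts) (hxc : x ∈ c.source) {p q : c.P}
    {b b' : X → ℝ≥0} {g h : X → ℝ} (hb : ∀ᶠ z in 𝓝 x, b z = b' z)
    (hg : SmoothRealAt c.coord x g) (hgz : ∀ᶠ z in 𝓝 x, 0 < g z ∧ (b z : ℝ) = lam p (c.coord z) * g z)
    (hh : SmoothRealAt c.coord x h)
    (hhz : ∀ᶠ z in 𝓝 x, 0 < h z ∧ (b' z : ℝ) = lam q (c.coord z) * h z) :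
    expClass (c.coord x) p = expClass (c.coord x) q := by
  have hch := 𝒳.isChart c hc
  have hcont := hch.continuousAt hxc
  refine expClass_eq_iff.2 (hch.exponent_unique hxc (hg.continuousAt hcont) (hh.continuousAt hcont)
    (hgz.mono fun z h => h.1) (hhz.mono fun z h => h.1) ?_)
  filter_upwards [hb, hgz, hhz] with z h1 h2 h3
  rw [← h2.2, ← h3.2, h1]

/-- The exponent of an interior germ, as an element of the group of exponents. -/
def exponent (hc : c ∈ 𝒳.charts) (hxc : x ∈ c.source) :
    Additive (interiorGerms 𝒳.toGSpace x) →+ ExpGroup (c.coord x) where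
  toFun φ := expClass (c.coord x) (exists_exponent 𝒳 hc hxc φ.toMul).choose
  map_zero' := by
    obtain ⟨b, h, hb, hh, hz⟩ := (exists_exponent 𝒳 hc hxc
      (Additive.toMul (0 : Additive (interiorGerms 𝒳.toGSpace x)))).choose_spec
    rw [← map_zero (expClass (c.coord x))]
    exact expClass_eq_of_eventually 𝒳 hc hxc (b' := fun _ => 1) (Germ.coe_eq.1 hb) hh hz
      (SmoothRealAt.const c.coord x 1) (by simp [lam_zero])
  map_add' φ ψ := by
    obtain ⟨b, h, hb, hh, hz⟩ := (exists_exponent 𝒳 hc hxc (Additive.toMul (φ + ψ))).choose_spec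
    obtain ⟨b', h', hb', hh', hz'⟩ := (exists_exponent 𝒳 hc hxc φ.toMul).choose_spec
    obtain ⟨b'', h'', hb'', hh'', hz''⟩ := (exists_exponent 𝒳 hc hxc ψ.toMul).choose_spec
    rw [← map_add]
    have hmul : (b : Germ (𝓝 x) ℝ≥0) = ((b' * b'' : X → ℝ≥0) : Germ (𝓝 x) ℝ≥0) := by
      rw [hb, Germ.coe_mul, hb', hb'']; rfl
    refine expClass_eq_of_eventually 𝒳 hc hxc (b' := b' * b'') (Germ.coe_eq.1 hmul) hh hz
      (hh'.mul hh'') ?_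
    filter_upwards [hz', hz''] with z h1 h2
    refine ⟨mul_pos h1.1 h2.1, ?_⟩
    rw [Pi.mul_apply, NNReal.coe_mul, h1.2, h2.2, lam_add, NNReal.coe_mul]
    ring

theorem exponent_eq (hc : c ∈ 𝒳.charts) (hxc : x ∈ c.source) {b : X → ℝ≥0}
    (hb : (b : Germ (𝓝 x) ℝ≥0) ∈ interiorGerms 𝒳.toGSpace x) {p : c.P} {h : X → ℝ}
    (hh : SmoothRealAt c.coord x h)
    (hz : ∀ᶠ z in 𝓝 x, 0 < h z ∧ (b z : ℝ) = lam p (c.coord z) * h z) :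
    exponent 𝒳 hc hxc (Additive.ofMul ⟨b, hb⟩) = expClass (c.coord x) p := by
  obtain ⟨b', h', hb', hh', hz'⟩ := (exists_exponent 𝒳 hc hxc ⟨b, hb⟩).choose_spec
  exact expClass_eq_of_eventually 𝒳 hc hxc (Germ.coe_eq.1 hb') hh' hz' hh hz

theorem exponent_lamGerm (hc : c ∈ 𝒳.charts) (hxc : x ∈ c.source) (p : c.P) :
    exponent 𝒳 hc hxc (Additive.ofMul (𝒳.lamGerm hc hxc p)) = expClass (c.coord x) p :=
  exponent_eq 𝒳 hc hxc _ (SmoothRealAt.const c.coord x 1) (by simp)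

theorem exists_exponent_eq (hc : c ∈ 𝒳.charts) (hxc : x ∈ c.source)
    (φ : Additive (interiorGerms 𝒳.toGSpace x)) :
    ∃ p, exponent 𝒳 hc hxc φ = expClass (c.coord x) p := ⟨_, rfl⟩

theorem exponent_eq_zero (hc : c ∈ 𝒳.charts) (hxc : x ∈ c.source)
    (φ : interiorGerms 𝒳.toGSpace x) (hφ : 0 < φ.1.value) :
    exponent 𝒳 hc hxc (Additive.ofMul φ) = 0 := by
  obtain ⟨φ, b, rfl, hb⟩ := φ
  obtain ⟨p, h, hh, hz⟩ := hb c hc hxc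
  refine (exponent_eq 𝒳 hc hxc (coe_mem_interiorGerms.2 hb) hh hz).trans ?_
  refine expClass_eq_zero (mem_supp.2 fun h0 => ?_)
  have h1 := hz.self_of_nhds.2
  rw [h0, NNReal.coe_zero, zero_mul] at h1
  have h2 : 0 < b x := hφ
  exact h2.ne' (NNReal.coe_eq_zero.1 h1)

/-- A nonnegative integer valued homomorphism, as a homomorphism to `ℕ`. -/
def toNatHom {M : Type*} [AddCommMonoid M] (f : M →+ ℤ) (h : ∀ m, 0 ≤ f m) : M →+ ℕ where
  toFun m := (f m).toNat
  map_zero' := by rw [map_zero]; rfl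
  map_add' a b := by rw [map_add, Int.toNat_add (h a) (h b)]

/-- Division of a homomorphism to `ℕ` by an integer dividing all its values. -/
def divNatHom {M : Type*} [AddCommMonoid M] (f : M →+ ℕ) (n : ℕ) (h : ∀ m, n ∣ f m) : M →+ ℕ where
  toFun m := f m / n
  map_zero' := by rw [map_zero, Nat.zero_div]
  map_add' a b := by rw [map_add, Nat.add_div_of_dvd_right (h a)]

theorem nsmul_divNatHom {M : Type*} [AddCommMonoid M] (f : M →+ ℕ) (n : ℕ) (h : ∀ m, n ∣ f m) :
    n • divNatHom f n h = f :=
  AddMonoidHom.ext fun m => Nat.mul_div_cancel' (h m)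

/-- If `M/N` is torsion-free, then `n β ∈ N` implies `β + N ∩ N ≠ ∅`, for cancellative `M`. -/
theorem exists_add_mem_of_nsmul_mem {M : Type*} [AddCommMonoid M] [IsCancelAdd M]
    {N : AddSubmonoid M} (hN : IsTorsionFreeMonoid (quotientCon N).Quotient) {n : ℕ} (hn : n ≠ 0)
    {β : M} (hβ : n • β ∈ N) : ∃ q ∈ N, ∃ q' ∈ N, β + q = q' := by
  have hquot : ((n • β : M) : (quotientCon N).Quotient) = ((0 : M) : (quotientCon N).Quotient) :=
    (AddCon.eq _).2 ⟨0, N.zero_mem, n • β, hβ, by rw [add_zero, zero_add]⟩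
  let of : (quotientCon N).Quotient →+ Algebra.GrothendieckAddGroup (quotientCon N).Quotient :=
    Algebra.GrothendieckAddGroup.of
  have h1 : n • of (β : (quotientCon N).Quotient) = n • of ((0 : M) : (quotientCon N).Quotient) := by
    have h0 : ((0 : M) : (quotientCon N).Quotient) = 0 := rfl
    have hb : ((n • β : M) : (quotientCon N).Quotient) = n • (β : (quotientCon N).Quotient) := rfl
    rw [h0, map_zero, smul_zero, ← map_nsmul, ← hb, hquot, h0, map_zero]
  have h2 := hN.nsmul_right_injective hn h1
  -- Equality in the group completion means equality after adding some class `s`; its representative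
  -- `m` is cancelled below.
  obtain ⟨⟨s, hs0⟩, hs⟩ := ((AddLocalization.addMonoidOf
    (⊤ : AddSubmonoid (quotientCon N).Quotient)).eq_iff_exists).1 h2
  obtain ⟨m, rfl⟩ := AddCon.mk'_surjective s
  obtain ⟨q, hq, q', hq', h⟩ := (AddCon.eq _).1 (show ((m + β : M) : (quotientCon N).Quotient) =
    ((m + 0 : M) : (quotientCon N).Quotient) from hs)
  refine ⟨q, hq, q', hq', ?_⟩
  rw [add_zero, add_assoc] at h
  exact add_left_cancel h

variable {𝒳}

/-- If `M̃_x f` is injective with torsion-free cokernel, then the exponents of the pullbacks of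
interior germs generate the group of exponents at `x`. -/
theorem closure_exponents_eq_top (hf : IsInteriorAt 𝒳.toGSpace 𝒵 f x)
    (hinj : Function.Injective (tildeMap hf))
    (htf : IsTorsionFreeMonoid (quotientCon (AddMonoidHom.mrange (tildeMap hf))).Quotient)
    (hc : c ∈ 𝒳.charts) (hxc : x ∈ c.source) :
    AddSubgroup.closure (Set.range ((exponent 𝒳 hc hxc).comp
      (MonoidHom.toAdditive (interiorPullback hf)))) = ⊤ := by
  have hch := 𝒳.isChart c hc
  by_contra hB
  have := hch.weaklyToric.free_expGroup (c.coord x)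
  obtain ⟨p, ψ, hp, hψ, l, hl⟩ := exists_prime_functional _ hB
  obtain ⟨α, hα, hαψ⟩ := exists_nonneg_modification hch.weaklyToric.fg (c.coord x) ψ hp.one_lt.le
  have hnn : ∀ φ, 0 ≤ (α.comp (exponent 𝒳 hc hxc)) φ := fun φ => by
    obtain ⟨q, hq⟩ := exists_exponent_eq 𝒳 hc hxc φ
    rw [AddMonoidHom.comp_apply, hq]
    exact hα q
  -- `α` is `ψ` made nonnegative without changing divisibility by `p`, so composing it with the
  -- exponent yields an element of `M̃_x X`. Germs positive at `x` have exponent zero.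
  let a : tildeM 𝒳.toGSpace x := ⟨toNatHom _ hnn, fun φ hφ => by
    change (α (exponent 𝒳 hc hxc (Additive.ofMul φ))).toNat = 0
    rw [exponent_eq_zero 𝒳 hc hxc φ hφ, map_zero, Int.toNat_zero]⟩
  have hdvd : ∀ φ, p ∣ (tildeMap hf a).1 φ := fun φ => by
    have h1 : (p : ℤ) ∣ α (exponent 𝒳 hc hxc
        ((MonoidHom.toAdditive (interiorPullback hf)) φ)) :=
      (hαψ _).2 (hψ _ (AddSubgroup.subset_closure ⟨φ, rfl⟩))
    rw [← Int.natCast_dvd_natCast]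
    change (p : ℤ) ∣ ((Int.toNat _ : ℕ) : ℤ)
    rwa [Int.toNat_of_nonneg (hnn _)]
  -- All values of the image of `a` are divisible by `p`, so the image is `p • b`.
  let b : tildeM 𝒵 (f x) := ⟨divNatHom _ p hdvd, fun φ hφ => by
    change (tildeMap hf a).1 (Additive.ofMul φ) / p = 0
    rw [(tildeMap hf a).2 φ hφ, Nat.zero_div]⟩
  have hb : p • b = tildeMap hf a := Subtype.ext (nsmul_divNatHom _ p hdvd)
  have : IsCancelAdd (tildeM 𝒵 (f x)) := by
    have hl : ∀ r s t : tildeM 𝒵 (f x), r + s = r + t → s = t := fun r s t h =>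
      Subtype.ext (AddMonoidHom.ext fun φ => Nat.add_left_cancel
        (DFunLike.congr_fun (congrArg Subtype.val h) φ))
    exact { add_left_cancel := hl
            add_right_cancel := fun r s t h => hl r s t (by rwa [add_comm r, add_comm r]) }
  obtain ⟨_, ⟨q, rfl⟩, _, ⟨q', rfl⟩, hqq⟩ := exists_add_mem_of_nsmul_mem htf hp.ne_zero (β := b)
    (hb ▸ AddMonoidHom.mem_mrange.2 ⟨a, rfl⟩)
  -- Torsion-freeness gave `b + f q = f q'`. Multiplying by `p` and using injectivity makes `a`
  -- divisible by `p` on each `λ_r`, against the choice of `ψ`.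
  have heq : a + p • q = p • q' := hinj (by
    rw [map_add, map_nsmul, map_nsmul, ← hqq, smul_add, hb])
  have hdiv : ∀ r : c.P, (p : ℤ) ∣ ψ (expClass (c.coord x) r) := fun r => by
    have h1 := DFunLike.congr_fun (congrArg Subtype.val heq)
      (Additive.ofMul (𝒳.lamGerm hc hxc r))
    have h2 : (α (exponent 𝒳 hc hxc (Additive.ofMul (𝒳.lamGerm hc hxc r)))).toNat +
      p * q.1 (Additive.ofMul (𝒳.lamGerm hc hxc r)) =
        p * q'.1 (Additive.ofMul (𝒳.lamGerm hc hxc r)) := h1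
    rw [exponent_lamGerm] at h2
    rw [← hαψ, ← Int.toNat_of_nonneg (hα r), Int.natCast_dvd_natCast]
    exact (Nat.dvd_add_left (dvd_mul_right p _)).1 (h2 ▸ dvd_mul_right p _)
  obtain ⟨r, s, rfl⟩ := exists_expClass_sub l
  exact hl (by rw [map_sub]; exact dvd_sub (hdiv r) (hdiv s))

/-- Under the hypotheses of `closure_exponents_eq_top`, each `λ_p` is, up to a smooth positive
factor, a quotient of pullbacks of coordinates. -/
theorem exists_quotient_of_pullbacks (hf : IsInteriorAt 𝒳.toGSpace 𝒵 f x)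
    (hinj : Function.Injective (tildeMap hf))
    (htf : IsTorsionFreeMonoid (quotientCon (AddMonoidHom.mrange (tildeMap hf))).Quotient)
    (hc : c ∈ 𝒳.charts) (hxc : x ∈ c.source) (he : e ∈ 𝒵.charts) (hxe : f x ∈ e.source)
    (p : c.P) : ∃ (q r : e.P) (H : X → ℝ), SmoothRealAt c.coord x H ∧ ∀ᶠ z in 𝓝 x, 0 < H z ∧
      (lam p (c.coord z) : ℝ) * H z * lam r (e.coord (f z)) = lam q (e.coord (f z)) := by
  have hch := 𝒳.isChart c hc
  have hmem : expClass (c.coord x) p ∈ AddSubgroup.closure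
      ((AddMonoidHom.mrange ((exponent 𝒳 hc hxc).comp
        (MonoidHom.toAdditive (interiorPullback hf))) :
          AddSubmonoid _) : Set (ExpGroup (c.coord x))) := by
    rw [AddMonoidHom.coe_mrange, closure_exponents_eq_top hf hinj htf hc hxc]
    exact AddSubgroup.mem_top _
  -- Exponents of pullbacks are closed under addition, so a member of the group they generate is a
  -- difference of two of them.
  have hdiff : ∃ φ φ' : interiorGerms 𝒵 (f x),
      expClass (c.coord x) p + exponent 𝒳 hc hxc (Additive.ofMul (interiorPullback hf φ')) =
        exponent 𝒳 hc hxc (Additive.ofMul (interiorPullback hf φ)) := by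
    generalize expClass (c.coord x) p = l at hmem ⊢
    set η := (exponent 𝒳 hc hxc).comp (MonoidHom.toAdditive (interiorPullback hf)) with hη
    have hadd : ∀ φ ψ : interiorGerms 𝒵 (f x), η (Additive.ofMul (φ * ψ)) =
      η (Additive.ofMul φ) + η (Additive.ofMul ψ) := fun φ ψ => map_add η _ _
    suffices h : ∃ φ φ' : interiorGerms 𝒵 (f x),
      l + η (Additive.ofMul φ') = η (Additive.ofMul φ) from h
    induction hmem using AddSubgroup.closure_induction with
    | mem y hy =>
      obtain ⟨φ, rfl⟩ := hy
      exact ⟨φ.toMul, 1, by rw [ofMul_one, map_zero, add_zero]; rfl⟩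
    | zero => exact ⟨1, 1, zero_add _⟩
    | add y z _ _ hy hz =>
      obtain ⟨φ, φ', h⟩ := hy
      obtain ⟨ψ, ψ', h'⟩ := hz
      exact ⟨φ * ψ, φ' * ψ', by rw [hadd, hadd, ← h, ← h']; abel⟩
    | neg y _ hy =>
      obtain ⟨φ, φ', h⟩ := hy
      exact ⟨φ', φ, by rw [← h]; abel⟩
  obtain ⟨⟨_, b, rfl, hb⟩, ⟨_, b', rfl, hb'⟩, hbb⟩ := hdiff
  obtain ⟨q, h, hh, hz⟩ := hb e he hxe
  obtain ⟨r, h', hh', hz'⟩ := hb' e he hxe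
  have hfb : ((fun z => b (f z) : X → ℝ≥0) : Germ (𝓝 x) ℝ≥0) ∈ interiorGerms 𝒳.toGSpace x :=
    hf.interiorGerms_comp ⟨b, rfl, hb⟩
  have hfb' : ((fun z => b' (f z) : X → ℝ≥0) : Germ (𝓝 x) ℝ≥0) ∈ interiorGerms 𝒳.toGSpace x :=
    hf.interiorGerms_comp ⟨b', rfl, hb'⟩
  obtain ⟨s, g, hg, hgz⟩ := coe_mem_interiorGerms.1 hfb c hc hxc
  obtain ⟨s', g', hg', hgz'⟩ := coe_mem_interiorGerms.1 hfb' c hc hxc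
  have e1 := exponent_eq 𝒳 hc hxc hfb hg hgz
  have e2 := exponent_eq 𝒳 hc hxc hfb' hg' hgz'
  have e3 : expClass (c.coord x) (p + s') = expClass (c.coord x) s := by
    rw [map_add, ← e1, ← e2]; exact hbb
  obtain ⟨t, ht, t', ht', htt⟩ := expClass_eq_iff.1 e3
  have hfh := hf.smoothReal_comp he hxe hh hc hxc
  have hfh' := hf.smoothReal_comp he hxe hh' hc hxc
  have htp := hch.eventually_lam_pos hxc ht
  have htp' := hch.eventually_lam_pos hxc ht'
  have hzf := hf.continuousAt.eventually hz
  have hzf' := hf.continuousAt.eventually hz'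
  have hden : SmoothRealAt c.coord x fun z => g' z * lam t' (c.coord z) * h (f z) :=
    (hg'.mul (SmoothRealAt.lam c.coord x t')).mul hfh
  -- `H` collects the smooth positive factors: those of the germs involved, and `λ_t`, `λ_t'`, which
  -- are positive near `x` because `t`, `t'` lie in the support.
  refine ⟨q, r, fun z => (lam t (c.coord z) * g z * h' (f z)) *
    (g' z * lam t' (c.coord z) * h (f z))⁻¹,
    (((SmoothRealAt.lam c.coord x t).mul hg).mul hfh').mul (hden.inv ?_), ?_⟩
  · filter_upwards [hgz', htp', hzf] with z h1 h2 h3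
    exact (mul_pos (mul_pos h1.1 h2) h3.1).ne'
  · filter_upwards [hgz, hgz', htp, htp', hzf, hzf'] with z h1 h2 h3 h4 h5 h6
    refine ⟨mul_pos (mul_pos (mul_pos h3 h1.1) h6.1)
      (inv_pos.2 (mul_pos (mul_pos h2.1 h4) h5.1)), ?_⟩
    have k1 : (lam p (c.coord z) : ℝ) * lam s' (c.coord z) * lam t (c.coord z) =
        lam s (c.coord z) * lam t' (c.coord z) := by
      have := congrArg (fun y => (lam y (c.coord z) : ℝ)) htt
      simpa [lam_add] using this
    have k2 := h1.2.symm.trans h5.2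
    have k3 := h2.2.symm.trans h6.2
    have hne := (mul_pos (mul_pos h2.1 h4) h5.1).ne'
    rw [← mul_left_inj' hne]
    have hsimp : ∀ a N r D : ℝ, D ≠ 0 → a * (N * D⁻¹) * r * D = a * N * r := by
      intro a N r D hD
      field_simp
    rw [hsimp _ _ _ _ hne]
    linear_combination (-(lam p (c.coord z) : ℝ) * lam t (c.coord z) * g z) * k3 +
      g' z * g z * k1 + g' z * lam t' (c.coord z) * k2

end ExponentMap

/-! ### Smooth left inverses -/

/-- A smooth map with injective derivative at a point has a smooth local left inverse, defined on an
open subset of the target. -/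
theorem exists_contDiffOn_leftInverse {E F : Type*} [NormedAddCommGroup E] [NormedSpace ℝ E]
    [FiniteDimensional ℝ E] [NormedAddCommGroup F] [NormedSpace ℝ F] [FiniteDimensional ℝ F]
    {Φ : E → F} {O : Set E} (hO : IsOpen O) (hΦ : ContDiffOn ℝ ∞ Φ O) {a : E} (ha : a ∈ O)
    (hinj : Function.Injective (fderiv ℝ Φ a)) :
    ∃ (W : Set F) (Ψ : F → E), IsOpen W ∧ ContDiffOn ℝ ∞ Ψ W ∧
      ∀ᶠ z in 𝓝 a, Φ z ∈ W ∧ Ψ (Φ z) = z := by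
  have := FiniteDimensional.complete ℝ E
  obtain ⟨L', hL'⟩ := (fderiv ℝ Φ a).toLinearMap.exists_leftInverse_of_injective
    (LinearMap.ker_eq_bot.2 hinj)
  let L : F →L[ℝ] E := LinearMap.toContinuousLinearMap L'
  have hLΦ : ContDiffOn ℝ ∞ (L ∘ Φ) O := L.contDiff.comp_contDiffOn hΦ
  have hat : ContDiffAt ℝ ∞ (L ∘ Φ) a := hLΦ.contDiffAt (hO.mem_nhds ha)
  have hfd : HasFDerivAt (L ∘ Φ) ((ContinuousLinearEquiv.refl ℝ E : E ≃L[ℝ] E) : E →L[ℝ] E) a := by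
    have h1 := ((hΦ.contDiffAt (hO.mem_nhds ha)).differentiableAt (by simp)).hasFDerivAt
    have h2 := L.hasFDerivAt.comp a h1
    have h3 : L ∘L fderiv ℝ Φ a = ((ContinuousLinearEquiv.refl ℝ E : E ≃L[ℝ] E) : E →L[ℝ] E) :=
      ContinuousLinearMap.ext fun z => LinearMap.congr_fun hL' z
    rwa [h3] at h2
  let H := hat.toOpenPartialHomeomorph (L ∘ Φ) hfd (by simp)
  have haH : a ∈ H.source := hat.mem_toOpenPartialHomeomorph_source hfd (by simp)
  -- Restricting to points where the derivative of `L ∘ Φ` is invertible makes the local inverse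
  -- smooth on a whole open set, not just at one point.
  let U : Set E := O ∩ fderiv ℝ (L ∘ Φ) ⁻¹' Set.range ((↑) : (E ≃L[ℝ] E) → E →L[ℝ] E)
  have hU : IsOpen U := (hLΦ.continuousOn_fderiv_of_isOpen hO (by simp)).isOpen_inter_preimage hO
    (ContinuousLinearEquiv.isOpen)
  have haU : a ∈ U := ⟨ha, ⟨_, hfd.fderiv.symm⟩⟩
  let W' : Set E := H.target ∩ H.symm ⁻¹' U
  have hW' : IsOpen W' := H.isOpen_inter_preimage_symm hU
  refine ⟨L ⁻¹' W', H.symm ∘ L, hW'.preimage L.continuous, ?_, ?_⟩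
  · refine ContDiffOn.comp (t := W') ?_ L.contDiff.contDiffOn fun z hz => hz
    intro y hy
    obtain ⟨hyO, eq, heq⟩ := hy.2
    have hc := hLΦ.contDiffAt (hO.mem_nhds hyO)
    refine (H.contDiffAt_symm (f₀' := eq) hy.1 ?_ hc).contDiffWithinAt
    change HasFDerivAt (L ∘ Φ) _ _
    rw [heq]
    exact (hc.differentiableAt (by simp)).hasFDerivAt
  · filter_upwards [H.open_source.mem_nhds haH, hU.mem_nhds haU] with z h1 h2
    have h3 : H.symm (L (Φ z)) = z := H.left_inv h1
    refine ⟨⟨H.map_source h1, ?_⟩, h3⟩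
    rw [mem_preimage, h3]
    exact h2

/-! ### Adapted coordinates on the model spaces -/

section AdaptedCoordinates

variable {k : ℕ} {P : AddSubmonoid (Fin k → ℤ)} {m : ℕ}

theorem exists_generators (hP : P.FG) : ∃ (m : ℕ) (gen : Fin m → P),
    AddSubmonoid.closure (Set.range fun j => (gen j : Fin k → ℤ)) = P := by
  obtain ⟨G, hG⟩ := hP
  have hGP : ∀ g ∈ G, g ∈ P := fun g hg => hG ▸ AddSubmonoid.subset_closure hg
  refine ⟨G.card, fun j => ⟨G.equivFin.symm j, hGP _ (G.equivFin.symm j).2⟩, ?_⟩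
  refine Eq.trans (congrArg AddSubmonoid.closure ?_) hG
  ext g
  refine ⟨?_, fun hg => ⟨G.equivFin ⟨g, hg⟩, by simp⟩⟩
  rintro ⟨j, rfl⟩
  exact (G.equivFin.symm j).2

open Classical in
/-- The noninvertible coordinates of `m` among the generators `gen`, at the point `m₀`. -/
def normalCoord (gen : Fin m → P) (m₀ m' : ModelSpace P) : Fin m → ℝ := fun j =>
  if (gen j : Fin k → ℤ) ∈ supp m₀ then 0 else lam (gen j) m'

theorem normalCoord_self (gen : Fin m → P) (m₀ : ModelSpace P) : normalCoord gen m₀ m₀ = 0 := by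
  funext j
  by_cases hj : (gen j : Fin k → ℤ) ∈ supp m₀
  · simp [normalCoord, hj]
  · have : lam (gen j) m₀ = 0 := by by_contra h; exact hj (mem_supp.2 h)
    simp [normalCoord, this]

theorem normalCoord_twist (gen : Fin m → P) (m₀ : ModelSpace P) (w : Fin k → ℝ) :
    normalCoord gen m₀ (twist m₀ w) = 0 := by
  funext j
  by_cases hj : (gen j : Fin k → ℤ) ∈ supp m₀
  · simp [normalCoord, hj]
  · have : lam (gen j) (twist m₀ w) = 0 := by
      by_contra h
      exact hj (supp_twist m₀ w ▸ mem_supp.2 h)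
    simp [normalCoord, this]

theorem continuous_normalCoord (gen : Fin m → P) (m₀ : ModelSpace P) :
    Continuous (normalCoord gen m₀) := by
  refine continuous_pi fun j => ?_
  by_cases hj : (gen j : Fin k → ℤ) ∈ supp m₀
  · simp only [normalCoord, if_pos hj]; exact continuous_const
  · simp only [normalCoord, if_neg hj]; exact continuous_lam_real _

/-- Logarithmic coordinates along the stratum of `m₀`: there are a linear projection `R` of `ℝᵏ`,
whose kernel is the annihilator of the support of `m₀`, and a map `y` to the range of `R`, such that
`λ_s m = exp ⟨y m, s⟩` for `s` in the support of `m₀`. -/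
theorem exists_tangential_coord {gen : Fin m → P}
    (hgen : AddSubmonoid.closure (Set.range fun j => (gen j : Fin k → ℤ)) = P) (m₀ : ModelSpace P) :
    ∃ (R : (Fin k → ℝ) →ₗ[ℝ] (Fin k → ℝ)) (y : ModelSpace P → (Fin k → ℝ)),
      (∀ w, (∀ s : P, (s : Fin k → ℤ) ∈ supp m₀ → dot w s = 0) → R w = 0) ∧
      (∀ m', supp m₀ ≤ supp m' → R (y m') = y m') ∧
      (∀ m', supp m₀ ≤ supp m' → ∀ s : P, (s : Fin k → ℤ) ∈ supp m₀ →
        (lam s m' : ℝ) = Real.exp (dot (y m') s)) ∧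
      (∀ w, y (twist m₀ w) = y m₀ + R w) ∧ ContinuousAt y m₀ := by
  classical
  -- `T` pairs with the generators in the support. A generalized inverse `R'` with `T R' T = T`
  -- makes `R = R' T` a projection with the kernel of `T`.
  let T : (Fin k → ℝ) →ₗ[ℝ] (Fin m → ℝ) :=
    LinearMap.pi fun j => if (gen j : Fin k → ℤ) ∈ supp m₀ then dotL (gen j) else 0
  have hT1 : ∀ w j, (gen j : Fin k → ℤ) ∈ supp m₀ → T w j = dot w (gen j) := fun w j hj => by
    simp [T, hj, dotL]
  have hT2 : ∀ w j, (gen j : Fin k → ℤ) ∉ supp m₀ → T w j = 0 := fun w j hj => by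
    simp [T, hj]
  obtain ⟨g, hg⟩ := T.rangeRestrict.exists_rightInverse_of_surjective
    (LinearMap.range_eq_top.2 T.surjective_rangeRestrict)
  obtain ⟨R', hR'⟩ := g.exists_extend
  have hTRT : ∀ w, T (R' (T w)) = T w := fun w => by
    have h1 : R' (T w) = g (T.rangeRestrict w) := LinearMap.congr_fun hR' (T.rangeRestrict w)
    rw [h1]
    exact congrArg Subtype.val (LinearMap.congr_fun hg (T.rangeRestrict w))
  -- Logarithms of the invertible generators, padded by zeros; near `m₀` this vector lies in the
  -- range of `T` by `exists_log`, and `y = R' l`.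
  let l : ModelSpace P → (Fin m → ℝ) := fun m' j =>
    if (gen j : Fin k → ℤ) ∈ supp m₀ then Real.log (lam (gen j) m') else 0
  have hl : ∀ m', supp m₀ ≤ supp m' → ∃ u, l m' = T u ∧ ∀ s : P, (s : Fin k → ℤ) ∈ supp m₀ →
      (lam s m' : ℝ) = Real.exp (dot u s) := by
    intro m' hm'
    obtain ⟨u, hu⟩ := exists_log m'
    refine ⟨u, ?_, fun s hs => hu s (hm' hs)⟩
    funext j
    by_cases hj : (gen j : Fin k → ℤ) ∈ supp m₀
    · rw [hT1 u j hj]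
      simp only [l, if_pos hj]
      rw [hu _ (hm' hj), Real.log_exp]
    · rw [hT2 u j hj]
      simp only [l, if_neg hj]
  have hdot : ∀ w w', T w = T w' → ∀ s ∈ supp m₀, dot w s = dot w' s := by
    intro w w' h s hs
    have hcl := (isFace_supp m₀).closure_inter hgen
    rw [← hcl] at hs
    induction hs using AddSubmonoid.closure_induction with
    | mem g hg =>
      obtain ⟨⟨j, rfl⟩, hj⟩ := hg
      rw [← hT1 w j hj, ← hT1 w' j hj, h]
    | zero => rw [dot_zero, dot_zero]
    | add p q _ _ hp hq => rw [dot_add, dot_add, hp, hq]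
  refine ⟨R' ∘ₗ T, fun m' => R' (l m'), fun w hw => ?_, fun m' hm' => ?_, fun m' hm' s hs => ?_,
    fun w => ?_, ?_⟩
  · have : T w = 0 := by
      funext j
      by_cases hj : (gen j : Fin k → ℤ) ∈ supp m₀
      · rw [hT1 w j hj, hw _ hj]; rfl
      · rw [hT2 w j hj]; rfl
    rw [LinearMap.comp_apply, this, map_zero]
  · obtain ⟨u, hu, -⟩ := hl m' hm'
    change R' (T (R' (l m'))) = R' (l m')
    rw [hu, hTRT]
  · obtain ⟨u, hu, hu'⟩ := hl m' hm'
    change _ = Real.exp (dot (R' (l m')) s)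
    rw [hu' s hs, hu, hdot _ _ (hTRT u) s hs]
  · change R' (l (twist m₀ w)) = R' (l m₀) + R' (T w)
    rw [← map_add]
    refine congrArg R' (funext fun j => ?_)
    by_cases hj : (gen j : Fin k → ℤ) ∈ supp m₀
    · rw [Pi.add_apply, hT1 w j hj]
      simp only [l, if_pos hj]
      rw [lam_twist, Real.log_mul (NNReal.coe_ne_zero.2 (mem_supp.1 hj)) (Real.exp_ne_zero _),
        Real.log_exp]
    · rw [Pi.add_apply, hT2 w j hj]
      simp only [l, if_neg hj, add_zero]
  · refine (LinearMap.continuous_of_finiteDimensional R').continuousAt.comp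
      (continuousAt_pi.2 fun j => ?_)
    by_cases hj : (gen j : Fin k → ℤ) ∈ supp m₀
    · simp only [l, if_pos hj]
      exact (continuous_lam_real (gen j)).continuousAt.log (NNReal.coe_ne_zero.2 (mem_supp.1 hj))
    · simp only [l, if_neg hj]
      exact continuousAt_const

/-- All coordinates `λ_p` are smooth functions of the adapted coordinates. -/
theorem exists_contDiff_eq_lam {gen : Fin m → P}
    (hgen : AddSubmonoid.closure (Set.range fun j => (gen j : Fin k → ℤ)) = P) {m₀ : ModelSpace P}
    {y : ModelSpace P → (Fin k → ℝ)}
    (hy : ∀ m', supp m₀ ≤ supp m' → ∀ s : P, (s : Fin k → ℤ) ∈ supp m₀ →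
        (lam s m' : ℝ) = Real.exp (dot (y m') s)) (p : P) :
    ∃ M : (Fin m → ℝ) × (Fin k → ℝ) → ℝ, ContDiff ℝ ∞ M ∧
      ∀ m', supp m₀ ≤ supp m' → (lam p m' : ℝ) = M (normalCoord gen m₀ m', y m') := by
  refine submonoid_induction hgen (C := fun p => ∃ M : (Fin m → ℝ) × (Fin k → ℝ) → ℝ,
    ContDiff ℝ ∞ M ∧ ∀ m', supp m₀ ≤ supp m' →
      (lam p m' : ℝ) = M (normalCoord gen m₀ m', y m')) ?_ ?_ ?_ p
  · rintro g ⟨j, hj⟩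
    have hj : gen j = g := Subtype.ext hj
    subst hj
    by_cases hj : (gen j : Fin k → ℤ) ∈ supp m₀
    · refine ⟨fun e => Real.exp (dot e.2 (gen j)), ?_, fun m' hm' => hy m' hm' _ hj⟩
      exact ((contDiff_dot _).comp contDiff_snd).exp
    · exact ⟨fun e => e.1 j, by fun_prop, fun m' _ => by simp [normalCoord, hj]⟩
  · exact ⟨fun _ => 1, contDiff_const, fun m' _ => by rw [lam_zero, NNReal.coe_one]⟩
  · rintro p q ⟨M, hM, h⟩ ⟨M', hM', h'⟩
    exact ⟨fun e => M e * M' e, hM.mul hM', fun m' hm' => by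
      rw [lam_add, NNReal.coe_mul, h m' hm', h' m' hm']⟩

end AdaptedCoordinates

/-- Smooth functions are smooth functions of the adapted coordinates. -/
theorem GChart.IsChart.exists_contDiffOn_eq {X : Type u} [TopologicalSpace X] {c : GChart X} {n : ℕ}
    {x : X} (hc : c.IsChart n) (hx : x ∈ c.source) {m : ℕ} {gen : Fin m → c.P}
    (hgen : AddSubmonoid.closure (Set.range fun j => (gen j : Fin c.k → ℤ)) = c.P)
    {y : ModelSpace c.P → (Fin c.k → ℝ)}
    (hy : ∀ m', supp (c.coord x) ≤ supp m' → ∀ s : c.P, (s : Fin c.k → ℤ) ∈ supp (c.coord x) →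
        (lam s m' : ℝ) = Real.exp (dot (y m') s))
    {a : X → ℝ} (ha : SmoothRealAt c.coord x a) :
    ∃ (O : Set ((Fin m → ℝ) × (Fin c.k → ℝ))) (A : (Fin m → ℝ) × (Fin c.k → ℝ) → ℝ),
      IsOpen O ∧ ContDiffOn ℝ ∞ A O ∧ ∀ᶠ z in 𝓝 x,
        (normalCoord gen (c.coord x) (c.coord z), y (c.coord z)) ∈ O ∧
        a z = A (normalCoord gen (c.coord x) (c.coord z), y (c.coord z)) := by
  obtain ⟨n, r, W, g, hW, hg, hz⟩ := ha
  choose M hM hMr using fun j => exists_contDiff_eq_lam hgen hy (r j)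
  have hM' : ContDiff ℝ ∞ fun e j => M j e := contDiff_pi.2 hM
  refine ⟨(fun e j => M j e) ⁻¹' W, fun e => g fun j => M j e, hW.preimage hM'.continuous,
    hg.comp hM'.contDiffOn fun e he => he, ?_⟩
  filter_upwards [hz, hc.eventually_supp_le hx] with z h1 h2
  have : (fun j => M j (normalCoord gen (c.coord x) (c.coord z), y (c.coord z))) =
      fun j => (lam (r j) (c.coord z) : ℝ) := funext fun j => (hMr j _ h2).symm
  refine ⟨?_, ?_⟩
  · rw [mem_preimage, this]; exact h1.1
  · rw [this]; exact h1.2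

/-- A continuous function `t` with `t b = a` for interior functions `a`, `b` is of the form `λ_p g`
with `g` smooth and positive. -/
theorem GChart.IsChart.exists_eq_lam_mul {X : Type u} [TopologicalSpace X] {c : GChart X} {n : ℕ}
    {x : X} (hc : c.IsChart n) (hx : x ∈ c.source) {t : X → ℝ} {a b : X → ℝ≥0}
    (ht : ∀ᶠ z in 𝓝 x, ContinuousAt t z) (ha : InteriorAt c.coord x a) (hb : InteriorAt c.coord x b)
    (h : ∀ᶠ z in 𝓝 x, t z * b z = a z) : ∃ (p : c.P) (g : X → ℝ), SmoothRealAt c.coord x g ∧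
      ∀ᶠ z in 𝓝 x, 0 < g z ∧ t z = lam p (c.coord z) * g z := by
  obtain ⟨p, g, hg, hgz⟩ := ha
  obtain ⟨q, f, hf, hfz⟩ := hb
  have hcont := hc.continuousAt hx
  -- Continuity of `t` bounds `λ_p / λ_q`, which forces `q` to divide `p` up to the support; the
  -- quotient `r` is the exponent of `t`.
  obtain ⟨s, hs, r, hr⟩ := hc.exists_add_eq_of_eq_mul hx (p := p) (q := q)
    (t := fun z => t z * f z / g z)
    ((ht.self_of_nhds.mul (hf.continuousAt hcont)).div (hg.continuousAt hcont)
      hgz.self_of_nhds.1.ne') (by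
      filter_upwards [hgz, hfz, h] with z h1 h2 h3
      have := h1.1.ne'
      rw [h1.2, h2.2] at h3
      field_simp
      linarith)
  have hsp := hc.eventually_lam_pos hx hs
  have hG : SmoothRealAt c.coord x fun z => g z * (f z * lam s (c.coord z))⁻¹ :=
    hg.mul ((hf.mul (SmoothRealAt.lam c.coord x s)).inv (by
      filter_upwards [hfz, hsp] with z h1 h2 using (mul_pos h1.1 h2).ne'))
  refine ⟨r, _, hG, ?_⟩
  -- At interior points `λ_q` can be cancelled; continuity of both sides and density of such points
  -- extend the identity to all points near `x`.
  have hfull : ∀ᶠ z in 𝓝 x, (∀ p : c.P, lam p (c.coord z) ≠ 0) →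
      t z = lam r (c.coord z) * (g z * (f z * lam s (c.coord z))⁻¹) := by
    filter_upwards [hgz, hfz, h, hsp] with z h1 h2 h3 h4 h5
    have k1 : (lam p (c.coord z) : ℝ) * lam s (c.coord z) =
        lam q (c.coord z) * lam r (c.coord z) := by
      have := congrArg (fun y => (lam y (c.coord z) : ℝ)) hr
      simpa [lam_add] using this
    rw [h1.2, h2.2] at h3
    have hq : (lam q (c.coord z) : ℝ) ≠ 0 := NNReal.coe_ne_zero.2 (h5 q)
    have hf0 := h2.1.ne'
    have hs0 := h4.ne'
    rw [← mul_assoc, ← div_eq_mul_inv, eq_div_iff (mul_ne_zero hf0 hs0), ← mul_right_inj' hq]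
    linear_combination (lam s (c.coord z) : ℝ) * h3 + g z * k1
  have hcr : ∀ᶠ z in 𝓝 x, ContinuousAt (fun z =>
      (lam r (c.coord z) : ℝ) * (g z * (f z * lam s (c.coord z))⁻¹)) z :=
    hc.eventually_continuousAt hx ((SmoothRealAt.lam c.coord x r).mul hG)
  filter_upwards [hgz, hfz, hsp, hfull.eventually_nhds, ht, hcr, hc.eventually_source hx]
    with z h1 h2 h3 h4 h5 h6 h7
  refine ⟨mul_pos h1.1 (inv_pos.2 (mul_pos h2.1 h3)), ?_⟩
  by_contra hne
  have hev := (h5.ne_iff_eventually_ne h6).1 hne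
  obtain ⟨z', hz1, hz2, hz3⟩ := ((hc.frequently_full h7).and_eventually (h4.and hev)).exists
  exact hz3 (hz2 hz1)

/-! ### Lifting smooth maps through immersions -/

/-- The map `(κ, y) ↦ (κ A(κ, y), B(κ, y), y - R y)`. -/
def blockMap {m l k : ℕ} (A : Fin m → (Fin m → ℝ) × (Fin k → ℝ) → ℝ)
    (B : Fin l → (Fin m → ℝ) × (Fin k → ℝ) → ℝ) (R : (Fin k → ℝ) →ₗ[ℝ] (Fin k → ℝ))
    (e : (Fin m → ℝ) × (Fin k → ℝ)) : (Fin m → ℝ) × (Fin l → ℝ) × (Fin k → ℝ) :=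
  (fun j => e.1 j * A j e, fun i => B i e, e.2 - R e.2)

section BlockMap

variable {m l k : ℕ} {A : Fin m → (Fin m → ℝ) × (Fin k → ℝ) → ℝ}
    {B : Fin l → (Fin m → ℝ) × (Fin k → ℝ) → ℝ} {R : (Fin k → ℝ) →ₗ[ℝ] (Fin k → ℝ)}
    {O : Set ((Fin m → ℝ) × (Fin k → ℝ))}

theorem contDiffOn_blockMap (hA : ∀ j, ContDiffOn ℝ ∞ (A j) O) (hB : ∀ j, ContDiffOn ℝ ∞ (B j) O) :
    ContDiffOn ℝ ∞ (blockMap A B R) O := by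
  have hR : ContDiff ℝ ∞ fun e : (Fin m → ℝ) × (Fin k → ℝ) => e.2 - R e.2 :=
    contDiff_snd.sub ((LinearMap.toContinuousLinearMap R).contDiff.comp contDiff_snd)
  refine ContDiffOn.prodMk (contDiffOn_pi.2 fun j => ContDiffOn.mul ?_ (hA j))
    (ContDiffOn.prodMk (contDiffOn_pi.2 hB) hR.contDiffOn)
  exact ((contDiff_apply ℝ ℝ j).comp contDiff_fst).contDiffOn

/-- At `κ = 0` the derivative in direction `(μ, w)` has first component `A μ`, so `μ = 0`. The last
component then forces `R w = w`, and the hypothesis on `B` gives `w = 0`. -/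
theorem injective_fderiv_blockMap (hO : IsOpen O) (hA : ∀ j, ContDiffOn ℝ ∞ (A j) O)
    (hB : ∀ j, ContDiffOn ℝ ∞ (B j) O) {y : Fin k → ℝ} (hy : ((0 : Fin m → ℝ), y) ∈ O)
    (hA0 : ∀ j, A j (0, y) ≠ 0)
    (hBR : ∀ w, R w = w → (∀ i, HasDerivAt (fun t : ℝ => B i (0, y + t • w)) 0 0) → w = 0) :
    Function.Injective (fderiv ℝ (blockMap A B R) (0, y)) := by
  have hd : HasFDerivAt (blockMap A B R) (fderiv ℝ (blockMap A B R) (0, y)) (0, y) :=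
    (((contDiffOn_blockMap hA hB).contDiffAt (hO.mem_nhds hy)).differentiableAt
      (by simp)).hasFDerivAt
  rw [injective_iff_map_eq_zero]
  rintro ⟨μ, w⟩ hv
  have hline : HasDerivAt (fun t : ℝ => (((0 : Fin m → ℝ), y) + t • (μ, w))) (μ, w) 0 := by
    simpa using ((hasDerivAt_id (0 : ℝ)).smul_const (μ, w)).const_add ((0 : Fin m → ℝ), y)
  have h0 : ((0 : Fin m → ℝ), y) + (0 : ℝ) • (μ, w) = (0, y) := by simp
  have hcomp : HasDerivAt (fun t : ℝ => blockMap A B R (((0 : Fin m → ℝ), y) + t • (μ, w))) 0 0 := by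
    rw [← hv]
    exact HasFDerivAt.comp_hasDerivAt (0 : ℝ) (by rw [h0]; exact hd) hline
  have h1 : ∀ j, HasDerivAt (fun t : ℝ => (t * μ j) * A j (((0 : Fin m → ℝ), y) + t • (μ, w))) 0 0 := by
    intro j
    have := ((ContinuousLinearMap.proj (R := ℝ) (φ := fun _ : Fin m => ℝ) j).comp
      (ContinuousLinearMap.fst ℝ (Fin m → ℝ) ((Fin l → ℝ) × (Fin k → ℝ)))).hasFDerivAt.comp_hasDerivAt
        (0 : ℝ) hcomp
    simpa [Function.comp_def, blockMap] using this
  have h2 : ∀ i, HasDerivAt (fun t : ℝ => B i (((0 : Fin m → ℝ), y) + t • (μ, w))) 0 0 := by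
    intro i
    have := ((ContinuousLinearMap.proj (R := ℝ) (φ := fun _ : Fin l => ℝ) i).comp
      ((ContinuousLinearMap.fst ℝ (Fin l → ℝ) (Fin k → ℝ)).comp
        (ContinuousLinearMap.snd ℝ (Fin m → ℝ) ((Fin l → ℝ) × (Fin k → ℝ))))).hasFDerivAt.comp_hasDerivAt
          (0 : ℝ) hcomp
    simpa [Function.comp_def, blockMap] using this
  have h3 : HasDerivAt (fun t : ℝ => (y + t • w) - R (y + t • w)) 0 0 := by
    have := ((ContinuousLinearMap.snd ℝ (Fin l → ℝ) (Fin k → ℝ)).comp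
        (ContinuousLinearMap.snd ℝ (Fin m → ℝ) ((Fin l → ℝ) × (Fin k → ℝ)))).hasFDerivAt.comp_hasDerivAt
          (0 : ℝ) hcomp
    simpa [Function.comp_def, blockMap] using this
  have hμ : μ = 0 := by
    funext j
    have hAj : DifferentiableAt ℝ (A j) (0, y) :=
      ((hA j).contDiffAt (hO.mem_nhds hy)).differentiableAt (by simp)
    have hAl : HasDerivAt (fun t : ℝ => A j (((0 : Fin m → ℝ), y) + t • (μ, w)))
        (fderiv ℝ (A j) (0, y) (μ, w)) 0 :=
      HasFDerivAt.comp_hasDerivAt (0 : ℝ) (by rw [h0]; exact hAj.hasFDerivAt) hline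
    have hl : HasDerivAt (fun t : ℝ => t * μ j) (μ j) 0 := by
      simpa using (hasDerivAt_id (0 : ℝ)).mul_const (μ j)
    have := (hl.fun_mul hAl).unique (h1 j)
    rw [h0, zero_mul, zero_mul, add_zero] at this
    exact (mul_eq_zero.1 this).resolve_right (hA0 j)
  subst hμ
  have hw : R w = w := by
    have hl : HasDerivAt (fun t : ℝ => (y + t • w) - R (y + t • w)) (w - R w) 0 := by
      have e1 : HasDerivAt (fun t : ℝ => (y - R y) + t • (w - R w)) (w - R w) 0 := by
        simpa using ((hasDerivAt_id (0 : ℝ)).smul_const (w - R w)).const_add (y - R y)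
      refine e1.congr_of_eventuallyEq (Eventually.of_forall fun t => ?_)
      simp only [map_add, map_smul, smul_sub]
      abel
    exact (sub_eq_zero.1 (hl.unique h3)).symm
  have hw0 := hBR w hw fun i => by simpa using h2 i
  rw [hw0]
  rfl

end BlockMap

section Lifting

variable {X : Type u} {X' : Type w} {Z : Type v} [TopologicalSpace X] [TopologicalSpace X']
  [TopologicalSpace Z] {𝒳 : GManifold X} {𝒵 : GSpace Z} {f : X → Z} {c : GChart X} {e : GChart Z}
  {c' : GChart X'} {n' : ℕ} {x' : X'}

/-- Let `f : X → Z` be an interior immersion at `h x'`, for a homeomorphism `h : X' → X`. If `f ∘ h`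
is smooth at `x'`, then `h` is smooth and interior at `x'`. -/
theorem interiorAt_of_comp_immersion (h : X' ≃ₜ X) (hc' : c'.IsChart n') (hx' : x' ∈ c'.source)
    (hf : IsInteriorAt 𝒳.toGSpace 𝒵 f (h x'))
    (hdiff : ∀ k, h x' ∈ stratum 𝒳.toGSpace k →
      InjOn (differential hf) (tangentStratum 𝒳.toGSpace k (h x')))
    (hinj : Function.Injective (tildeMap hf))
    (htf : IsTorsionFreeMonoid (quotientCon (AddMonoidHom.mrange (tildeMap hf))).Quotient)
    (hc : c ∈ 𝒳.charts) (hxc : h x' ∈ c.source) (he : e ∈ 𝒵.charts) (hxe : f (h x') ∈ e.source)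
    (heP : e.P.FG)
    (hs : ∀ q : e.P, SmoothNonnegAt c'.coord x' fun z => lam q (e.coord (f (h z)))) (p : c.P) :
    InteriorAt c'.coord x' fun z => lam p (c.coord (h z)) := by
  have hch := 𝒳.isChart c hc
  have hht : Tendsto h (𝓝 x') (𝓝 (h x')) := h.continuous.continuousAt
  have hcl := hch.continuousAt hxc
  obtain ⟨m, gen, hgen⟩ := exists_generators hch.weaklyToric.fg
  obtain ⟨l, gen', hgen'⟩ := exists_generators heP
  obtain ⟨R, y, hR0, hRy, hy, hytw, hycont⟩ := exists_tangential_coord hgen (c.coord (h x'))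
  choose q r H hH hHz using fun j =>
    exists_quotient_of_pullbacks hf hinj htf hc hxc he hxe (gen j)
  have hF : ∀ q : e.P, InteriorAt c.coord (h x') fun z => lam q (e.coord (f z)) :=
    hf.interior c hc hxc e he hxe
  -- the pullbacks of the coordinates of `Z` are interior on `X'`
  have hF' : ∀ q : e.P, InteriorAt c'.coord x' fun z => lam q (e.coord (f (h z))) := by
    intro q
    -- Vanishing near `x'` would transfer to a neighbourhood of `h x'` since `h` is a homeomorphism,
    -- where the interior function is nonzero at dense points.
    refine (hs q).resolve_right fun h0 => ?_
    obtain ⟨p, g, -, hg⟩ := hF q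
    have h1 : ∀ᶠ z in 𝓝 (h x'), lam q (e.coord (f z)) = 0 := by
      rw [← h.map_nhds_eq]; exact h0
    obtain ⟨z, hz1, hz2, hz3⟩ := ((hch.frequently_full hxc).and_eventually (h1.and hg)).exists
    have h4 : (lam q (e.coord (f z)) : ℝ) = lam p (c.coord z) * g z := hz3.2
    rw [hz2, NNReal.coe_zero] at h4
    exact mul_ne_zero (NNReal.coe_ne_zero.2 (hz1 p)) hz3.1.ne' h4.symm
  -- the normal coordinates, multiplied by `H`, are interior on `X'`
  have hT : ∀ j, ∃ (p : c'.P) (g : X' → ℝ), SmoothRealAt c'.coord x' g ∧ ∀ᶠ z in 𝓝 x', 0 < g z ∧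
      (lam (gen j) (c.coord (h z)) : ℝ) * H j (h z) = lam p (c'.coord z) * g z := by
    intro j
    refine hc'.exists_eq_lam_mul hx' (t := fun z => (lam (gen j) (c.coord (h z)) : ℝ) * H j (h z))
      ?_ (hF' (q j)) (hF' (r j)) ?_
    · have := hch.eventually_continuousAt hxc ((SmoothRealAt.lam c.coord _ (gen j)).mul (hH j))
      filter_upwards [hht.eventually this] with z hz
      exact hz.comp (f := h) h.continuous.continuousAt
    · exact (hht.eventually (hHz j)).mono fun z hz => hz.2
  choose OA A hOA hA hAz using fun j => hch.exists_contDiffOn_eq hxc hgen hy (hH j)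
  choose OB B hOB hB hBz using fun i =>
    hch.exists_contDiffOn_eq hxc hgen hy (hF (gen' i)).smoothReal
  let K : X → (Fin m → ℝ) × (Fin c.k → ℝ) := fun z =>
    (normalCoord gen (c.coord (h x')) (c.coord z), y (c.coord z))
  have hK : ContinuousAt K (h x') := ((continuous_normalCoord gen _).continuousAt.comp hcl).prodMk
    (hycont.comp hcl)
  have hK0 : K (h x') = (0, y (c.coord (h x'))) := by
    simp only [K, normalCoord_self]
  let O : Set ((Fin m → ℝ) × (Fin c.k → ℝ)) := (⋂ j, OA j) ∩ ⋂ i, OB i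
  have hO : IsOpen O := (isOpen_iInter_of_finite hOA).inter (isOpen_iInter_of_finite hOB)
  have hAO : ∀ j, ContDiffOn ℝ ∞ (A j) O := fun j =>
    (hA j).mono (inter_subset_left.trans (iInter_subset _ j))
  have hBO : ∀ i, ContDiffOn ℝ ∞ (B i) O := fun i =>
    (hB i).mono (inter_subset_right.trans (iInter_subset _ i))
  have h0O : ((0 : Fin m → ℝ), y (c.coord (h x'))) ∈ O := by
    rw [← hK0]
    exact ⟨mem_iInter.2 fun j => (hAz j).self_of_nhds.1, mem_iInter.2 fun i => (hBz i).self_of_nhds.1⟩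
  have hinjΦ : Function.Injective (fderiv ℝ (blockMap A B R) (0, y (c.coord (h x')))) := by
    refine injective_fderiv_blockMap hO hAO hBO h0O (fun j => ?_) fun w hw hBw => ?_
    · have h1 := (hAz j).self_of_nhds.2
      have h2 := (hHz j).self_of_nhds.1
      rw [normalCoord_self] at h1
      rw [← h1]
      exact h2.ne'
    · rw [← hw]
      refine hR0 w fun s hs => ?_
      refine dot_eq_zero_of_deriv_eq_zero 𝒳 hf hdiff hc hxc he hxe hgen' ?_ hs
      rintro g ⟨i, hi⟩
      have hi : gen' i = g := Subtype.ext hi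
      subst hi
      refine (hBw i).congr_of_eventuallyEq ?_
      filter_upwards [(hch.tendsto_curve hxc w).eventually (hBz i),
        hch.eventually_coord_curve hxc w] with t h1 h2
      rw [h1.2, h2.2, normalCoord_twist, hytw, map_smul, hw]
  -- `Ψ` recovers the adapted coordinates of `h z` from functions already known to be smooth on
  -- `X'`.
  obtain ⟨W, Ψ, hW, hΨ, hΨz⟩ := exists_contDiffOn_leftInverse hO
    (contDiffOn_blockMap hAO hBO) h0O hinjΦ
  -- smooth functions on `X` pull back to smooth functions on `X'`
  have hpull : ∀ a : X → ℝ, SmoothRealAt c.coord (h x') a →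
      SmoothRealAt c'.coord x' fun z => a (h z) := by
    intro a ha
    obtain ⟨Oa, α, hOa, hα, hαz⟩ := hch.exists_contDiffOn_eq hxc hgen hy ha
    -- The third slot is zero because the tangential coordinates `y` of actual points near `h x'`
    -- lie in the range of the projection `R`.
    let J : (Fin m ⊕ Fin l → ℝ) → (Fin m → ℝ) × (Fin l → ℝ) × (Fin c.k → ℝ) := fun v =>
      (fun j => v (Sum.inl j), fun i => v (Sum.inr i), 0)
    have hJ : ContDiff ℝ ∞ J := (contDiff_pi.2 fun j => contDiff_apply ℝ ℝ _).prodMk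
      ((contDiff_pi.2 fun j => contDiff_apply ℝ ℝ _).prodMk contDiff_const)
    let b : Fin m ⊕ Fin l → X' → ℝ := Sum.elim
      (fun j z => normalCoord gen (c.coord (h x')) (c.coord (h z)) j * H j (h z))
      (fun i z => (lam (gen' i) (e.coord (f (h z))) : ℝ))
    have hb : ∀ ι, SmoothRealAt c'.coord x' (b ι) := by
      rintro (j | i)
      · change SmoothRealAt c'.coord x'
          fun z => normalCoord gen (c.coord (h x')) (c.coord (h z)) j * H j (h z)
        by_cases hj : (gen j : Fin c.k → ℤ) ∈ supp (c.coord (h x'))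
        · simp only [normalCoord, if_pos hj, zero_mul]
          exact SmoothRealAt.const _ _ _
        · simp only [normalCoord, if_neg hj]
          obtain ⟨p, g, hg, hz⟩ := hT j
          exact ((SmoothRealAt.lam c'.coord x' p).mul hg).congr (hz.mono fun z hz => hz.2)
      · exact (hF' (gen' i)).smoothReal
    have hJb : ∀ᶠ z in 𝓝 x', J (fun ι => b ι z) = blockMap A B R (K (h z)) := by
      filter_upwards [hht.eventually (eventually_all.2 hAz), hht.eventually (eventually_all.2 hBz),
        hht.eventually (hch.eventually_supp_le hxc)] with z h1 h2 h3
      refine Prod.ext (funext fun j => ?_) (Prod.ext (funext fun i => ?_) ?_)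
      · change _ * H j (h z) = _ * A j (K (h z))
        rw [(h1 j).2]
      · exact (h2 i).2
      · change 0 = y (c.coord (h z)) - R (y (c.coord (h z)))
        rw [hRy _ h3, sub_self]
    have hKh : Tendsto (fun z => K (h z)) (𝓝 x') (𝓝 (0, y (c.coord (h x')))) := by
      rw [← hK0]; exact hK.tendsto.comp hht
    have hV : IsOpen (W ∩ Ψ ⁻¹' Oa) := hΨ.continuousOn.isOpen_inter_preimage hW hOa
    refine SmoothRealAt.comp_fintype hb (W := J ⁻¹' (W ∩ Ψ ⁻¹' Oa)) (g := fun v => α (Ψ (J v)))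
      (hV.preimage hJ.continuous) ?_ ?_ ?_
    · exact hα.comp ((hΨ.mono inter_subset_left).comp hJ.contDiffOn fun v hv => hv)
        fun v hv => hv.2
    · filter_upwards [hJb, hKh.eventually hΨz, hht.eventually hαz] with z h1 h2 h3
      rw [mem_preimage, h1]
      refine ⟨h2.1, ?_⟩
      rw [mem_preimage, h2.2]
      exact h3.1
    · filter_upwards [hJb, hKh.eventually hΨz, hht.eventually hαz] with z h1 h2 h3
      rw [h1, h2.2]
      exact h3.2
  refine submonoid_induction hgen (C := fun p => InteriorAt c'.coord x'
    fun z => lam p (c.coord (h z))) ?_ ?_ ?_ p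
  · rintro g ⟨j, hj⟩
    have hj : gen j = g := Subtype.ext hj
    subst hj
    obtain ⟨p, g, hg, hz⟩ := hT j
    have hHp := hht.eventually (hHz j)
    -- `H j ∘ h` is now known to be smooth and positive, so it can be divided out of the interior
    -- function `(λ H) ∘ h`.
    refine ⟨p, fun z => g z * (H j (h z))⁻¹,
      hg.mul ((hpull _ (hH j)).inv (hHp.mono fun z hz => hz.1.ne')), ?_⟩
    filter_upwards [hz, hHp] with z h1 h2
    refine ⟨mul_pos h1.1 (inv_pos.2 h2.1), ?_⟩
    rw [← mul_assoc, ← div_eq_mul_inv, eq_div_iff h2.1.ne', h1.2]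
  · simp only [lam_zero]
    exact InteriorAt.one _ _
  · intro p q hp hq
    simp only [lam_add]
    exact hp.mul hq

end Lifting

/-- If `i` is an immersion, `h` is a homeomorphism and `i ∘ h` is smooth, then `h` is smooth. -/
theorem isSmooth_of_comp_immersion {X : Type u} {X' : Type w} {Y : Type v} [TopologicalSpace X]
    [TopologicalSpace X'] [TopologicalSpace Y] {𝒳 : GManifold X} {𝒳' : GManifold X'}
    {𝒴 : GManifold Y} {i : X → Y} (hi : IsImmersion 𝒳.toGSpace 𝒴.toGSpace i) (h : X' ≃ₜ X)
    (hih : IsSmooth 𝒳'.toGSpace 𝒴.toGSpace (i ∘ h)) : IsSmooth 𝒳'.toGSpace 𝒳.toGSpace h := by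
  refine ⟨h.continuous, fun x' c' hc' hx' c hc hxc p => Or.inl ?_⟩
  obtain ⟨-, δ, -, hδ⟩ := hi
  obtain ⟨hf, hdiff, hinj, htf⟩ := hδ (h x')
  obtain ⟨e, he, hxe⟩ := hf.covered
  -- A chart of `C(Y)` comes from a chart `d` of `Y` and a face `F`. Its coordinates are the `λ_q`
  -- of `d` with `q ∈ F`, so smoothness of `i ∘ h` into `Y` suffices.
  obtain ⟨d, hd, F, hF, rfl⟩ := id he
  exact interiorAt_of_comp_immersion h (𝒳'.isChart c' hc') hx' hf hdiff hinj htf hc hxc he hxe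
    (hF.fg (𝒴.isChart d hd).weaklyToric.fg)
    (fun q : F => hih.2 x' c' hc' hx' d hd hxe.1 ⟨(q : Fin d.k → ℤ), hF.le q.2⟩) p

/-! ### Invariance of the dimension -/

section Dimension

variable {X : Type u} [TopologicalSpace X] {c d : GChart X} {n n' : ℕ} {x : X}

/-- A basis of `P^gp`, written as differences of elements of `P`. -/
theorem exists_basis_differences {k : ℕ} (P : AddSubmonoid (Fin k → ℤ)) :
    ∃ b : Fin (rank P) → P × P,
      (∀ w, (∀ j, dot w (b j).1 = dot w (b j).2) → ∀ p ∈ P, dot w p = 0) ∧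
      ∀ v : Fin (rank P) → ℝ, ∃ w : Fin k → ℝ, ∀ j, dot w (b j).1 - dot w (b j).2 = v j := by
  have hfin : Module.Finite ℤ (AddSubgroup.closure (P : Set (Fin k → ℤ))) :=
    inferInstanceAs (Module.Finite ℤ
      (AddSubgroup.toIntSubmodule (AddSubgroup.closure (P : Set (Fin k → ℤ)))))
  have hfree : Module.Free ℤ (AddSubgroup.closure (P : Set (Fin k → ℤ))) :=
    inferInstanceAs (Module.Free ℤ
      (AddSubgroup.toIntSubmodule (AddSubgroup.closure (P : Set (Fin k → ℤ)))))
  let β : Module.Basis (Fin (rank P)) ℤ (AddSubgroup.closure (P : Set (Fin k → ℤ))) :=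
    Module.finBasis ℤ _
  choose s hs r hr hsr using fun j => (mem_addSubgroup_closure_iff P).1 (β j).2
  have hβ : ∀ w j, dot w (s j) - dot w (r j) = dot w (β j) := fun w j => by
    rw [← hsr j, dot_add]; ring
  refine ⟨fun j => (⟨s j, hs j⟩, ⟨r j, hr j⟩), fun w hw p hp => ?_, fun v => ?_⟩
  · let f : AddSubgroup.closure (P : Set (Fin k → ℤ)) →+ ℝ :=
      { toFun := fun g => dot w g, map_zero' := dot_zero w
        map_add' := fun g h => dot_add w g h }
    have hf : f.toIntLinearMap = 0 := β.ext fun j => by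
      change dot w (β j) = 0
      rw [← hβ, hw j, sub_self]
    exact LinearMap.congr_fun hf ⟨p, AddSubgroup.subset_closure hp⟩
  · obtain ⟨w, hw⟩ := exists_eq_dot
      (AddSubgroup.closure (P : Set (Fin k → ℤ))).toAddSubmonoid
      (β.constr ℤ v).toAddMonoidHom
    refine ⟨w, fun j => ?_⟩
    have h1 : β.constr ℤ v (β j) = dot w (β j) := hw (β j)
    change dot w (s j) - dot w (r j) = v j
    rw [hβ, ← h1, Module.Basis.constr_basis]

/-- At a point of the interior of two compatible charts, the ranks of their monoids compare: the
derivative of the transition map is injective. -/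
theorem GChart.IsChart.rank_le (hc : c.IsChart n) (hxc : x ∈ c.source)
    (hxd : x ∈ d.source) (hfull : ∀ p : c.P, lam p (c.coord x) ≠ 0)
    (hfull' : ∀ q : d.P, lam q (d.coord x) ≠ 0) (hcd : c.Compatible d) : rank c.P ≤ rank d.P := by
  obtain ⟨h1, h2⟩ := hcd x ⟨hxc, hxd⟩
  choose D hD using fun q : d.P => hc.exists_hasDerivAt_curve hxc (h1 q).smoothReal
  have hne : ∀ q : d.P, (lam q (d.coord x) : ℝ) ≠ 0 := fun q => NNReal.coe_ne_zero.2 (hfull' q)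
  have hDadd : ∀ p q w, D (p + q) w = D p w * lam q (d.coord x) + lam p (d.coord x) * D q w := by
    intro p q w
    have := (hD p w).fun_mul (hD q w)
    rw [hc.curve_zero hxc] at this
    refine (hD (p + q) w).unique ?_
    simpa only [lam_add, NNReal.coe_mul] using this
  -- The logarithmic derivative of `λ_q` is additive in `q`, hence a pairing with a tangent vector
  -- `w'` in the other chart.
  have hext : ∀ w, ∃ w' : Fin d.k → ℝ, ∀ q : d.P, D q w / lam q (d.coord x) = dot w' q := by
    intro w
    let θ : d.P →+ ℝ :=
      { toFun := fun q => D q w / lam q (d.coord x)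
        map_zero' := by
          have h0 := hDadd 0 0 w
          rw [add_zero, lam_zero, NNReal.coe_one] at h0
          have : D 0 w = 0 := by linarith
          rw [this, zero_div]
        map_add' := fun p q => by
          rw [hDadd, lam_add, NNReal.coe_mul]
          have := hne p
          have := hne q
          field_simp }
    exact exists_eq_dot d.P θ
  have hker : ∀ w, (∀ q, D q w = 0) → ∀ p ∈ c.P, dot w p = 0 := by
    intro w hw p hp
    obtain ⟨m, r, W, g, hW, hg, hz⟩ := (h2 ⟨p, hp⟩).smoothReal
    have e1 := hc.hasDerivAt_comp_curve hxc w (b := fun j z => (lam (r j) (d.coord z) : ℝ)) (d := 0)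
      (fun j => by
        have e0 := hD (r j) w
        rwa [hw (r j)] at e0) hW hg hz
    rw [map_zero] at e1
    have e2 := e1.unique (hc.hasDerivAt_lam_curve hxc w ⟨p, hp⟩)
    exact (mul_eq_zero.1 e2.symm).resolve_left (NNReal.coe_ne_zero.2 (hfull _))
  obtain ⟨b, -, hb⟩ := exists_basis_differences c.P
  obtain ⟨b', hb', -⟩ := exists_basis_differences d.P
  let ρ : (Fin c.k → ℝ) →ₗ[ℝ] (Fin (rank c.P) → ℝ) :=
    LinearMap.pi fun j => dotL (b j).1 - dotL (b j).2
  have hρ : Function.Surjective ρ := fun v => by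
    obtain ⟨w, hw⟩ := hb v
    exact ⟨w, funext hw⟩
  obtain ⟨σ, hσ⟩ := ρ.exists_rightInverse_of_surjective (LinearMap.range_eq_top.2 hρ)
  let L : (Fin c.k → ℝ) →ₗ[ℝ] (Fin (rank d.P) → ℝ) := LinearMap.pi fun j =>
    (lam (b' j).1 (d.coord x) : ℝ)⁻¹ • D (b' j).1 - (lam (b' j).2 (d.coord x) : ℝ)⁻¹ • D (b' j).2
  -- If the logarithmic derivatives vanish on a basis of `d.P^gp`, then all `λ_q` have zero
  -- derivative. The reverse transition map then shows that `w` pairs to zero with `c.P`.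
  have hinj : Function.Injective (L ∘ₗ σ) := by
    rw [← LinearMap.ker_eq_bot, LinearMap.ker_eq_bot']
    intro v hv
    obtain ⟨w', hw'⟩ := hext (σ v)
    have h3 : ∀ j, dot w' (b' j).1 = dot w' (b' j).2 := fun j => by
      rw [← hw', ← hw', ← sub_eq_zero, div_eq_inv_mul, div_eq_inv_mul]
      exact congrFun hv j
    have h4 := hb' w' h3
    have h5 := hker (σ v) fun q => by
      have := hw' q
      rw [h4 q q.2] at this
      exact (div_eq_zero_iff.1 this).resolve_right (hne q)
    have h6 : ρ (σ v) = v := LinearMap.congr_fun hσ v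
    rw [← h6]
    funext j
    change dot (σ v) (b j).1 - dot (σ v) (b j).2 = 0
    rw [h5 _ (b j).1.2, h5 _ (b j).2.2, sub_zero]
  simpa using LinearMap.finrank_le_finrank_of_injective hinj

theorem GChart.Compatible.symm (h : c.Compatible d) : d.Compatible c :=
  fun x hx => ⟨(h x ⟨hx.2, hx.1⟩).2, (h x ⟨hx.2, hx.1⟩).1⟩

/-- Ranks can be compared at a point interior for both charts. One is found in two moves: supports
can only grow nearby, so a point interior for `c` stays so when moved slightly to become interior
for `d`. -/
theorem GChart.IsChart.dim_eq (hc : c.IsChart n) (hd : d.IsChart n') (hxc : x ∈ c.source)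
    (hxd : x ∈ d.source) (hcd : c.Compatible d) : n = n' := by
  obtain ⟨z, hz, hzc, hzd⟩ := ((hc.frequently_full hxc).and_eventually
    ((hc.eventually_source hxc).and (hd.eventually_source hxd))).exists
  obtain ⟨z', hz', hzz, hzc', hzd'⟩ := ((hd.frequently_full hzd).and_eventually
    ((hc.eventually_supp_le hzc).and
      ((hc.eventually_source hzc).and (hd.eventually_source hzd)))).exists
  have hz2 : ∀ p : c.P, lam p (c.coord z') ≠ 0 := fun p => mem_supp.1 (hzz (mem_supp.2 (hz p)))
  rw [← hc.rank_eq, ← hd.rank_eq]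
  exact le_antisymm (hc.rank_le hzc' hzd' hz2 hz' hcd) (hd.rank_le hzd' hzc' hz' hz2 hcd.symm)

end Dimension

/-! ### Transport of structure -/

section Transport

variable {A : Type u} {B : Type v} [TopologicalSpace A] [TopologicalSpace B]

/-- The pullback of a chart under a map. -/
def GChart.pullback (c : GChart B) (φ : A → B) : GChart A where
  k := c.k
  P := c.P
  source := φ ⁻¹' c.source
  coord := fun z => c.coord (φ z)

theorem GChart.IsChart.pullback {c : GChart B} {n : ℕ} (hc : c.IsChart n) (φ : A ≃ₜ B) :
    (c.pullback φ).IsChart n where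
  weaklyToric := hc.weaklyToric
  rank_eq := hc.rank_eq
  isOpen_source := hc.isOpen_source.preimage φ.continuous
  isOpenEmbedding := hc.isOpenEmbedding.comp
    (φ.sets (s := φ ⁻¹' c.source) (t := c.source) rfl).isOpenEmbedding

theorem GChart.Compatible.pullback {c d : GChart B} (h : c.Compatible d) (φ : A ≃ₜ B) :
    (c.pullback φ).Compatible (d.pullback φ) := fun x hx =>
  ⟨fun q => ((h (φ x) hx).1 q).comp_continuousAt φ.continuous.continuousAt,
    fun p => ((h (φ x) hx).2 p).comp_continuousAt φ.continuous.continuousAt⟩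

theorem GChart.pullback_symm_pullback (c : GChart A) (φ : A ≃ₜ B) :
    (c.pullback φ.symm).pullback φ = c := by
  obtain ⟨k, P, s, e⟩ := c
  simp [GChart.pullback, ← preimage_comp]

theorem GChart.pullback_pullback_symm (c : GChart B) (φ : A ≃ₜ B) :
    (c.pullback φ).pullback φ.symm = c :=
  c.pullback_symm_pullback φ.symm

/-- Transport of the structure of a manifold with g-corners along a homeomorphism. -/
def GManifold.transport (𝒳 : GManifold A) (φ : A ≃ₜ B) : GManifold B where
  charts := {c | c.pullback φ ∈ 𝒳.charts}
  t2 := have := 𝒳.t2; φ.t2Space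
  secondCountable := have := 𝒳.secondCountable; φ.symm.isEmbedding.secondCountableTopology
  dim := 𝒳.dim
  isChart c hc := by
    rw [← c.pullback_pullback_symm φ]
    exact (𝒳.isChart _ hc).pullback φ.symm
  compatible c hc d hd := by
    rw [← c.pullback_pullback_symm φ, ← d.pullback_pullback_symm φ]
    exact (𝒳.compatible _ hc _ hd).pullback φ.symm
  cover b := by
    obtain ⟨c, hc, hx⟩ := 𝒳.cover (φ.symm b)
    refine ⟨c.pullback φ.symm, ?_, hx⟩
    rw [mem_ofPred_eq, c.pullback_symm_pullback φ]
    exact hc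
  maximal c hc h := 𝒳.maximal _ (hc.pullback φ) fun d hd => by
    rw [← d.pullback_symm_pullback φ]
    refine (h _ ?_).pullback φ
    rw [mem_ofPred_eq, d.pullback_symm_pullback φ]
    exact hd

theorem isDiffeo_transport {C : Type w} [TopologicalSpace C] {𝒲 : GManifold C} {𝒳 : GManifold A}
    (h : C ≃ₜ A) (φ : A ≃ₜ B) (h1 : IsSmooth 𝒲.toGSpace 𝒳.toGSpace h)
    (h2 : IsSmooth 𝒳.toGSpace 𝒲.toGSpace h.symm) {f : C → B} (hf : ∀ z, f z = φ (h z)) :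
    IsDiffeo 𝒲.toGSpace (𝒳.transport φ).toGSpace f := by
  refine ⟨(h.trans φ).toEquiv, (funext hf).symm, ⟨(h.trans φ).continuous, ?_⟩,
    ⟨(h.trans φ).symm.continuous, ?_⟩⟩
  · intro x c hc hx d hd hxd
    exact h1.2 x c hc hx _ hd hxd
  · intro b c hc hb d hd hbd q
    have := (h2.2 (φ.symm b) _ hc (by
      change φ (φ.symm b) ∈ c.source
      rwa [φ.apply_symm_apply]) d hd hbd q).comp_continuousAt φ.symm.continuous.continuousAt
    simp only [GChart.pullback, φ.apply_symm_apply] at this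
    exact this

theorem GManifold.isSmooth_id (𝒳 : GManifold A) : IsSmooth 𝒳.toGSpace 𝒳.toGSpace id :=
  ⟨continuous_id, fun x c hc hx d hd hxd => (𝒳.compatible c hc d hd x ⟨hx, hxd⟩).1⟩

/-- Smoothness of the diffeomorphism and of its inverse, read in these two charts, is exactly
smoothness of the transition maps. -/
theorem GManifold.compatible_of_isDiffeo {𝒳 : GManifold A} {φ : A ≃ₜ B} {𝒮 : GManifold B}
    (h : IsDiffeo 𝒳.toGSpace 𝒮.toGSpace φ) {c d : GChart B} (hc : c ∈ (𝒳.transport φ).charts)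
    (hd : d ∈ 𝒮.charts) : c.Compatible d := by
  obtain ⟨g, hg, h1, h2⟩ := h
  have hgs : ∀ b, g.symm b = φ.symm b := fun b => by
    rw [Equiv.symm_apply_eq, hg, φ.apply_symm_apply]
  rintro b ⟨hbc, hbd⟩
  have hbc' : φ.symm b ∈ (c.pullback φ).source := by
    change φ (φ.symm b) ∈ c.source
    rwa [φ.apply_symm_apply]
  refine ⟨fun q => ?_, fun p => ?_⟩
  · have := (h1.2 (φ.symm b) _ hc hbc' d hd (by rwa [hg, φ.apply_symm_apply]) q).comp_continuousAt
      φ.symm.continuous.continuousAt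
    simpa only [GChart.pullback, hg, φ.apply_symm_apply] using this
  · have := h2.2 b d hd hbd _ hc (by rwa [hgs]) p
    simpa only [GChart.pullback, hgs, φ.apply_symm_apply] using this

/-- Compatible maximal atlases of equal dimension contain each other's charts. When the space is
nonempty, two charts at a common point determine the dimension; when it is empty, nothing does. -/
theorem GManifold.eq_transport_of_isDiffeo {𝒳 : GManifold A} {φ : A ≃ₜ B} {𝒮 : GManifold B}
    (hdim : Nonempty A ∨ 𝒮.dim = 𝒳.dim) (h : IsDiffeo 𝒳.toGSpace 𝒮.toGSpace φ) :
    𝒮 = 𝒳.transport φ := by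
  have hcomp := fun c hc d hd => GManifold.compatible_of_isDiffeo (c := c) (d := d) h hc hd
  have hdim' : 𝒮.dim = (𝒳.transport φ).dim := by
    rcases hdim with ⟨⟨a⟩⟩ | hdim
    · obtain ⟨c, hc, hac⟩ := (𝒳.transport φ).cover (φ a)
      obtain ⟨d, hd, had⟩ := 𝒮.cover (φ a)
      exact (((𝒳.transport φ).isChart c hc).dim_eq (𝒮.isChart d hd) hac had (hcomp c hc d hd)).symm
    · exact hdim
  have hcharts : 𝒮.charts = (𝒳.transport φ).charts := by
    ext c
    refine ⟨fun hc => ?_, fun hc => ?_⟩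
    · refine (𝒳.transport φ).maximal c (hdim' ▸ 𝒮.isChart c hc) fun d hd => ?_
      exact (hcomp d hd c hc).symm
    · exact 𝒮.maximal c (hdim' ▸ (𝒳.transport φ).isChart c hc) fun d hd => hcomp c hc d hd
  -- The charts and the dimension are the only data of the structure; the remaining fields are
  -- propositions.
  generalize 𝒳.transport φ = 𝒯 at hdim' hcharts
  obtain ⟨⟨C⟩, _, _, n⟩ := 𝒮
  obtain ⟨⟨C'⟩, _, _, n'⟩ := 𝒯
  obtain rfl : C = C' := hcharts
  obtain rfl : n = n' := hdim'
  rfl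

end Transport

end GCorners

end

theorem corollary4p12 {X : Type u} {Y : Type v} [TopologicalSpace X] [TopologicalSpace Y]
    (𝒳 : GCorners.GManifold X) (𝒴 : GCorners.GManifold Y) (i : X → Y)
    (hi : GCorners.IsEmbedding 𝒳.toGSpace 𝒴.toGSpace i) :
    ∃ 𝒮 : GCorners.GManifold (Set.range i),
      𝒮.dim = 𝒳.dim ∧
      GCorners.IsDiffeo 𝒳.toGSpace 𝒮.toGSpace (Set.rangeFactorization i) ∧
      (∀ 𝒮' : GCorners.GManifold (Set.range i), (Nonempty X ∨ 𝒮'.dim = 𝒳.dim) →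
        GCorners.IsDiffeo 𝒳.toGSpace 𝒮'.toGSpace (Set.rangeFactorization i) → 𝒮' = 𝒮) ∧
      (∀ (X' : Type w) [TopologicalSpace X'] (𝒳' : GCorners.GManifold X') (i' : X' → Y),
        GCorners.IsEmbedding 𝒳'.toGSpace 𝒴.toGSpace i' → ∀ h : Set.range i' = Set.range i,
        GCorners.IsDiffeo 𝒳'.toGSpace 𝒮.toGSpace
          (fun x' => (⟨i' x', h ▸ Set.mem_range_self x'⟩ : Set.range i))) := by
  let φ : X ≃ₜ Set.range i := hi.2.toHomeomorph
  refine ⟨𝒳.transport φ, rfl, ?_, fun 𝒮' hdim h' => ?_, fun X' _ 𝒳' i' hi' h => ?_⟩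
  · exact GCorners.isDiffeo_transport (Homeomorph.refl X) φ 𝒳.isSmooth_id 𝒳.isSmooth_id fun _ => rfl
  · exact GCorners.GManifold.eq_transport_of_isDiffeo hdim h'
  · let ψ : X' ≃ₜ Set.range i := hi'.2.toHomeomorph.trans (Homeomorph.setCongr h)
    have hψ : ∀ z, ((ψ z : Set.range i) : Y) = i' z := fun _ => rfl
    have h1 : i ∘ (ψ.trans φ.symm) = i' := funext fun z => by
      have : φ (φ.symm (ψ z)) = ψ z := φ.apply_symm_apply _
      exact congrArg Subtype.val this
    have h2 : i' ∘ (ψ.trans φ.symm).symm = i := by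
      rw [← h1, Function.comp_assoc, Homeomorph.self_comp_symm, Function.comp_id]
    -- The comparison homeomorphism is smooth because `i` is an immersion and `i'` is smooth; its
    -- inverse is smooth with the two roles exchanged.
    refine GCorners.isDiffeo_transport (ψ.trans φ.symm) φ
      (GCorners.isSmooth_of_comp_immersion hi.1 _ (by rw [h1]; exact hi'.1.1))
      (GCorners.isSmooth_of_comp_immersion hi'.1 _ (by rw [h2]; exact hi.1.1)) fun z => ?_
    exact (φ.apply_symm_apply (ψ z)).symm
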